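/- **Conventions.** $\mathrm{PSL}(2,\mathbb C)$ acts on the Riemann sphere $\hat{\mathbb C}$ by Möbius transformations; square brackets denote the class of a matrix. The cross ratio is normalized by $cr(\infty,0,1,z)=z$. The order $|T|$ of a Möbius transformation is its usual order if this is finite, and $|T|=\infty$ means that $T$ is parabolic. A signature $\sigma=(0,3;\nu_1,\nu_2,\nu_3)$ with $\nu_j\in\{2,3,\dots\}\cup\{\infty\}$ is hyperbolic if $1-\sum_j 1/\nu_j>0$ (with $1/\infty=0$). A triangle group of signature $\sigma$ is a Kleinian group generated by two Möbius transformations $X,Y$ with $|X|=\nu_1$, $|Y|=\nu_2$, $|XY|=\nu_3$ which is conjugate in $\mathrm{PSL}(2,\mathbb C)$ to the group of orientation preserving elements of the group generated by the reflections in the sides of a hyperbolic triangle with angles $\pi/\nu_1,\pi/\nu_2,\pi/\nu_3$ (a vertex with $\nu_j=\infty$ is an ideal vertex). An element $A$ of a group $G$ is primitive if, whenever $A=B^n$ with $B\in G$, $n\in\mathbb Z$, the elements $A$ and $B$ generate the same cyclic group. An elliptic transformation of finite order $q$ is geometric if it is conjugate in $\mathrm{PSL}(2,\mathbb C)$ to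 $z\mapsto e^{\pm2\pi i/q}z$. For distinct $a,b,c\in\hat{\mathbb C}$ let $\Lambda$ be the circle through $a,b,c$, let $\Delta=\{z\in\hat{\mathbb C}:\operatorname{Im} cr(a,b,c,z)>0\}$, and let $L$ and $L'$ be the circles orthogonal to $\Lambda$ through $a,b$ and through $a,c$, respectively. Distinct points $z_1,z_2\in L\cap\overline\Delta$ are well ordered with respect to $(a,b,c)$ if $z_1=a$, or $z_2=b$, or $z_1\ne a$, $z_2\neq b$ and $cr(a,z_1,z_2,b)$ is real and greater than $1$. Let $\Gamma$ be a triangle group of hyperbolic signature $\sigma$ with limit set $\Lambda$. Then $(A,B)$ are canonical generators of $\Gamma$ for the parameters $(a,b,c)$ if $A,B$ generate $\Gamma$ and 1. $|A|=\nu_1$, $|B|=\nu_2$, $|AB|=\nu_3$; 2. the fixed points of $A$ and of $B$ lie on $L$, those of $AB$ on $L'$; 3. the fixed points $z_1$ of $A$ and $z_2$ of $B$ on $L\cap\overline\Delta$ are distinct and well ordered with respect to $(a,b,c)$; 4. $A$ and $B$ are primitive elements of $\Gamma$, and geometric whenever elliptic. **Theorem 3.** Let $a,b,c$ be three distinct points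 of the Riemann sphere and let $\sigma=(0,3;\nu_1,\nu_2,\nu_3)$ be a hyperbolic signature. There exists a unique pair $(A,B)$ of Möbius transformations that are canonical generators, for the parameters $(a,b,c)$, of a triangle group of signature $\sigma$. For $(a,b,c)=(\infty,0,1)$ these generators are given as follows, with $q_j=\cos(\pi/\nu_j)$ and $p_j=\sin(\pi/\nu_j)$. (1) For the signature $(0,3;\infty,\nu_1,\nu_2)$, $\nu_i\le\infty$: $$A=\begin{bmatrix}-1&-2\\0&-1\end{bmatrix},\qquad B=\begin{bmatrix}-q_1&b\\q_1+q_2&-q_1\end{bmatrix},\qquad b=\frac{q_1^2-1}{q_1+q_2}.$$ (2) For the signature $(0,3;\nu_1,\nu_2,\nu_3)$ with all $\nu_i$ finite: $q_1^2+q_2^2+q_3^2+2q_1q_2q_3-1>0$ and $$A=\begin{bmatrix}-q_1&-kp_1\\k^{-1}p_1&-q_1\end{bmatrix},\qquad B=\begin{bmatrix}-q_2&-hp_2\\h^{-1}p_2&-q_2\end{bmatrix},$$ where $$k=\frac{q_2+q_1q_3+q_1l}{p_1l},\qquad h=\frac{kp_1p_2}{q_1q_2+q_3+l},\qquad l=\sqrt{q_1^2+q_2^2+q_3^2+2q_1q_2q_3-1}>0.$$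 For any distinct $a,b,c$ there is a unique Möbius transformation $T$ that maps $a,b,c$ to $\infty,0,1$, respectively; if $(A,B)$ are the canonical generators for $(\infty,0,1)$ and a hyperbolic signature $\sigma$, then $(T^{-1}AT,\,T^{-1}BT)$ are the canonical generators for $(a,b,c)$ and $\sigma$. -/

import Mathlib

open scoped MatrixGroups OnePoint ComplexConjugate

noncomputable section

namespace TriangleGroups

/-! ### Moebius transformations of the Riemann sphere `OnePoint ℂ` -/

/-- The action of `SL(2, ℂ)` on the Riemann sphere by fractional linear transformations. -/
def slAction : SL(2, ℂ) →* Equiv.Perm (OnePoint ℂ) :=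
  (MulAction.toPermHom (GL (Fin 2) ℂ) (OnePoint ℂ)).comp Matrix.SpecialLinearGroup.toGL

theorem slAction_center (A : SL(2, ℂ)) (hA : A ∈ Subgroup.center SL(2, ℂ)) :
    slAction A = 1 := by
  obtain ⟨r, hr, hrA⟩ := Matrix.SpecialLinearGroup.mem_center_iff.mp hA
  have h00 : A.1 0 0 = r := by rw [← hrA]; simp
  have h01 : A.1 0 1 = 0 := by rw [← hrA]; simp
  have h10 : A.1 1 0 = 0 := by rw [← hrA]; simp
  have h11 : A.1 1 1 = r := by rw [← hrA]; simp
  have hr0 : r ≠ 0 := by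
    rintro rfl
    simp at hr
  ext z
  cases z with
  | infty =>
    change Matrix.SpecialLinearGroup.toGL A • (∞ : OnePoint ℂ) = ∞
    rw [OnePoint.smul_infty_eq_ite]
    simp [h10]
  | coe z =>
    change Matrix.SpecialLinearGroup.toGL A • (z : OnePoint ℂ) = z
    rw [OnePoint.smul_some_eq_ite]
    simp [h00, h01, h10, h11, hr0]

/-- The group `PSL(2, ℂ)` as a group of transformations of the Riemann sphere:
the class of `!![a, b; c, d]` acts as `z ↦ (a z + b) / (c z + d)`. -/
def mobius : PSL(2, ℂ) →* Equiv.Perm (OnePoint ℂ) :=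
  QuotientGroup.lift (Subgroup.center SL(2, ℂ)) slAction slAction_center

/-! ### Cross ratio -/

/-- Homogeneous coordinates of a point of the sphere. -/
def homog : OnePoint ℂ → ℂ × ℂ
  | none => (1, 0)
  | some z => (z, 1)

/-- The determinant of the homogeneous coordinates of two points; for finite points it is
their difference. -/
def bracket (x y : OnePoint ℂ) : ℂ :=
  (homog x).1 * (homog y).2 - (homog y).1 * (homog x).2

open Classical in
/-- The cross ratio `(w - y) (z - x) / ((w - x) (z - y))` of four points of the sphere,
normalized by `crossRatio ∞ 0 1 w = w`. -/
def crossRatio (x y z w : OnePoint ℂ) : OnePoint ℂ :=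
  if bracket w x * bracket z y = 0 then ∞
  else (((bracket w y * bracket z x) / (bracket w x * bracket z y) : ℂ) : OnePoint ℂ)

/-! ### Circles on the Riemann sphere -/

/-- A circle on the Riemann sphere, given by an equation
`α |z|² + β conj z + conj β z + γ = 0` with `α`, `γ` real and `α γ < |β|²`
(a Euclidean circle for `α ≠ 0`, a straight line together with `∞` for `α = 0`). -/
structure SphereCircle where
  α : ℝ
  β : ℂ
  γ : ℝ
  nondeg : α * γ < Complex.normSq β

namespace SphereCircle

/-- The set of points of a circle. -/
def points (C : SphereCircle) : Set (OnePoint ℂ) :=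
  {x | (x = ∞ ∧ C.α = 0) ∨
    ∃ z : ℂ, x = z ∧ C.α * Complex.normSq z + 2 * (conj C.β * z).re + C.γ = 0}

/-- Orthogonality of circles. For two Euclidean circles with centres `c₁`, `c₂` and radii
`r₁`, `r₂` it says `|c₁ - c₂|² = r₁² + r₂²`. -/
def Orthogonal (C D : SphereCircle) : Prop :=
  2 * (C.β * conj D.β).re = C.α * D.γ + D.α * C.γ

/-- The extended real line. -/
def realLine : SphereCircle where
  α := 0
  β := Complex.I
  γ := 0
  nondeg := by simp

/-- The matrix of the reflection in a circle, which is
`z ↦ (-β conj z - γ) / (α conj z + conj β)`. -/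
def reflectionMatrix (C : SphereCircle) : GL (Fin 2) ℂ :=
  Matrix.GeneralLinearGroup.mkOfDetNeZero !![-C.β, -(C.γ : ℂ); (C.α : ℂ), conj C.β] (by
    have h := C.nondeg
    rw [Matrix.det_fin_two_of, neg_mul, Complex.mul_conj, neg_mul, sub_neg_eq_add]
    have h2 : -((Complex.normSq C.β : ℝ) : ℂ) + (C.γ : ℂ) * (C.α : ℂ)
        = ((-Complex.normSq C.β + C.γ * C.α : ℝ) : ℂ) := by push_cast; ring
    rw [h2]
    exact_mod_cast (by nlinarith : -Complex.normSq C.β + C.γ * C.α ≠ 0))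

/-- The reflection (inversion) in a circle of the sphere. -/
def reflection (C : SphereCircle) : Equiv.Perm (OnePoint ℂ) :=
  MulAction.toPerm C.reflectionMatrix * Complex.conjCLE.toHomeomorph.onePointCongr.toEquiv

end SphereCircle

/-! ### Kleinian groups -/

/-- The set of discontinuity of a group of Moebius transformations: the points with a
neighbourhood `U` that meets only finitely many of its translates. -/
def discontinuitySet (Γ : Subgroup PSL(2, ℂ)) : Set (OnePoint ℂ) :=
  {x | ∃ U : Set (OnePoint ℂ), IsOpen U ∧ x ∈ U ∧
    {g : PSL(2, ℂ) | g ∈ Γ ∧ (mobius g '' U ∩ U).Nonempty}.Finite}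

/-- A Kleinian group acts discontinuously somewhere on the sphere. -/
def IsKleinian (Γ : Subgroup PSL(2, ℂ)) : Prop :=
  (discontinuitySet Γ).Nonempty

/-- The limit set of a Kleinian group. -/
def limitSet (Γ : Subgroup PSL(2, ℂ)) : Set (OnePoint ℂ) :=
  (discontinuitySet Γ)ᶜ

/-! ### Types of elements -/

/-- A parabolic transformation: it has exactly one fixed point on the sphere. -/
def IsParabolic (A : PSL(2, ℂ)) : Prop :=
  ∃! z : OnePoint ℂ, mobius A z = z

/-- `A` has order `n`, where parabolic transformations, and only these, are counted as having
order `∞`. -/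
def HasOrder (A : PSL(2, ℂ)) (n : ℕ∞) : Prop :=
  (n = ⊤ ∧ IsParabolic A) ∨ (n ≠ ⊤ ∧ IsOfFinOrder A ∧ (orderOf A : ℕ∞) = n)

/-- `A` is conjugate in `PSL(2, ℂ)` to `z ↦ c z`. -/
def IsConjToScaling (A : PSL(2, ℂ)) (c : ℂ) : Prop :=
  ∃ S : PSL(2, ℂ), ∀ z : ℂ, mobius (S * A * S⁻¹) (z : OnePoint ℂ) = ((c * z : ℂ) : OnePoint ℂ)

/-- An elliptic transformation: a nontrivial one conjugate to a rotation. -/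
def IsElliptic (A : PSL(2, ℂ)) : Prop :=
  ∃ c : ℂ, ‖c‖ = 1 ∧ c ≠ 1 ∧ IsConjToScaling A c

/-- A geometric elliptic transformation: it has finite order `n` and is conjugate to one of
the minimal rotations `z ↦ exp (± 2 π i / n) z`. -/
def IsGeometric (A : PSL(2, ℂ)) : Prop :=
  IsOfFinOrder A ∧
    (IsConjToScaling A (Complex.exp (2 * Real.pi * Complex.I / (orderOf A : ℂ))) ∨
      IsConjToScaling A (Complex.exp (-(2 * Real.pi * Complex.I / (orderOf A : ℂ)))))

/-- `A` is a primitive element of `Γ`: whenever `A` is a power of an element `B` of `Γ`, then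
`B` generates the same cyclic group as `A` (for `A` of infinite order: `B = A` or `B = A⁻¹`). -/
def IsPrimitive (Γ : Subgroup PSL(2, ℂ)) (A : PSL(2, ℂ)) : Prop :=
  A ∈ Γ ∧ ∀ B ∈ Γ, ∀ n : ℤ, B ^ n = A → Subgroup.zpowers B = Subgroup.zpowers A

/-! ### Signatures -/

/-- The number `1 / n`, where `1 / ∞ = 0`. -/
def recip (n : ℕ∞) : ℝ :=
  if n = ⊤ then 0 else 1 / (n.toNat : ℝ)

/-- `(0, 3; ν₁, ν₂, ν₃)` is a hyperbolic signature. -/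
def IsHyperbolicSignature (ν : Fin 3 → ℕ∞) : Prop :=
  (∀ j, 2 ≤ ν j) ∧ 0 < 2 * (0 : ℝ) - 2 + 3 - ∑ j, recip (ν j)

/-- `cos (π / n)` -/
def cosPi (n : ℕ∞) : ℝ := Real.cos (Real.pi * recip n)

/-- `sin (π / n)` -/
def sinPi (n : ℕ∞) : ℝ := Real.sin (Real.pi * recip n)

/-! ### Hyperbolic triangles and triangle groups -/

/-- The image of `x` under the transformation `z ↦ (z - w) / (z - conj w)`, which maps the upper
half-plane onto the unit disc and `w` to `0`. The hyperbolic rays that start from `w` are mapped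
to Euclidean radii. -/
def centered (w : ℂ) : OnePoint ℂ → ℂ
  | none => 1
  | some z => (z - w) / (z - conj w)

/-- The hyperbolic angle at the point `w` of the upper half-plane between the geodesics from `w`
to the points `x` and `y` of the closed half-plane (points at infinity included). -/
def angleAt (w : ℂ) (x y : OnePoint ℂ) : ℝ :=
  InnerProductGeometry.angle (centered w x) (centered w y)

/-- `v 0, v 1, v 2` are the vertices of a hyperbolic triangle in the upper half-plane whose angle
at `v j` is `π / ν j`; the vertices with `ν j = ∞` are ideal vertices (points of the extended
real line), with angle `0`. -/
structure IsTriangle (v : Fin 3 → OnePoint ℂ) (ν : Fin 3 → ℕ∞) : Prop where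
  injective : Function.Injective v
  ideal : ∀ j, ν j = ⊤ → v j ∈ SphereCircle.realLine.points
  finite : ∀ j, ν j ≠ ⊤ → ∃ w : ℂ, v j = w ∧ 0 < w.im ∧
    angleAt w (v (j + 1)) (v (j + 2)) = Real.pi * recip (ν j)

/-- The circle `S j` carries the side of the triangle opposite to the vertex `v j`. -/
def AreSides (S : Fin 3 → SphereCircle) (v : Fin 3 → OnePoint ℂ) : Prop :=
  ∀ j, (S j).Orthogonal SphereCircle.realLine ∧
    v (j + 1) ∈ (S j).points ∧ v (j + 2) ∈ (S j).points

/-- The Moebius transformations in the group generated by the reflections in three circles. -/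
def orientationPreserving (S : Fin 3 → SphereCircle) : Subgroup PSL(2, ℂ) :=
  (Subgroup.closure (Set.range fun j => (S j).reflection)).comap mobius

/-- `Γ` is a triangle group of signature `(0, 3; ν₁, ν₂, ν₃)`: a Kleinian group generated by two
transformations `X`, `Y` with `|X| = ν₁`, `|Y| = ν₂`, `|X Y| = ν₃`, which is, up to conjugation
in `PSL(2, ℂ)`, the group of orientation preserving elements of the group generated by the
reflections in the sides of a hyperbolic triangle with angles `π / ν₁`, `π / ν₂`, `π / ν₃`. -/
structure IsTriangleGroup (Γ : Subgroup PSL(2, ℂ)) (ν : Fin 3 → ℕ∞) : Prop where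
  kleinian : IsKleinian Γ
  generated : ∃ X Y : PSL(2, ℂ), Γ = Subgroup.closure {X, Y} ∧
    HasOrder X (ν 0) ∧ HasOrder Y (ν 1) ∧ HasOrder (X * Y) (ν 2)
  triangle : ∃ (v : Fin 3 → OnePoint ℂ) (S : Fin 3 → SphereCircle) (T : PSL(2, ℂ)),
    IsTriangle v ν ∧ AreSides S v ∧
      Γ = (orientationPreserving S).map (MulAut.conj T).toMonoidHom

/-! ### Canonical generators -/

/-- The disc `Δ` of the points `z` with `Im (cr (a, b, c, z)) > 0`. -/
def disc (a b c : OnePoint ℂ) : Set (OnePoint ℂ) :=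
  {z | ∃ w : ℂ, crossRatio a b c z = w ∧ 0 < w.im}

/-- The distinct points `z₁` and `z₂` are well ordered with respect to `(a, b, c)`. -/
def WellOrdered (a b : OnePoint ℂ) (z₁ z₂ : OnePoint ℂ) : Prop :=
  z₁ ≠ z₂ ∧ (z₁ = a ∨ z₂ = b ∨
    (z₁ ≠ a ∧ z₂ ≠ b ∧ ∃ t : ℝ, 1 < t ∧ crossRatio a z₁ z₂ b = ((t : ℂ) : OnePoint ℂ)))

/-- `(A, B)` are canonical generators of `Γ` (a triangle group of signature
`(0, 3; ν₁, ν₂, ν₃)`) for the parameters `(a, b, c)`. Here `Λ` is the circle through `a, b, c`,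
and `L`, `L'` are the circles orthogonal to `Λ` through `a, b` and through `a, c`. -/
def IsCanonicalFor (a b c : OnePoint ℂ) (ν : Fin 3 → ℕ∞) (Γ : Subgroup PSL(2, ℂ))
    (A B : PSL(2, ℂ)) : Prop :=
  ∃ Λ L L' : SphereCircle,
    (a ∈ Λ.points ∧ b ∈ Λ.points ∧ c ∈ Λ.points) ∧
    (L.Orthogonal Λ ∧ a ∈ L.points ∧ b ∈ L.points) ∧
    (L'.Orthogonal Λ ∧ a ∈ L'.points ∧ c ∈ L'.points) ∧
    limitSet Γ = Λ.points ∧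
    Γ = Subgroup.closure {A, B} ∧
    (HasOrder A (ν 0) ∧ HasOrder B (ν 1) ∧ HasOrder (A * B) (ν 2)) ∧
    ((∀ z, mobius A z = z → z ∈ L.points) ∧ (∀ z, mobius B z = z → z ∈ L.points) ∧
      (∀ z, mobius (A * B) z = z → z ∈ L'.points)) ∧
    (∃ z₁ ∈ L.points ∩ closure (disc a b c), ∃ z₂ ∈ L.points ∩ closure (disc a b c),
      mobius A z₁ = z₁ ∧ mobius B z₂ = z₂ ∧ WellOrdered a b z₁ z₂) ∧
    (IsPrimitive Γ A ∧ IsPrimitive Γ B) ∧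
    ((IsElliptic A → IsGeometric A) ∧ (IsElliptic B → IsGeometric B))

/-- `(A, B)` are canonical generators, for the parameters `(a, b, c)`, of some triangle group of
signature `(0, 3; ν₁, ν₂, ν₃)`. -/
def IsCanonicalPair (a b c : OnePoint ℂ) (ν : Fin 3 → ℕ∞) (A B : PSL(2, ℂ)) : Prop :=
  ∃ Γ : Subgroup PSL(2, ℂ), IsTriangleGroup Γ ν ∧ IsCanonicalFor a b c ν Γ A B

/-- The class in `PSL(2, ℂ)` of the real matrix `M` is `A`; in particular `det M = 1`. -/
def IsClassOf (A : PSL(2, ℂ)) (M : Matrix (Fin 2) (Fin 2) ℝ) : Prop :=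
  ∃ N : SL(2, ℂ), N.1 = M.map Complex.ofReal ∧ A = QuotientGroup.mk N

/-- `l² = q₁² + q₂² + q₃² + 2 q₁ q₂ q₃ - 1`. -/
def lSq (ν : Fin 3 → ℕ∞) : ℝ :=
  cosPi (ν 0) ^ 2 + cosPi (ν 1) ^ 2 + cosPi (ν 2) ^ 2 +
    2 * cosPi (ν 0) * cosPi (ν 1) * cosPi (ν 2) - 1

/-- `k = (q₂ + q₁ q₃ + q₁ l) / (p₁ l)`. -/
def kParam (ν : Fin 3 → ℕ∞) : ℝ :=
  (cosPi (ν 1) + cosPi (ν 0) * cosPi (ν 2) + cosPi (ν 0) * √(lSq ν)) /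
    (sinPi (ν 0) * √(lSq ν))

/-- `h = k p₁ p₂ / (q₁ q₂ + q₃ + l)`. -/
def hParam (ν : Fin 3 → ℕ∞) : ℝ :=
  kParam ν * sinPi (ν 0) * sinPi (ν 1) /
    (cosPi (ν 0) * cosPi (ν 1) + cosPi (ν 2) + √(lSq ν))

end TriangleGroups

end

/-! Real traceless 2×2 matrices with the quadratic form −det are a Lorentzian space of signature
(2,1). Vectors of norm one are the normals of geodesics of the upper half-plane, vectors of negative
norm are its points, isotropic vectors are the points of the extended real line, and a real matrix
acts by conjugation. A hyperbolic triangle with angles π/νᵢ becomes a triple of unit normals with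
pairings −cos(π/νᵢ) (`IsMirrorTriple`). The Gram determinant is −l², and hyperbolicity is the reason
for l² > 0. The dual basis represents the vertices. The triangle group is the group of even words in
the three mirrors (`evenGroup`).

The geometry of this group comes from Tits's induction on the length of words (`side_and_sector`):
no mirror cuts an image of the closed chamber, and the image lies on the negative side of a mirror
only if that reflection shortens the word. Three consequences are used. Elements fixing a point of
the chamber are products of the reflections whose mirrors contain it (`stabilizer`). Pairings
between images of the vertices are largest in the chamber itself, which bounds distances of vertices
from below (`form_wordAct_dual_le`, `form_wordAct_dual_self_le`). The group is discrete, since a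
word of length n pushes the sum of the dual basis away by at least 2n (`finite_weylVector`).
Discreteness allows a causal vector to be moved into the chamber by minimizing along its orbit
(`exists_mem_chamber`). Applied to isotropic vectors this shows that no real point is a point of
discontinuity, so the limit set is the extended real line; applied to the fixed vector of an
elliptic or parabolic element it shows that the element is conjugate to a power of a rotation about
a vertex (`exists_conj_rotation`).

Existence for (∞, 0, 1): the imaginary axis is taken as the side that joins the fixed points of A
and B, and two further explicit mirrors complete the triangle. A and B are products of two mirrors
each; all conditions are checked on their matrices.

Uniqueness for (∞, 0, 1): if the limit set is the real line, the group is again given by real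
mirrors. A and B, normalized to traces −2q₁ and −2q₂, have equal diagonal entries because their
fixed points lie on the imaginary axis, so four unknowns a₁, c₁, a₂, c₂ remain. Primitivity makes A
and B rotations about vertices, whose distance is bounded below: |a₁c₂ + c₁a₂| ≥ 2(q₁q₂ + q₃)
(`le_sq_form`). The order of AB gives only |tr AB| ≤ 2q₃, the opposite estimate. Hence equality
holds, up to replacing A or B by its negative when its trace is zero. Together with the position of
the fixed points of AB on Re z = 1 and the well ordering, the equations have one solution
(`IsHyperbolicSignature.solve`).

All notions are invariant under conjugation (`IsCanonicalPair.conj`), so the transformation taking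
a, b, c to ∞, 0, 1 reduces the general case to this one. -/

noncomputable section

namespace TriangleGroups

/-! ### Groups generated by reflections -/

/-- The values `sin (k θ) / sin θ`, as polynomials in `q = cos θ`. -/
def sinRatio (q : ℝ) : ℕ → ℝ
  | 0 => 0
  | 1 => 1
  | n + 2 => 2 * q * sinRatio q (n + 1) - sinRatio q n

/-- The word `i j i j …` of length `n`. -/
def alternating {ι : Type*} (i j : ι) : ℕ → List ι
  | 0 => []
  | n + 1 => i :: alternating j i n

@[simp] theorem length_alternating {ι : Type*} (i j : ι) (n : ℕ) :
    (alternating i j n).length = n := by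
  induction n generalizing i j with
  | zero => rfl
  | succ n ih => simp [alternating, ih]

/-- The element of a group given by a word in generators. -/
def wordProd {ι W : Type*} [Group W] (s : ι → W) (L : List ι) : W := (L.map s).prod

section
variable {ι W : Type*} [Group W] (s : ι → W)

@[simp] theorem wordProd_nil : wordProd s [] = 1 := rfl

@[simp] theorem wordProd_cons (i : ι) (L : List ι) :
    wordProd s (i :: L) = s i * wordProd s L := by simp [wordProd]

@[simp] theorem wordProd_append (L L' : List ι) :
    wordProd s (L ++ L') = wordProd s L * wordProd s L' := by simp [wordProd]

/-- A word of minimal length among those that give the same element. -/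
def IsReduced (L : List ι) : Prop :=
  ∀ L', wordProd s L' = wordProd s L → L.length ≤ L'.length

theorem exists_isReduced (L : List ι) :
    ∃ L', IsReduced s L' ∧ wordProd s L' = wordProd s L := by
  classical
  have h : ∃ n, ∃ L', L'.length = n ∧ wordProd s L' = wordProd s L := ⟨_, L, rfl, rfl⟩
  obtain ⟨L', h1, h2⟩ := Nat.find_spec h
  refine ⟨L', fun L'' h'' => ?_, h2⟩
  rw [h1]
  exact Nat.find_min' h ⟨L'', rfl, h''.trans h2⟩

theorem IsReduced.of_cons {s : ι → W} {i : ι} {L : List ι} (h : IsReduced s (i :: L)) :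
    IsReduced s L := by
  intro L' h'
  have := h (i :: L') (by simp [h'])
  simpa using this

theorem wordProd_reverse {s : ι → W} (sq : ∀ i, s i * s i = 1) (L : List ι) :
    wordProd s L.reverse = (wordProd s L)⁻¹ := by
  induction L with
  | nil => simp
  | cons i L ih => simp [ih, inv_eq_of_mul_eq_one_right (sq i)]

end

/-! ### Reflections in a quadratic space and Tits's induction on the length of words -/

section
variable {ι V W : Type*} [AddCommGroup V] [Module ℝ V] [Group W]

/-- Reflections in a quadratic space, with angles between the mirrors that are either `π / m`,
with a braid relation of length `m`, or zero. -/
structure IsReflectionSystem (B : LinearMap.BilinForm ℝ V) (α : ι → V)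
    (π : W →* Module.End ℝ V) (s : ι → W) : Prop where
  symm : ∀ v w, B v w = B w v
  norm : ∀ i, B (α i) (α i) = 1
  act : ∀ i v, π (s i) v = v - (2 * B v (α i)) • α i
  sq : ∀ i, s i * s i = 1
  dihedral : ∀ i j, i ≠ j → ∃ m : ℕ∞, m ≠ 0 ∧
    (∀ k : ℕ, k ≤ m → 0 ≤ sinRatio (-B (α i) (α j)) k) ∧
    ∀ n : ℕ, m = n → wordProd s (alternating i j n) = wordProd s (alternating j i n)

/-- The closed chamber. -/
def chamber (B : LinearMap.BilinForm ℝ V) (α : ι → V) : Set V := {d | ∀ i, 0 ≤ B d (α i)}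

namespace IsReflectionSystem
variable {B : LinearMap.BilinForm ℝ V} {α : ι → V} {π : W →* Module.End ℝ V} {s : ι → W}

theorem act_self (h : IsReflectionSystem B α π s) (i : ι) (v : V) :
    B (π (s i) v) (α i) = - B v (α i) := by
  rw [h.act]; simp [h.norm]; ring

theorem act_other (h : IsReflectionSystem B α π s) (i j : ι) (v : V) :
    B (π (s j) v) (α i) = B v (α i) + 2 * (-B (α i) (α j)) * B v (α j) := by
  rw [h.act]; simp [h.symm (α j) (α i)]; ring

theorem act_act (h : IsReflectionSystem B α π s) (i : ι) (v : V) :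
    π (s i) (π (s i) v) = v := by
  rw [← Module.End.mul_apply, ← map_mul, h.sq, map_one, Module.End.one_apply]

theorem bilin_act (h : IsReflectionSystem B α π s) (i : ι) (v w : V) :
    B (π (s i) v) w = B v (π (s i) w) := by
  rw [h.act, h.act]; simp [h.symm (α i) w]; ring

theorem bilin_act_act (h : IsReflectionSystem B α π s) (i : ι) (v w : V) :
    B (π (s i) v) (π (s i) w) = B v w := by
  rw [h.bilin_act, h.act_act]

theorem bilin_word (h : IsReflectionSystem B α π s) (L : List ι) (v w : V) :
    B (π (wordProd s L) v) (π (wordProd s L) w) = B v w := by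
  induction L with
  | nil => simp
  | cons i L ih => simp [h.bilin_act_act, ih]

theorem bilin_word_left (h : IsReflectionSystem B α π s) (L : List ι) (v w : V) :
    B (π (wordProd s L) v) w = B v (π (wordProd s L.reverse) w) := by
  rw [← h.bilin_word L v, wordProd_reverse h.sq, ← Module.End.mul_apply (π _), ← map_mul]
  simp

/-- A letter s_j adds 2q times the α_j coordinate to the α_i coordinate and reverses the former,
with q = −B(α_i, α_j). This is the recursion of `sinRatio`; each further letter exchanges the roles
of i and j, whence the parity. -/
theorem bilin_alternating (h : IsReflectionSystem B α π s) (k : ℕ) : ∀ (i j : ι) (y : V),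
    B (π (wordProd s (alternating j i k)) y) (α i) =
      if Even k then sinRatio (-B (α i) (α j)) (k + 1) * B y (α i) +
        sinRatio (-B (α i) (α j)) k * B y (α j)
      else sinRatio (-B (α i) (α j)) k * B y (α i) +
        sinRatio (-B (α i) (α j)) (k + 1) * B y (α j) := by
  induction k using Nat.twoStepInduction with
  | zero => intro i j y; simp [alternating, sinRatio]
  | one => intro i j y; simp [alternating, sinRatio, h.act_other]
  | more k ih1 ih2 =>
    intro i j y
    rw [alternating, wordProd_cons, map_mul, Module.End.mul_apply, h.act_other, ih2 j i y,
      alternating, wordProd_cons, map_mul, Module.End.mul_apply, h.act_self, ih1 i j y,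
      h.symm (α j) (α i)]
    rcases Nat.even_or_odd k with hk | hk
    · have h1 : ¬ Even (k + 1) := by simpa [parity_simps] using hk
      have h2 : Even (k + 1 + 1) := by simpa [parity_simps] using hk
      rw [if_pos hk, if_neg h1, if_pos h2]
      simp only [sinRatio]; ring
    · have hk' : ¬ Even k := by simpa using hk
      have h1 : Even (k + 1) := by simpa [parity_simps] using hk
      have h2 : ¬ Even (k + 1 + 1) := by simpa [parity_simps] using hk
      rw [if_neg hk', if_pos h1, if_neg h2]
      simp only [sinRatio]; ring

/-- As long as the coefficients are nonnegative, an alternating word that begins with the other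
mirror keeps the sector of the two mirrors on the nonnegative side of α_i. -/
theorem bilin_alternating_nonneg (h : IsReflectionSystem B α π s) {k : ℕ} {i j : ι} {y : V}
    (h0 : 0 ≤ sinRatio (-B (α i) (α j)) k) (h1 : 0 ≤ sinRatio (-B (α i) (α j)) (k + 1))
    (hi : 0 ≤ B y (α i)) (hj : 0 ≤ B y (α j)) :
    0 ≤ B (π (wordProd s (alternating j i k)) y) (α i) := by
  rw [h.bilin_alternating]
  split_ifs <;> positivity

/-- Every mirror has each chamber on one of its sides, the negative one only if the reflection
shortens the word. -/
def SideProperty (B : LinearMap.BilinForm ℝ V) (α : ι → V) (π : W →* Module.End ℝ V)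
    (s : ι → W) (n : ℕ) : Prop :=
  ∀ L, IsReduced s L → L.length = n → ∀ i,
    (∀ d ∈ chamber B α, 0 ≤ B (π (wordProd s L) d) (α i)) ∨
    ((∀ d ∈ chamber B α, B (π (wordProd s L) d) (α i) ≤ 0) ∧
      ∃ L', L'.length + 1 = n ∧ wordProd s L' = s i * wordProd s L)

/-- Every chamber lies in a sector of the dihedral group of two mirrors. -/
def SectorProperty (B : LinearMap.BilinForm ℝ V) (α : ι → V) (π : W →* Module.End ℝ V)
    (s : ι → W) (n : ℕ) : Prop :=
  ∀ L, IsReduced s L → L.length = n → ∀ i j, i ≠ j → ∀ m : ℕ∞,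
    (∀ n : ℕ, m = n → wordProd s (alternating i j n) = wordProd s (alternating j i n)) → m ≠ 0 →
    ∃ a b, ((a = i ∧ b = j) ∨ (a = j ∧ b = i)) ∧ ∃ (k : ℕ) (L' : List ι), (k : ℕ∞) ≤ m ∧
      wordProd s L = wordProd s (alternating a b k) * wordProd s L' ∧
      n = k + L'.length ∧
      (∀ d ∈ chamber B α, 0 ≤ B (π (wordProd s L') d) (α i)) ∧
      (∀ d ∈ chamber B α, 0 ≤ B (π (wordProd s L') d) (α j))

theorem mul_cancel (h : IsReflectionSystem B α π s) (i : ι) (w : W) : s i * (s i * w) = w := by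
  rw [← mul_assoc, h.sq, one_mul]

/-- For a reduced word s_j L with i ≠ j, the element of L is a dihedral word in s_i, s_j times an
element X that maps the chamber into the sector of both mirrors. Reducedness forces the dihedral
word to begin with s_i, so s_j prolongs it and `bilin_alternating` gives the sign. The side becomes
negative only when the longest dihedral element is reached, and then the braid relation lets the
word begin with s_i, so that s_i shortens it. -/
theorem sideProperty_succ (h : IsReflectionSystem B α π s) {n : ℕ}
    (hP : SideProperty B α π s n) (hQ : SectorProperty B α π s n) :
    SideProperty B α π s (n + 1) := by
  rintro (_ | ⟨j, L⟩) hL hn i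
  · simp at hn
  have hn' : L.length = n := by simpa using hn
  by_cases hij : i = j
  · subst hij
    right
    rcases hP L hL.of_cons hn' i with h1 | ⟨-, L', h2, h3⟩
    · refine ⟨fun d hd => ?_, L, by rw [hn'], by simp [h.mul_cancel]⟩
      simpa [h.act_self] using h1 d hd
    · have := hL L' (by simp [h3])
      simp at this; omega
  obtain ⟨m, hm0, hU, hbr⟩ := h.dihedral i j hij
  obtain ⟨a, b, hab, k, X, hkm, hX, hlen, hXi, hXj⟩ := hQ L hL.of_cons hn' i j hij m hbr hm0
  -- If the dihedral word could also begin with `j`, the letter in front would cancel against it and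
  -- `j :: L` would not be reduced.
  have hfirst : ∀ k', k = k' + 1 →
      wordProd s (alternating a b k) ≠ wordProd s (alternating j i k) := by
    rintro k' rfl heq
    have := hL (alternating i j k' ++ X) (by
      rw [wordProd_cons, hX, heq, alternating, wordProd_cons, wordProd_append, mul_assoc,
        h.mul_cancel])
    simp at this; omega
  have haij : wordProd s (alternating a b k) = wordProd s (alternating i j k) := by
    cases k with
    | zero => rfl
    | succ k =>
      rcases hab with ⟨rfl, rfl⟩ | ⟨rfl, rfl⟩
      · rfl
      · exact absurd rfl (hfirst k rfl)
  have hw : wordProd s (j :: L) = wordProd s (alternating j i (k + 1)) * wordProd s X := by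
    rw [wordProd_cons, hX, haij, alternating, wordProd_cons, mul_assoc]
  -- At length m the braid relation would let the word begin with `j`.
  have hkm' : (k : ℕ∞) < m := by
    refine lt_of_le_of_ne hkm ?_
    rintro rfl
    cases k with
    | zero => simp at hm0
    | succ k => exact hfirst k rfl (haij.trans (hbr _ rfl))
  have hk1 : ((k + 1 : ℕ) : ℕ∞) ≤ m := by exact_mod_cast Order.add_one_le_of_lt hkm'
  rcases eq_or_lt_of_le hk1 with hk2 | hk2
  · right
    have hbr' := hbr (k + 1) hk2.symm
    have hs : s i * wordProd s (j :: L) = wordProd s (alternating j i k) * wordProd s X := by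
      rw [hw, ← hbr', alternating, wordProd_cons, mul_assoc, h.mul_cancel]
    refine ⟨fun d hd => ?_, alternating j i k ++ X, by simp; omega, by rw [hs, wordProd_append]⟩
    have h4 : 0 ≤ B (π (s i * wordProd s (j :: L)) d) (α i) := by
      rw [hs, map_mul, Module.End.mul_apply]
      exact h.bilin_alternating_nonneg (hU _ hkm) (hU _ hk1) (hXi d hd) (hXj d hd)
    rw [map_mul, Module.End.mul_apply, h.act_self] at h4
    linarith
  · left
    intro d hd
    rw [hw, map_mul, Module.End.mul_apply]
    exact h.bilin_alternating_nonneg (hU _ hk1)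
      (hU _ (by exact_mod_cast Order.add_one_le_of_lt hk2)) (hXi d hd) (hXj d hd)

/-- If the chamber is on the nonnegative side of both mirrors, k = 0 works. Otherwise one of the two
reflections shortens the word; it is split off, the shorter word is decomposed by induction, and the
letter is put back in front of the dihedral part. -/
theorem sectorProperty_succ (h : IsReflectionSystem B α π s) {n : ℕ}
    (hP : SideProperty B α π s (n + 1)) (hQ : SectorProperty B α π s n) :
    SectorProperty B α π s (n + 1) := by
  have key : ∀ L, IsReduced s L → L.length = n + 1 → ∀ i j, i ≠ j → ∀ m : ℕ∞,
      (∀ n : ℕ, m = n → wordProd s (alternating i j n) = wordProd s (alternating j i n)) →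
      m ≠ 0 → (∃ L', L'.length + 1 = n + 1 ∧ wordProd s L' = s i * wordProd s L) →
      ∃ (k : ℕ) (L' : List ι), (k : ℕ∞) ≤ m ∧
      wordProd s L = wordProd s (alternating i j k) * wordProd s L' ∧
      n + 1 = k + L'.length ∧
      (∀ d ∈ chamber B α, 0 ≤ B (π (wordProd s L') d) (α i)) ∧
      (∀ d ∈ chamber B α, 0 ≤ B (π (wordProd s L') d) (α j)) := by
    rintro L hL hn i j hij m hbr hm0 ⟨L', hl', hw'⟩
    have hred : IsReduced s L' := by
      intro L'' h''
      have := hL (i :: L'') (by rw [wordProd_cons, h'', hw', h.mul_cancel])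
      simp at this; omega
    obtain ⟨a, b, hab, k, X, hkm, hX, hlen, hXi, hXj⟩ :=
      hQ L' hred (by omega) i j hij m hbr hm0
    have hLw : wordProd s L = s i * wordProd s L' := by rw [hw', h.mul_cancel]
    have hfirst : ∀ k', k = k' + 1 →
        wordProd s (alternating a b k) ≠ wordProd s (alternating i j k) := by
      rintro k' rfl heq
      have := hL (alternating j i k' ++ X) (by
        rw [hLw, hX, heq, alternating, wordProd_cons, wordProd_append, mul_assoc,
          h.mul_cancel])
      simp at this; omega
    have haij : wordProd s (alternating a b k) = wordProd s (alternating j i k) := by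
      cases k with
      | zero => rfl
      | succ k =>
        rcases hab with ⟨rfl, rfl⟩ | ⟨rfl, rfl⟩
        · exact absurd rfl (hfirst k rfl)
        · rfl
    have hkm' : (k : ℕ∞) < m := by
      refine lt_of_le_of_ne hkm ?_
      rintro rfl
      cases k with
      | zero => simp at hm0
      | succ k => exact hfirst k rfl (haij.trans (hbr _ rfl).symm)
    refine ⟨k + 1, X, by exact_mod_cast Order.add_one_le_of_lt hkm', ?_, by omega, hXi, hXj⟩
    rw [hLw, hX, haij, alternating, wordProd_cons, mul_assoc]
  intro L hL hn i j hij m hbr hm0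
  rcases hP L hL hn i with hi | ⟨-, hi⟩
  · rcases hP L hL hn j with hj | ⟨-, hj⟩
    · exact ⟨i, j, .inl ⟨rfl, rfl⟩, 0, L, by simp, by simp [alternating], by simp [hn], hi, hj⟩
    · obtain ⟨k, X, h1, h2, h3, h4, h5⟩ :=
        key L hL hn j i hij.symm m (fun n hn => (hbr n hn).symm) hm0 hj
      exact ⟨j, i, .inr ⟨rfl, rfl⟩, k, X, h1, h2, h3, h5, h4⟩
  · obtain ⟨k, X, h1, h2, h3, h4, h5⟩ := key L hL hn i j hij m hbr hm0 hi
    exact ⟨i, j, .inl ⟨rfl, rfl⟩, k, X, h1, h2, h3, h4, h5⟩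

theorem side_and_sector (h : IsReflectionSystem B α π s) (n : ℕ) :
    SideProperty B α π s n ∧ SectorProperty B α π s n := by
  induction n with
  | zero =>
    constructor
    · intro L hL hn i
      obtain rfl := List.length_eq_zero_iff.mp hn
      left; intro d hd; simpa using hd i
    · intro L hL hn i j hij m hbr hm0
      obtain rfl := List.length_eq_zero_iff.mp hn
      exact ⟨i, j, .inl ⟨rfl, rfl⟩, 0, [], by simp, by simp [alternating], by simp,
        fun d hd => by simpa using hd i, fun d hd => by simpa using hd j⟩
  | succ n ih =>
    have := h.sideProperty_succ ih.1 ih.2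
    exact ⟨this, h.sectorProperty_succ this ih.2⟩

/-- On the negative side s_i would shorten L, and `i :: L` would not be reduced. -/
theorem bilin_nonneg_of_isReduced (h : IsReflectionSystem B α π s) {i : ι} {L : List ι}
    (hL : IsReduced s (i :: L)) {d : V} (hd : d ∈ chamber B α) :
    0 ≤ B (π (wordProd s L) d) (α i) := by
  rcases (h.side_and_sector L.length).1 L hL.of_cons rfl i with h1 | ⟨-, L', h2, h3⟩
  · exact h1 d hd
  · have := hL L' (by simp [h3])
    simp at this; omega

/-- Elements that map a point of the closed chamber into the closed chamber are products of
reflections which fix the point. -/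
theorem exists_word_of_mem_chamber (h : IsReflectionSystem B α π s) {d d' : V}
    (hd : d ∈ chamber B α) (hd' : d' ∈ chamber B α) (L : List ι)
    (hL : π (wordProd s L) d = d') :
    d = d' ∧ ∃ L', wordProd s L' = wordProd s L ∧ ∀ i ∈ L', B d (α i) = 0 := by
  obtain ⟨R, hR, hRL⟩ := exists_isReduced s L
  rw [← hRL] at hL ⊢
  clear hRL L
  suffices d = d' ∧ ∀ i ∈ R, B d (α i) = 0 from ⟨this.1, R, rfl, this.2⟩
  induction R with
  | nil => exact ⟨by simpa using hL, by simp⟩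
  | cons i R ih =>
    have h1 := h.bilin_nonneg_of_isReduced hR hd
    rw [wordProd_cons, map_mul, Module.End.mul_apply] at hL
    -- Both `d'` and its reflection in mirror `i` are on the nonnegative side, so `d'` lies on the
    -- mirror and the first letter may be dropped.
    have h2 : B d' (α i) = 0 := by
      refine le_antisymm ?_ (hd' i)
      rw [← hL, h.act_self]; linarith
    have h3 : π (wordProd s R) d = d' := by
      rw [← h.act_act i (π (wordProd s R) d), hL, h.act, h2]; simp
    obtain ⟨rfl, h5⟩ := ih h3 hR.of_cons
    exact ⟨rfl, by simpa [h2] using h5⟩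

/-- Removing the first letter i of a reduced word adds 2 B(v, α_i) B(α_i, d') with both factors
nonnegative, where v is the image of d under the rest of the word. -/
theorem bilin_word_le (h : IsReflectionSystem B α π s) {d d' : V}
    (hd : d ∈ chamber B α) (hd' : d' ∈ chamber B α) (L : List ι) :
    B (π (wordProd s L) d) d' ≤ B d d' := by
  obtain ⟨R, hR, hRL⟩ := exists_isReduced s L
  rw [← hRL]
  clear hRL L
  induction R with
  | nil => simp
  | cons i R ih =>
    refine le_trans ?_ (ih hR.of_cons)
    have h1 := h.bilin_nonneg_of_isReduced hR hd
    have h2 : 0 ≤ B (α i) d' := by rw [h.symm]; exact hd' i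
    rw [wordProd_cons, map_mul, Module.End.mul_apply, h.act]
    simp only [map_sub, map_smul, LinearMap.sub_apply, LinearMap.smul_apply, smul_eq_mul]
    nlinarith [mul_nonneg h1 h2]

/-- The orbit of a point on all mirrors but one. -/
theorem bilin_word_le_of_ne (h : IsReflectionSystem B α π s) {d d' : V} {j : ι}
    (hd : d ∈ chamber B α) (hd' : d' ∈ chamber B α) (hj : ∀ i, i ≠ j → B d (α i) = 0)
    (L : List ι) (hL : π (wordProd s L) d ≠ d) :
    B (π (wordProd s L) d) d' ≤ B (π (s j) d) d' := by
  obtain ⟨R, hR, hRL⟩ := exists_isReduced s L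
  rw [← hRL] at hL ⊢
  clear hRL L
  induction R with
  | nil => simp at hL
  | cons i R ih =>
    rw [wordProd_cons, map_mul, Module.End.mul_apply] at hL ⊢
    -- If the rest of the word fixes `d`, the first letter moves it and must be `j`, because `d`
    -- lies on every other mirror. Otherwise the first letter is removed as in `bilin_word_le`.
    by_cases hRd : π (wordProd s R) d = d
    · rw [hRd] at hL ⊢
      by_cases hij : i = j
      · rw [hij]
      · exact absurd (by rw [h.act, hj i hij]; simp) hL
    · refine le_trans ?_ (ih hRd hR.of_cons)
      have h1 := h.bilin_nonneg_of_isReduced hR hd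
      have h2 : 0 ≤ B (α i) d' := by rw [h.symm]; exact hd' i
      rw [h.act]
      simp only [map_sub, map_smul, LinearMap.sub_apply, LinearMap.smul_apply, smul_eq_mul]
      nlinarith [mul_nonneg h1 h2]

/-- A point all of whose images have distance at least `c` from the mirrors has a discrete
orbit. -/
theorem length_le_of_bilin (h : IsReflectionSystem B α π s) {d : V} {c : ℝ}
    (hone : ∀ i, B d (α i) = 1)
    (hc : ∀ (L : List ι) (i : ι), (∀ d' ∈ chamber B α, 0 ≤ B (π (wordProd s L) d') (α i)) →
      c ≤ B (π (wordProd s L) d) (α i)) {L : List ι} (hL : IsReduced s L) :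
    B (π (wordProd s L) d) d ≤ B d d - 2 * c * L.length := by
  induction L with
  | nil => simp
  | cons i R ih =>
    have h1 := hc R i fun d' => h.bilin_nonneg_of_isReduced hL
    have h2 := ih hL.of_cons
    have h3 : B (α i) d = 1 := by rw [h.symm, hone]
    rw [wordProd_cons, map_mul, Module.End.mul_apply, h.act]
    simp only [map_sub, map_smul, LinearMap.sub_apply, LinearMap.smul_apply, smul_eq_mul,
      List.length_cons, h3]
    push_cast
    linarith

theorem finite_bilin_word [Finite ι] (h : IsReflectionSystem B α π s) {d : V} {c : ℝ} (hc0 : 0 < c)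
    (hone : ∀ i, B d (α i) = 1)
    (hc : ∀ (L : List ι) (i : ι), (∀ d' ∈ chamber B α, 0 ≤ B (π (wordProd s L) d') (α i)) →
      c ≤ B (π (wordProd s L) d) (α i)) (M : ℝ) :
    {w | ∃ L, w = wordProd s L ∧ -M ≤ B (π w d) d}.Finite := by
  obtain ⟨n, hn⟩ := exists_nat_ge ((B d d + M) / (2 * c))
  refine ((List.finite_length_le ι n).image (wordProd s)).subset ?_
  rintro w ⟨L, rfl, hw⟩
  obtain ⟨R, hR, hRL⟩ := exists_isReduced s L
  refine ⟨R, ?_, hRL⟩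
  rw [← hRL] at hw
  have h1 := h.length_le_of_bilin hone hc hR
  have h2 : (R.length : ℝ) ≤ n := by
    refine le_trans ?_ hn
    rw [le_div_iff₀ (by positivity)]
    linarith
  exact_mod_cast h2

end IsReflectionSystem
end

/-! ### Moebius transformations given by invertible matrices -/

abbrev CMat := Matrix (Fin 2) (Fin 2) ℂ

theorem center_smul {N N' : SL(2, ℂ)} {c : ℂ} (h : N'.1 = c • N.1) :
    (QuotientGroup.mk N : PSL(2, ℂ)) = QuotientGroup.mk N' := by
  rw [QuotientGroup.eq, Matrix.SpecialLinearGroup.mem_center_iff]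
  have hc : c ^ 2 = 1 := by
    have := N'.2
    rw [h, Matrix.det_smul, N.2] at this
    simpa using this
  refine ⟨c, by simpa using hc, ?_⟩
  have : (N⁻¹ * N').1 = c • 1 := by
    rw [Matrix.SpecialLinearGroup.coe_mul, h, Matrix.mul_smul,
      ← Matrix.SpecialLinearGroup.coe_mul, inv_mul_cancel, Matrix.SpecialLinearGroup.coe_one]
  rw [this, Matrix.scalar_apply, Matrix.smul_one_eq_diagonal]

theorem eq_smul_of_mk_eq {N N' : SL(2, ℂ)}
    (h : (QuotientGroup.mk N : PSL(2, ℂ)) = QuotientGroup.mk N') :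
    N'.1 = N.1 ∨ N'.1 = - N.1 := by
  rw [QuotientGroup.eq, Matrix.SpecialLinearGroup.mem_center_iff] at h
  obtain ⟨c, hc, h⟩ := h
  have h1 : N'.1 = c • N.1 := by
    have : N' = N * (N⁻¹ * N') := by group
    rw [this, Matrix.SpecialLinearGroup.coe_mul, ← h]
    rw [Matrix.scalar_apply, ← Matrix.smul_one_eq_diagonal, Matrix.mul_smul, mul_one]
  have : c = 1 ∨ c = -1 := by
    have hc' : c ^ 2 = 1 := by simpa using hc
    have : (c - 1) * (c + 1) = 0 := by linear_combination hc'
    rcases mul_eq_zero.mp this with h | h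
    · exact .inl (by linear_combination h)
    · exact .inr (by linear_combination h)
  rcases this with rfl | rfl <;> simp [h1]

/-- The normalization of an invertible matrix to determinant one. -/
def normalize (M : CMat) (h : M.det ≠ 0) : SL(2, ℂ) :=
  ⟨(M.det ^ (((2 : ℕ) : ℂ)⁻¹))⁻¹ • M, by
    rw [Matrix.det_smul, Fintype.card_fin, inv_pow, Complex.cpow_nat_inv_pow _ two_ne_zero,
      inv_mul_cancel₀ h]⟩

open Classical in
/-- The class of an invertible matrix in `PSL(2, ℂ)`. -/
def toPSL (M : CMat) : PSL(2, ℂ) :=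
  if h : M.det ≠ 0 then QuotientGroup.mk (normalize M h) else 1

theorem toPSL_of_eq_smul {M : CMat} {N : SL(2, ℂ)} {c : ℂ} (hc : c ≠ 0) (h : M = c • N.1) :
    toPSL M = QuotientGroup.mk N := by
  have hd : M.det ≠ 0 := by rw [h, Matrix.det_smul, N.2]; simpa using hc
  have h2 : (normalize M hd).1 = ((M.det ^ (((2 : ℕ) : ℂ)⁻¹))⁻¹ * c) • N.1 := by
    rw [mul_smul, ← h]; rfl
  rw [toPSL, dif_pos hd]
  exact (center_smul h2).symm

theorem toPSL_coe (N : SL(2, ℂ)) : toPSL N.1 = QuotientGroup.mk N :=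
  toPSL_of_eq_smul one_ne_zero (one_smul _ _).symm

theorem eq_smul_normalize {M : CMat} (h : M.det ≠ 0) :
    (M.det ^ (((2 : ℕ) : ℂ)⁻¹)) ≠ 0 ∧
      M = (M.det ^ (((2 : ℕ) : ℂ)⁻¹)) • (normalize M h).1 := by
  have h0 : (M.det ^ (((2 : ℕ) : ℂ)⁻¹)) ≠ 0 := by
    intro h0
    have := Complex.cpow_nat_inv_pow M.det two_ne_zero
    rw [h0] at this; simp at this; exact h this.symm
  exact ⟨h0, by rw [normalize]; simp only; rw [smul_smul, mul_inv_cancel₀ h0, one_smul]⟩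

theorem exists_rep {M : CMat} (h : M.det ≠ 0) :
    ∃ (c : ℂ) (N : SL(2, ℂ)), c ≠ 0 ∧ M = c • N.1 ∧ toPSL M = QuotientGroup.mk N := by
  obtain ⟨h0, h1⟩ := eq_smul_normalize h
  exact ⟨_, _, h0, h1, toPSL_of_eq_smul h0 h1⟩

theorem exists_toPSL (A : PSL(2, ℂ)) : ∃ M : CMat, M.det = 1 ∧ A = toPSL M := by
  obtain ⟨N, rfl⟩ := QuotientGroup.mk_surjective A
  exact ⟨N.1, N.2, (toPSL_coe N).symm⟩

theorem toPSL_one : toPSL 1 = 1 := toPSL_coe 1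

theorem toPSL_mul {M M' : CMat} (h : M.det ≠ 0) (h' : M'.det ≠ 0) :
    toPSL (M * M') = toPSL M * toPSL M' := by
  obtain ⟨c, N, hc, hM, hN⟩ := exists_rep h
  obtain ⟨c', N', hc', hM', hN'⟩ := exists_rep h'
  rw [hN, hN', ← QuotientGroup.mk_mul]
  refine toPSL_of_eq_smul (mul_ne_zero hc hc') ?_
  rw [Matrix.SpecialLinearGroup.coe_mul]
  nth_rewrite 1 [hM, hM']
  rw [Matrix.smul_mul, Matrix.mul_smul, smul_smul]

theorem toPSL_smul {M : CMat} {c : ℂ} (h : M.det ≠ 0) (hc : c ≠ 0) :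
    toPSL (c • M) = toPSL M := by
  obtain ⟨c', N, hc', hM, hN⟩ := exists_rep h
  rw [hN]
  exact toPSL_of_eq_smul (mul_ne_zero hc hc') (by nth_rewrite 1 [hM]; rw [smul_smul])

theorem eq_smul_of_toPSL_eq {M M' : CMat} (h : M.det ≠ 0) (h' : M'.det ≠ 0)
    (heq : toPSL M = toPSL M') : ∃ c : ℂ, c ≠ 0 ∧ M' = c • M := by
  obtain ⟨c, N, hc, hM, hN⟩ := exists_rep h
  obtain ⟨c', N', hc', hM', hN'⟩ := exists_rep h'
  rw [hN, hN'] at heq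
  rcases eq_smul_of_mk_eq heq with h1 | h1
  · exact ⟨c' / c, div_ne_zero hc' hc, by rw [hM', hM, h1, smul_smul, div_mul_cancel₀ _ hc]⟩
  · refine ⟨-(c' / c), neg_ne_zero.mpr (div_ne_zero hc' hc), ?_⟩
    rw [hM', hM, h1, smul_smul, neg_mul, div_mul_cancel₀ _ hc]; simp

theorem toPSL_inv {M : CMat} (h : M.det ≠ 0) : (toPSL M)⁻¹ = toPSL M.adjugate := by
  have h1 : M.adjugate.det ≠ 0 := by rw [Matrix.det_adjugate]; simpa using h
  refine inv_eq_of_mul_eq_one_right ?_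
  rw [← toPSL_mul h h1, Matrix.mul_adjugate, toPSL_smul (by simp) h, toPSL_one]

theorem mobius_toPSL {M : CMat} (h : M.det ≠ 0) (z : OnePoint ℂ) :
    mobius (toPSL M) z = Matrix.GeneralLinearGroup.mkOfDetNeZero M h • z := by
  obtain ⟨c, N, hc, hM, hN⟩ := exists_rep h
  rw [hN]
  change Matrix.SpecialLinearGroup.toGL N • z = _
  have key : ∀ i j, (Matrix.GeneralLinearGroup.mkOfDetNeZero M h) i j =
      c * (Matrix.SpecialLinearGroup.toGL N) i j := by
    intro i j
    change M i j = c * N.1 i j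
    rw [hM]; simp
  cases z with
  | infty =>
    simp only [OnePoint.smul_infty_eq_ite, key, mul_eq_zero, hc, false_or,
      mul_div_mul_left _ _ hc]
  | coe z =>
    have e1 : c * (Matrix.SpecialLinearGroup.toGL N) 1 0 * z +
        c * (Matrix.SpecialLinearGroup.toGL N) 1 1 = c * ((Matrix.SpecialLinearGroup.toGL N) 1 0
        * z + (Matrix.SpecialLinearGroup.toGL N) 1 1) := by ring
    have e2 : c * (Matrix.SpecialLinearGroup.toGL N) 0 0 * z +
        c * (Matrix.SpecialLinearGroup.toGL N) 0 1 = c * ((Matrix.SpecialLinearGroup.toGL N) 0 0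
        * z + (Matrix.SpecialLinearGroup.toGL N) 0 1) := by ring
    simp only [OnePoint.smul_some_eq_ite, key, e1, e2, mul_eq_zero, hc, false_or,
      mul_div_mul_left _ _ hc]

theorem mobius_infty {M : CMat} (h : M.det ≠ 0) :
    mobius (toPSL M) ∞ = if M 1 0 = 0 then ∞ else ((M 0 0 / M 1 0 : ℂ) : OnePoint ℂ) := by
  rw [mobius_toPSL h, OnePoint.smul_infty_eq_ite]; rfl

theorem mobius_coe {M : CMat} (h : M.det ≠ 0) (z : ℂ) :
    mobius (toPSL M) z = if M 1 0 * z + M 1 1 = 0 then ∞ else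
      (((M 0 0 * z + M 0 1) / (M 1 0 * z + M 1 1) : ℂ) : OnePoint ℂ) := by
  rw [mobius_toPSL h, OnePoint.smul_some_eq_ite]; rfl

theorem mobius_infty_eq_infty {M : CMat} (h : M.det ≠ 0) :
    mobius (toPSL M) ∞ = ∞ ↔ M 1 0 = 0 := by
  rw [mobius_infty h]; split_ifs with h1 <;> simp [h1]

theorem mobius_coe_eq_coe {M : CMat} (h : M.det ≠ 0) (z w : ℂ) :
    mobius (toPSL M) z = w ↔
      M 1 0 * z + M 1 1 ≠ 0 ∧ M 0 0 * z + M 0 1 = w * (M 1 0 * z + M 1 1) := by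
  rw [mobius_coe h]; split_ifs with h1
  · simp [h1]
  · rw [OnePoint.coe_eq_coe, div_eq_iff h1]; simp [h1]

theorem mobius_coe_eq_infty {M : CMat} (h : M.det ≠ 0) (z : ℂ) :
    mobius (toPSL M) z = ∞ ↔ M 1 0 * z + M 1 1 = 0 := by
  rw [mobius_coe h]; split_ifs with h1 <;> simp [h1]

theorem mobius_infty_eq_coe {M : CMat} (h : M.det ≠ 0) (w : ℂ) :
    mobius (toPSL M) ∞ = w ↔ M 1 0 ≠ 0 ∧ M 0 0 = w * M 1 0 := by
  rw [mobius_infty h]; split_ifs with h1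
  · simp [h1]
  · rw [OnePoint.coe_eq_coe, div_eq_iff h1]; simp [h1]

theorem mobius_coe_fixed {M : CMat} (h : M.det ≠ 0) (z : ℂ) :
    mobius (toPSL M) z = z ↔ M 1 0 * z ^ 2 + (M 1 1 - M 0 0) * z - M 0 1 = 0 := by
  rw [mobius_coe_eq_coe h]
  constructor
  · rintro ⟨-, h2⟩; linear_combination -h2
  · intro h2
    refine ⟨fun h3 => h ?_, by linear_combination -h2⟩
    rw [Matrix.det_fin_two]
    linear_combination (M 0 0 - M 1 0 * z) * h3 - M 1 0 * (-1) * h2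

theorem eq_one_of_fixes {M : CMat} (h : M.det ≠ 0) (h0 : M 1 0 = 0) (h1 : M 0 1 = 0)
    (h2 : M 0 0 = M 1 1) : toPSL M = 1 := by
  have : M = M 1 1 • (1 : CMat) := by
    ext i j; fin_cases i <;> fin_cases j <;> simp [h0, h1, h2]
  have h3 : M 1 1 ≠ 0 := by
    rintro h3; rw [this, h3] at h; simp at h
  rw [this, toPSL_smul (by simp) h3, toPSL_one]

theorem mobius_injective : Function.Injective mobius := by
  rw [injective_iff_map_eq_one]
  intro A hA
  obtain ⟨M, hM, rfl⟩ := exists_toPSL A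
  have hd : M.det ≠ 0 := by simp [hM]
  have h0 := (mobius_infty_eq_infty hd).mp (by rw [hA]; rfl)
  have h1 := (mobius_coe_fixed hd 0).mp (by rw [hA]; rfl)
  have h2 := (mobius_coe_fixed hd 1).mp (by rw [hA]; rfl)
  have h1' : M 0 1 = 0 := by simpa using h1
  refine eq_one_of_fixes hd h0 h1' ?_
  rw [h0, h1'] at h2; linear_combination -h2

/-! ### The braid relation in a group -/

theorem wordProd_alternating {ι W : Type*} [Group W] {s : ι → W} (i j : ι) (n : ℕ) :
    wordProd s (alternating i j (2 * n)) = (s i * s j) ^ n ∧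
      wordProd s (alternating i j (2 * n + 1)) = (s i * s j) ^ n * s i := by
  induction n generalizing i j with
  | zero => simp [alternating]
  | succ n ih =>
    have h1 : wordProd s (alternating i j (2 * (n + 1))) = (s i * s j) ^ (n + 1) := by
      rw [show 2 * (n + 1) = (2 * n) + 1 + 1 by ring, alternating, alternating, wordProd_cons,
        wordProd_cons, (ih i j).1, ← mul_assoc, ← pow_succ']
    refine ⟨h1, ?_⟩
    rw [show 2 * (n + 1) + 1 = (2 * n + 1) + 1 + 1 by ring, alternating, alternating,
      wordProd_cons, wordProd_cons, (ih i j).2, ← mul_assoc, ← mul_assoc, ← pow_succ']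

/-- For n = 2k the two words are mutually inverse k-th powers, equal because the 2k-th power is
trivial; for odd n one letter is carried along. -/
theorem alternating_comm {ι W : Type*} [Group W] {s : ι → W} (sq : ∀ i, s i * s i = 1)
    (i j : ι) (n : ℕ) (h : (s i * s j) ^ n = 1) :
    wordProd s (alternating i j n) = wordProd s (alternating j i n) := by
  have hinv : s j * s i = (s i * s j)⁻¹ := by
    rw [mul_inv_rev, inv_eq_of_mul_eq_one_right (sq i), inv_eq_of_mul_eq_one_right (sq j)]
  obtain ⟨k, rfl | rfl⟩ := Nat.even_or_odd' n
  · rw [(wordProd_alternating i j k).1, (wordProd_alternating j i k).1, hinv, inv_pow,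
      eq_inv_iff_mul_eq_one, ← pow_add, ← two_mul, h]
  · have hi : s i = s i * s j * s j := by rw [mul_assoc, sq, mul_one]
    have hk : (s i * s j) ^ k * (s i * s j) = ((s i * s j) ^ k)⁻¹ := by
      rw [eq_inv_iff_mul_eq_one, ← pow_succ, ← pow_add, ← h]; congr 1; ring
    rw [(wordProd_alternating i j k).2, (wordProd_alternating j i k).2, hinv, inv_pow, ← hk]
    nth_rewrite 2 [hi]
    simp only [mul_assoc]

/-! ### Signatures -/

theorem two_le_toNat {n : ℕ∞} (h : 2 ≤ n) (ht : n ≠ ⊤) : 2 ≤ n.toNat := by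
  lift n to ℕ using ht
  simpa using h

theorem recip_nonneg (n : ℕ∞) : 0 ≤ recip n := by
  unfold recip; split_ifs <;> positivity

theorem recip_le_half {n : ℕ∞} (h : 2 ≤ n) : recip n ≤ 1 / 2 := by
  unfold recip
  split_ifs with ht
  · norm_num
  · have : (2 : ℝ) ≤ n.toNat := by exact_mod_cast two_le_toNat h ht
    exact one_div_le_one_div_of_le two_pos this

theorem recip_pos {n : ℕ∞} (h : 2 ≤ n) (ht : n ≠ ⊤) : 0 < recip n := by
  unfold recip
  rw [if_neg ht]
  have := two_le_toNat h ht
  positivity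

theorem cosPi_nonneg {n : ℕ∞} (h : 2 ≤ n) : 0 ≤ cosPi n := by
  have h1 := recip_nonneg n
  have h2 := recip_le_half h
  have := Real.pi_pos
  apply Real.cos_nonneg_of_neg_pi_div_two_le_of_le <;> nlinarith

theorem cosPi_le_one (n : ℕ∞) : cosPi n ≤ 1 := Real.cos_le_one _

theorem sinPi_nonneg {n : ℕ∞} (h : 2 ≤ n) : 0 ≤ sinPi n := by
  have h1 := recip_nonneg n
  have h2 := recip_le_half h
  have := Real.pi_pos
  apply Real.sin_nonneg_of_nonneg_of_le_pi <;> nlinarith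

theorem sinPi_pos {n : ℕ∞} (h : 2 ≤ n) (ht : n ≠ ⊤) : 0 < sinPi n := by
  have h1 := recip_pos h ht
  have h2 := recip_le_half h
  have := Real.pi_pos
  apply Real.sin_pos_of_pos_of_lt_pi <;> nlinarith

@[simp] theorem cosPi_top : cosPi ⊤ = 1 := by simp [cosPi, recip]

@[simp] theorem sinPi_top : sinPi ⊤ = 0 := by simp [sinPi, recip]

theorem sinPi_sq (n : ℕ∞) : sinPi n ^ 2 = 1 - cosPi n ^ 2 := by
  have := Real.sin_sq_add_cos_sq (Real.pi * recip n)
  unfold sinPi cosPi; linarith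

namespace IsHyperbolicSignature
variable {ν : Fin 3 → ℕ∞}

theorem sum_lt (h : IsHyperbolicSignature ν) : recip (ν 0) + recip (ν 1) + recip (ν 2) < 1 := by
  have := h.2
  rw [Fin.sum_univ_three] at this; linarith

theorem sum_lt' (h : IsHyperbolicSignature ν) (i : Fin 3) :
    recip (ν i) + recip (ν (i + 1)) + recip (ν (i + 2)) < 1 := by
  have := h.sum_lt
  fin_cases i <;> simp only [Fin.zero_eta, Fin.mk_one, Fin.reduceFinMk, Fin.reduceAdd,
    zero_add, Fin.isValue] <;> linarith

/-- The angle sum is less than π, so π/νᵢ is less than π minus the other two angles, and the cosine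
decreases on [0, π]. -/
theorem sin_mul_sin_lt (h : IsHyperbolicSignature ν) (i : Fin 3) :
    sinPi (ν (i + 1)) * sinPi (ν (i + 2)) <
      cosPi (ν (i + 1)) * cosPi (ν (i + 2)) + cosPi (ν i) := by
  have hpi := Real.pi_pos
  have h0 := h.sum_lt' i
  have h1 := recip_nonneg (ν i)
  have h2 := recip_nonneg (ν (i + 1))
  have h3 := recip_nonneg (ν (i + 2))
  have h4 := Real.cos_lt_cos_of_nonneg_of_le_pi (x := Real.pi * recip (ν i))
    (y := Real.pi - (Real.pi * recip (ν (i + 1)) + Real.pi * recip (ν (i + 2))))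
    (by positivity) (by nlinarith) (by nlinarith)
  rw [Real.cos_pi_sub, Real.cos_add] at h4
  unfold sinPi cosPi
  linarith

theorem cos_cross_pos (h : IsHyperbolicSignature ν) (i : Fin 3) :
    0 < cosPi (ν (i + 1)) * cosPi (ν (i + 2)) + cosPi (ν i) :=
  (mul_nonneg (sinPi_nonneg (h.1 _)) (sinPi_nonneg (h.1 _))).trans_lt (h.sin_mul_sin_lt i)

/-- l² = (q₁q₂ + q₃)² − p₁²p₂², which is positive by `sin_mul_sin_lt`. -/
theorem lSq_pos (h : IsHyperbolicSignature ν) : 0 < lSq ν := by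
  have h1 := h.sin_mul_sin_lt 2
  have h2 : 0 ≤ sinPi (ν (2 + 1)) * sinPi (ν (2 + 2)) :=
    mul_nonneg (sinPi_nonneg (h.1 _)) (sinPi_nonneg (h.1 _))
  have h3 : (sinPi (ν (2 + 1)) * sinPi (ν (2 + 2))) ^ 2 <
      (cosPi (ν (2 + 1)) * cosPi (ν (2 + 2)) + cosPi (ν 2)) ^ 2 := by gcongr
  rw [mul_pow, sinPi_sq, sinPi_sq] at h3
  simp only [Fin.reduceAdd, Fin.isValue] at h3
  unfold lSq
  linarith

end IsHyperbolicSignature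

theorem sinRatio_mul_sin (θ : ℝ) (k : ℕ) :
    sinRatio (Real.cos θ) k * Real.sin θ = Real.sin (k * θ) := by
  induction k using Nat.twoStepInduction with
  | zero => simp [sinRatio]
  | one => simp [sinRatio]
  | more k ih1 ih2 =>
    have h1 : ((k + 2 : ℕ) : ℝ) * θ = ((k + 1 : ℕ) : ℝ) * θ + θ := by push_cast; ring
    have h2 : (k : ℝ) * θ = ((k + 1 : ℕ) : ℝ) * θ - θ := by push_cast; ring
    rw [sinRatio, h1, Real.sin_add, sub_mul, ih1, h2, Real.sin_sub, mul_assoc, ih2]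
    ring

theorem sinRatio_one (k : ℕ) : sinRatio 1 k = k := by
  induction k using Nat.twoStepInduction with
  | zero => simp [sinRatio]
  | one => simp [sinRatio]
  | more k ih1 ih2 => rw [sinRatio, ih1, ih2]; push_cast; ring

theorem sinRatio_nonneg {n : ℕ∞} (h : 2 ≤ n) {k : ℕ} (hk : k ≤ n) :
    0 ≤ sinRatio (cosPi n) k := by
  by_cases ht : n = ⊤
  · rw [ht, cosPi_top, sinRatio_one]; positivity
  have h1 := sinRatio_mul_sin (Real.pi * recip n) k
  have h2 := sinPi_pos h ht
  have h3 : 0 ≤ Real.sin (k * (Real.pi * recip n)) := by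
    have hk' : (k : ℝ) * recip n ≤ 1 := by
      lift n to ℕ using ht
      have : 2 ≤ n := by simpa using h
      have hk : k ≤ n := by simpa using hk
      have hk : (k : ℝ) ≤ n := by exact_mod_cast hk
      simp only [recip, ENat.natCast_ne_top, if_false, ENat.toNat_natCast]
      rw [mul_one_div, div_le_one (by positivity)]; exact hk
    have := recip_nonneg n
    have := Real.pi_pos
    apply Real.sin_nonneg_of_nonneg_of_le_pi
    · positivity
    · nlinarith
  rw [← h1] at h3
  exact nonneg_of_mul_nonneg_left h3 h2

theorem sinRatio_order {n : ℕ} (h : 2 ≤ n) :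
    sinRatio (cosPi n) n = 0 ∧ sinRatio (cosPi n) (n - 1) = 1 := by
  have h2 : 0 < sinPi n := sinPi_pos (by exact_mod_cast h) (ENat.natCast_ne_top n)
  have hr : recip n = 1 / n := by simp [recip]
  have hn : (n : ℝ) ≠ 0 := by positivity
  constructor
  · have h1 := sinRatio_mul_sin (Real.pi * recip n) n
    rw [hr, show (n : ℝ) * (Real.pi * (1 / n)) = Real.pi by field_simp, Real.sin_pi, ← hr] at h1
    exact (mul_eq_zero.mp h1).resolve_right h2.ne'
  · have h1 := sinRatio_mul_sin (Real.pi * recip n) (n - 1)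
    rw [Nat.cast_sub (by omega), hr, show ((n : ℝ) - (1 : ℕ)) * (Real.pi * (1 / n)) =
      Real.pi - Real.pi * (1 / n) by push_cast; field_simp, Real.sin_pi_sub, ← hr] at h1
    exact mul_right_cancel₀ h2.ne' (h1.trans (one_mul _).symm)

/-! ### Real matrices and the space of traceless matrices -/

abbrev RMat := Matrix (Fin 2) (Fin 2) ℝ

/-- The Moebius transformation given by a real matrix. -/
def realPSL (M : RMat) : PSL(2, ℂ) := toPSL (M.map Complex.ofReal)

theorem det_map_ofReal (M : RMat) : (M.map Complex.ofReal).det = (M.det : ℂ) := by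
  simp [Matrix.det_fin_two]

theorem det_map_ne_zero {M : RMat} (h : M.det ≠ 0) : (M.map Complex.ofReal).det ≠ 0 := by
  rw [det_map_ofReal]; exact_mod_cast h

theorem realPSL_mul {M M' : RMat} (h : M.det ≠ 0) (h' : M'.det ≠ 0) :
    realPSL (M * M') = realPSL M * realPSL M' := by
  rw [realPSL, realPSL, realPSL, ← toPSL_mul (det_map_ne_zero h) (det_map_ne_zero h')]
  congr 1
  exact Matrix.map_mul (f := Complex.ofRealHom)

theorem realPSL_one : realPSL 1 = 1 := by
  rw [realPSL, Matrix.map_one _ Complex.ofReal_zero Complex.ofReal_one, toPSL_one]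

theorem realPSL_smul {M : RMat} {c : ℝ} (h : M.det ≠ 0) (hc : c ≠ 0) :
    realPSL (c • M) = realPSL M := by
  rw [realPSL, realPSL, ← toPSL_smul (det_map_ne_zero h) (Complex.ofReal_ne_zero.mpr hc)]
  congr 1
  ext i j; simp

theorem realPSL_neg {M : RMat} (h : M.det ≠ 0) : realPSL (-M) = realPSL M := by
  rw [← realPSL_smul h (c := -1) (by simp)]; simp

theorem realPSL_inv {M : RMat} (h : M.det ≠ 0) : (realPSL M)⁻¹ = realPSL M.adjugate := by
  rw [realPSL, toPSL_inv (det_map_ne_zero h), realPSL]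
  congr 1
  simp only [Matrix.adjugate_fin_two]
  ext i j; fin_cases i <;> fin_cases j <;> simp

theorem eq_smul_of_realPSL_eq {M M' : RMat} (h : M.det ≠ 0) (h' : M'.det ≠ 0)
    (heq : realPSL M = realPSL M') : ∃ c : ℝ, c ≠ 0 ∧ M' = c • M := by
  obtain ⟨c, hc, hM⟩ := eq_smul_of_toPSL_eq (det_map_ne_zero h) (det_map_ne_zero h') heq
  have h1 : ∀ i j, (M' i j : ℂ) = c * M i j := fun i j => congrFun (congrFun hM i) j
  -- Both matrices are real, so the complex scalar may be replaced by its real part.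
  have h2 : ∀ i j, M' i j = c.re * M i j := fun i j => by
    have := congrArg Complex.re (h1 i j); simpa using this
  refine ⟨c.re, ?_, by ext i j; simp [h2]⟩
  intro h0
  apply h'
  simp [Matrix.det_fin_two, h2, h0]

abbrev V3 := Fin 3 → ℝ

/-- The traceless matrix with the given coordinates. -/
def toMat (v : V3) : RMat := !![v 0, -v 1; v 2, -v 0]

/-- The quadratic form `- det` on traceless matrices. -/
def form : LinearMap.BilinForm ℝ V3 :=
  LinearMap.mk₂ ℝ (fun v w => v 0 * w 0 - (v 1 * w 2 + v 2 * w 1) / 2)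
    (by intros; simp; ring) (by intros; simp; ring) (by intros; simp; ring)
    (by intros; simp; ring)

theorem form_apply (v w : V3) : form v w = v 0 * w 0 - (v 1 * w 2 + v 2 * w 1) / 2 := rfl

theorem form_comm (v w : V3) : form v w = form w v := by
  rw [form_apply, form_apply]; ring

theorem det_toMat (v : V3) : (toMat v).det = - form v v := by
  rw [toMat, Matrix.det_fin_two_of, form_apply]; ring

theorem toMat_injective : Function.Injective toMat := by
  intro v w h
  have h0 := congrFun (congrFun h 0) 0
  have h1 := congrFun (congrFun h 0) 1
  have h2 := congrFun (congrFun h 1) 0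
  simp [toMat] at h0 h1 h2
  ext i; fin_cases i <;> assumption

theorem trace_toMat_mul (v w : V3) : (toMat v * toMat w).trace = 2 * form v w := by
  simp [toMat, Matrix.trace_fin_two, form_apply]; ring

/-- The reflection in the plane orthogonal to a vector of norm one. -/
def reflect (r v : V3) : V3 := v - (2 * form v r) • r

/-- This links the linear reflections with Moebius transformations. For norm one the matrix of r has
determinant −1 and squares to 1; conjugating with the adjugate instead of the inverse supplies the
sign that sends r to −r and fixes the orthogonal plane. -/
theorem toMat_reflect {r : V3} (hr : form r r = 1) (v : V3) :
    toMat (reflect r v) = toMat r * toMat v * (toMat r).adjugate := by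
  rw [form_apply] at hr
  rw [toMat, toMat, Matrix.adjugate_fin_two_of]
  ext i j
  fin_cases i <;> fin_cases j <;> simp [toMat, reflect, form_apply, Matrix.mul_apply]
  · linear_combination (-(v 0)) * hr
  · linear_combination v 1 * hr
  · linear_combination (-(v 2)) * hr
  · linear_combination v 0 * hr

/-! ### Triples of mirrors -/

/-- Normal vectors of the three sides of a hyperbolic triangle with angles `π / ν i`. -/
structure IsMirrorTriple (R : Fin 3 → V3) (ν : Fin 3 → ℕ∞) : Prop where
  norm : ∀ i, form (R i) (R i) = 1
  gram : ∀ i, form (R (i + 1)) (R (i + 2)) = -cosPi (ν i)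

/-- The real matrix given by a word in the mirrors. -/
def wordMat (R : Fin 3 → V3) (L : List (Fin 3)) : RMat := (L.map fun i => toMat (R i)).prod

/-- The action of a word in the mirrors on traceless matrices. -/
def wordAct (R : Fin 3 → V3) (L : List (Fin 3)) (v : V3) : V3 :=
  L.foldr (fun i v => reflect (R i) v) v

@[simp] theorem wordMat_nil (R : Fin 3 → V3) : wordMat R [] = 1 := rfl

@[simp] theorem wordMat_cons (R : Fin 3 → V3) (i : Fin 3) (L : List (Fin 3)) :
    wordMat R (i :: L) = toMat (R i) * wordMat R L := by simp [wordMat]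

@[simp] theorem wordAct_nil (R : Fin 3 → V3) (v : V3) : wordAct R [] v = v := rfl

@[simp] theorem wordAct_cons (R : Fin 3 → V3) (i : Fin 3) (L : List (Fin 3)) (v : V3) :
    wordAct R (i :: L) v = reflect (R i) (wordAct R L v) := rfl

@[simp] theorem wordAct_append (R : Fin 3 → V3) (L L' : List (Fin 3)) (v : V3) :
    wordAct R (L ++ L') v = wordAct R L (wordAct R L' v) := by simp [wordAct]

theorem reflect_reflect {r : V3} (hr : form r r = 1) (v : V3) :
    reflect r (reflect r v) = v := by
  simp only [reflect, map_sub, map_smul, LinearMap.sub_apply, LinearMap.smul_apply, hr]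
  ext i; simp; ring

/-- Reflections as linear equivalences. -/
def reflectEquiv (r : V3) (hr : form r r = 1) : V3 ≃ₗ[ℝ] V3 :=
  LinearEquiv.ofInvolutive
    { toFun := reflect r
      map_add' := fun v w => by ext i; simp [reflect]; ring
      map_smul' := fun c v => by ext i; simp [reflect]; ring }
    (reflect_reflect hr)

/-- Pairs of a Moebius transformation and a linear map, with a sign. -/
abbrev MirrorGroup := PSL(2, ℂ) × (V3 ≃ₗ[ℝ] V3) × ℤˣ

/-- The linear action of a mirror group. -/
def mirrorRep : MirrorGroup →* Module.End ℝ V3 :=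
  (LinearEquiv.automorphismGroup.toLinearMapMonoidHom).comp
    ((MonoidHom.fst _ _).comp (MonoidHom.snd _ _))

namespace IsMirrorTriple
variable {R : Fin 3 → V3} {ν : Fin 3 → ℕ∞}

/-- The generators of the mirror group. -/
def gen (h : IsMirrorTriple R ν) (i : Fin 3) : MirrorGroup :=
  (realPSL (toMat (R i)), reflectEquiv (R i) (h.norm i), -1)

theorem det_toMat_mirror (h : IsMirrorTriple R ν) (i : Fin 3) : (toMat (R i)).det = -1 := by
  rw [det_toMat, h.norm]

theorem det_wordMat (h : IsMirrorTriple R ν) (L : List (Fin 3)) :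
    (wordMat R L).det = (-1) ^ L.length := by
  induction L with
  | nil => simp
  | cons i L ih => rw [wordMat_cons, Matrix.det_mul, h.det_toMat_mirror, ih]; simp [pow_succ]

theorem det_wordMat_ne_zero (h : IsMirrorTriple R ν) (L : List (Fin 3)) :
    (wordMat R L).det ≠ 0 := by rw [h.det_wordMat]; positivity

theorem fst_wordProd (h : IsMirrorTriple R ν) (L : List (Fin 3)) :
    (wordProd h.gen L).1 = realPSL (wordMat R L) := by
  induction L with
  | nil => simp [realPSL_one]
  | cons i L ih =>
    rw [wordProd_cons, wordMat_cons, realPSL_mul (by simp [h.det_toMat_mirror])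
      (h.det_wordMat_ne_zero L), Prod.fst_mul, ih, gen]

theorem sign_wordProd (h : IsMirrorTriple R ν) (L : List (Fin 3)) :
    (wordProd h.gen L).2.2 = (-1) ^ L.length := by
  induction L with
  | nil => simp
  | cons i L ih => rw [wordProd_cons, Prod.snd_mul, Prod.snd_mul, ih]; simp [gen, pow_succ]

theorem rep_wordProd (h : IsMirrorTriple R ν) (L : List (Fin 3)) (v : V3) :
    mirrorRep (wordProd h.gen L) v = wordAct R L v := by
  induction L with
  | nil => simp
  | cons i L ih => rw [wordProd_cons, map_mul, Module.End.mul_apply, ih]; rfl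

theorem toMat_wordAct (h : IsMirrorTriple R ν) (L : List (Fin 3)) (v : V3) :
    toMat (wordAct R L v) = wordMat R L * toMat v * (wordMat R L).adjugate := by
  induction L with
  | nil => simp
  | cons i L ih =>
    rw [wordAct_cons, wordMat_cons, toMat_reflect (h.norm i), ih, Matrix.adjugate_mul_distrib]
    simp only [mul_assoc]

theorem gen_sq (h : IsMirrorTriple R ν) (i : Fin 3) : h.gen i * h.gen i = 1 := by
  refine Prod.ext ?_ (Prod.ext ?_ ?_)
  · change realPSL _ * realPSL _ = 1
    have hd := h.det_toMat_mirror i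
    rw [← realPSL_mul (by simp [hd]) (by simp [hd])]
    have hn := h.norm i
    rw [form_apply] at hn
    have : toMat (R i) * toMat (R i) = 1 := by
      ext a b; fin_cases a <;> fin_cases b <;> simp [toMat, Matrix.mul_apply] <;> linarith
    rw [this, realPSL_one]
  · ext v : 1
    exact reflect_reflect (h.norm i) v
  · simp [gen]

theorem gram_of_ne (h : IsMirrorTriple R ν) {i j : Fin 3} (hij : i ≠ j) :
    ∃ k, k ≠ i ∧ k ≠ j ∧ form (R i) (R j) = -cosPi (ν k) := by
  have h0 := h.gram 0
  have h1 := h.gram 1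
  have h2 := h.gram 2
  simp only [zero_add, Fin.reduceAdd, Fin.isValue] at h0 h1 h2
  fin_cases i <;> fin_cases j
  · exact absurd rfl hij
  · exact ⟨2, by decide, by decide, h2⟩
  · exact ⟨1, by decide, by decide, by rw [form_comm]; exact h1⟩
  · exact ⟨2, by decide, by decide, by rw [form_comm]; exact h2⟩
  · exact absurd rfl hij
  · exact ⟨0, by decide, by decide, h0⟩
  · exact ⟨1, by decide, by decide, h1⟩
  · exact ⟨0, by decide, by decide, by rw [form_comm]; exact h0⟩
  · exact absurd rfl hij

end IsMirrorTriple

/-- Powers of a unimodular matrix by the theorem of Cayley and Hamilton. -/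
theorem pow_succ_eq_sinRatio {Y : RMat} {q : ℝ} (hd : Y.det = 1) (ht : Y.trace = 2 * q) (k : ℕ) :
    Y ^ (k + 1) = sinRatio q (k + 1) • Y - sinRatio q k • (1 : RMat) := by
  have hY : Y * Y = (2 * q) • Y - (1 : RMat) := by
    rw [Matrix.det_fin_two] at hd
    rw [Matrix.trace_fin_two] at ht
    ext i j
    fin_cases i <;> fin_cases j <;> simp [Matrix.mul_apply]
    · linear_combination (Y 0 0) * ht - hd
    · linear_combination (Y 0 1) * ht
    · linear_combination (Y 1 0) * ht
    · linear_combination (Y 1 1) * ht - hd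
  induction k with
  | zero => simp [sinRatio]
  | succ k ih =>
    rw [pow_succ, ih, sub_mul, Matrix.smul_mul, Matrix.smul_mul, hY, one_mul, sinRatio]
    module

namespace IsMirrorTriple
variable {R : Fin 3 → V3} {ν : Fin 3 → ℕ∞}

/-- The product of the two mirror matrices has trace −2 cos(π/n), so its negative has the
eigenvalues e^{±πi/n}. By Cayley and Hamilton the n-th power of the negative is governed by
`sinRatio` at n and n − 1, which are 0 and 1; it equals −1. -/
theorem rotation_pow (h : IsMirrorTriple R ν) {i j : Fin 3} {n : ℕ} (hn : 2 ≤ n)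
    (hij : form (R i) (R j) = -cosPi n) :
    (toMat (R i) * toMat (R j)) ^ n = (-1 : ℝ) ^ (n + 1) • (1 : RMat) := by
  obtain ⟨h1, h2⟩ := sinRatio_order hn
  have key := pow_succ_eq_sinRatio (Y := -(toMat (R i) * toMat (R j))) (q := cosPi n)
    (by rw [Matrix.det_neg, Matrix.det_mul, h.det_toMat_mirror, h.det_toMat_mirror]; simp)
    (by rw [Matrix.trace_neg, trace_toMat_mul, hij]; ring) (n - 1)
  rw [Nat.sub_add_cancel (by omega), h1, h2, neg_pow] at key
  have h3 : ((-1 : RMat) ^ n) = ((-1 : ℝ) ^ n) • (1 : RMat) := by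
    rcases Nat.even_or_odd n with hn | hn <;> simp [hn.neg_one_pow]
  rw [h3, Matrix.smul_mul, one_mul] at key
  have h4 : ((-1 : ℝ) ^ n) * (-1) ^ n = 1 := by rw [← mul_pow]; simp
  calc _ = ((-1 : ℝ) ^ n) • (((-1 : ℝ) ^ n) • (toMat (R i) * toMat (R j)) ^ n) := by
        rw [smul_smul, h4, one_smul]
    _ = _ := by rw [key, pow_succ]; simp

theorem gen_rotation_pow (h : IsMirrorTriple R ν) {i j : Fin 3} {n : ℕ} (hn : 2 ≤ n)
    (hij : form (R i) (R j) = -cosPi n) : (h.gen i * h.gen j) ^ n = 1 := by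
  have hpow : ∀ n, wordProd h.gen (alternating i j (2 * n)) = (h.gen i * h.gen j) ^ n :=
    fun n => (wordProd_alternating i j n).1
  have hmat : ∀ n, wordMat R (alternating i j (2 * n)) = (toMat (R i) * toMat (R j)) ^ n := by
    intro n
    induction n with
    | zero => simp [alternating]
    | succ n ih =>
      rw [show 2 * (n + 1) = 2 * n + 1 + 1 by ring, alternating, alternating, wordMat_cons,
        wordMat_cons, ih, pow_succ', mul_assoc]
  have hm := (hmat n).trans (h.rotation_pow hn hij)
  rw [← hpow]
  refine Prod.ext ?_ (Prod.ext ?_ ?_)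
  · rw [h.fst_wordProd, hm, realPSL_smul (by simp) (by positivity), realPSL_one]; rfl
  · ext v : 1
    change mirrorRep (wordProd h.gen _) v = v
    rw [h.rep_wordProd]
    apply toMat_injective
    rw [h.toMat_wordAct, hm, Matrix.adjugate_smul]
    simp only [Matrix.adjugate_one, Matrix.smul_mul, Matrix.mul_smul, one_mul, mul_one, smul_smul]
    rw [Fintype.card_fin, Nat.add_one_sub_one, pow_one, ← mul_pow]
    simp
  · rw [h.sign_wordProd]; simp

/-- The three components of `MirrorGroup` keep together what a word determines: the Moebius
transformation, the linear action to which Tits's theorem applies, and the parity. Ideal vertices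
have m = ∞ and carry no braid relation. -/
theorem isReflectionSystem (h : IsMirrorTriple R ν) (hν : ∀ i, 2 ≤ ν i) :
    IsReflectionSystem form R mirrorRep h.gen where
  symm := form_comm
  norm := h.norm
  act _ _ := rfl
  sq := h.gen_sq
  dihedral i j hij := by
    obtain ⟨k, -, -, hk⟩ := h.gram_of_ne hij
    refine ⟨ν k, ?_, fun n hn => ?_, fun n hn => alternating_comm h.gen_sq i j n ?_⟩
    · have := hν k
      rintro h0; rw [h0] at this; simp at this
    · rw [hk, neg_neg]; exact sinRatio_nonneg (hν k) hn
    · have h2 := hν k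
      rw [hn] at hk h2
      exact h.gen_rotation_pow (by exact_mod_cast h2) hk

end IsMirrorTriple

/-! ### The dual basis -/

/-- The basis dual to the normal vectors; its elements represent the vertices. -/
def dual (R : Fin 3 → V3) (ν : Fin 3 → ℕ∞) (i : Fin 3) : V3 :=
  (-(lSq ν)⁻¹) • ((sinPi (ν i) ^ 2) • R i +
    (cosPi (ν i) * cosPi (ν (i + 1)) + cosPi (ν (i + 2))) • R (i + 1) +
    (cosPi (ν i) * cosPi (ν (i + 2)) + cosPi (ν (i + 1))) • R (i + 2))

/-- The sum of the dual basis, an interior point of the chamber. -/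
def weylVector (R : Fin 3 → V3) (ν : Fin 3 → ℕ∞) : V3 := ∑ i, dual R ν i

theorem lSq_cyclic (ν : Fin 3 → ℕ∞) (i : Fin 3) :
    lSq ν = cosPi (ν i) ^ 2 + cosPi (ν (i + 1)) ^ 2 + cosPi (ν (i + 2)) ^ 2 +
    2 * cosPi (ν i) * cosPi (ν (i + 1)) * cosPi (ν (i + 2)) - 1 := by
  unfold lSq
  fin_cases i <;> simp only [Fin.zero_eta, Fin.mk_one, Fin.reduceFinMk, Fin.reduceAdd,
    zero_add, Fin.isValue] <;> ring

namespace IsMirrorTriple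
variable {R : Fin 3 → V3} {ν : Fin 3 → ℕ∞}

theorem gram_cyclic (h : IsMirrorTriple R ν) (i : Fin 3) :
    form (R i) (R (i + 1)) = -cosPi (ν (i + 2)) ∧ form (R (i + 1)) (R i) = -cosPi (ν (i + 2)) ∧
    form (R i) (R (i + 2)) = -cosPi (ν (i + 1)) ∧ form (R (i + 2)) (R i) = -cosPi (ν (i + 1)) ∧
    form (R (i + 1)) (R (i + 2)) = -cosPi (ν i) ∧ form (R (i + 2)) (R (i + 1)) = -cosPi (ν i)
    := by
  have h0 := h.gram i
  have h1 := h.gram (i + 1)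
  have h2 := h.gram (i + 2)
  rw [show i + 1 + 1 = i + 2 by grind, show i + 1 + 2 = i by grind] at h1
  rw [show i + 2 + 1 = i by grind, show i + 2 + 2 = i + 1 by grind] at h2
  refine ⟨h2, ?_, ?_, h1, h0, ?_⟩ <;> rw [form_comm] <;> assumption

/-- The coefficients of `dual` are the cofactors of the Gram matrix of the normals, divided by its
determinant −l². -/
theorem form_dual (h : IsMirrorTriple R ν) (hl : 0 < lSq ν) (i : Fin 3) :
    form (dual R ν i) (R i) = 1 ∧ form (dual R ν i) (R (i + 1)) = 0 ∧
      form (dual R ν i) (R (i + 2)) = 0 := by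
  obtain ⟨h1, h2, h3, h4, h5, h6⟩ := h.gram_cyclic i
  have hl' := hl.ne'
  simp only [dual, map_smul, map_add, LinearMap.smul_apply, LinearMap.add_apply, smul_eq_mul,
    h1, h2, h3, h4, h5, h6, h.norm, sinPi_sq]
  refine ⟨?_, ?_, ?_⟩
  · rw [neg_mul, neg_eq_iff_eq_neg, inv_mul_eq_iff_eq_mul₀ hl', lSq_cyclic ν i]; ring
  · ring
  · ring

theorem form_dual_eq (h : IsMirrorTriple R ν) (hl : 0 < lSq ν) (i j : Fin 3) :
    form (dual R ν i) (R j) = if i = j then 1 else 0 := by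
  obtain ⟨h1, h2, h3⟩ := h.form_dual hl i
  rcases (by grind : j = i ∨ j = i + 1 ∨ j = i + 2) with rfl | rfl | rfl
  · simp [h1]
  · rw [h2, if_neg (by grind)]
  · rw [h3, if_neg (by grind)]

theorem form_dual_dual (h : IsMirrorTriple R ν) (hl : 0 < lSq ν) (i : Fin 3) :
    form (dual R ν i) (dual R ν i) = -(sinPi (ν i) ^ 2 / lSq ν) ∧
    form (dual R ν i) (dual R ν (i + 1)) =
      -((cosPi (ν i) * cosPi (ν (i + 1)) + cosPi (ν (i + 2))) / lSq ν) ∧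
    form (dual R ν i) (dual R ν (i + 2)) =
      -((cosPi (ν i) * cosPi (ν (i + 2)) + cosPi (ν (i + 1))) / lSq ν) := by
  obtain ⟨h1, h2, h3⟩ := h.form_dual hl i
  refine ⟨?_, ?_, ?_⟩
  · nth_rewrite 2 [dual]
    simp only [map_smul, map_add, smul_eq_mul, h1, h2, h3]
    ring
  · nth_rewrite 2 [dual]
    simp only [map_smul, map_add, smul_eq_mul, h2, h3, show i + 1 + 1 = i + 2 by grind,
      show i + 1 + 2 = i by grind, h1]
    ring
  · nth_rewrite 2 [dual]
    simp only [map_smul, map_add, smul_eq_mul, h2, h3, show i + 2 + 1 = i by grind,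
      show i + 2 + 2 = i + 1 by grind, h1]
    ring

theorem sum_form_smul (h : IsMirrorTriple R ν) (hl : 0 < lSq ν) (v : V3) :
    v = ∑ j, form v (dual R ν j) • R j := by
  have hd : ∀ c : Fin 3 → ℝ, ∀ i, form (∑ j, c j • R j) (dual R ν i) = c i := by
    intro c i
    simp [map_sum, LinearMap.sum_apply, form_comm (R _), h.form_dual_eq hl]
  have hli : LinearIndependent ℝ R := by
    rw [Fintype.linearIndependent_iff]
    intro c hc i
    rw [← hd c i, hc]; simp
  let b := basisOfLinearIndependentOfCardEqFinrank hli (by simp)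
  have hv := b.sum_repr v
  have hb : ∀ j, b j = R j := fun j => by simp [b]
  simp only [hb] at hv
  rw [← hv]
  simp only [hd]

end IsMirrorTriple

/-! ### Causal vectors -/

/-- The closed future cone of the quadratic space. -/
def IsFuture (v : V3) : Prop := v 0 ^ 2 ≤ v 1 * v 2 ∧ 0 ≤ v 1 ∧ 0 ≤ v 2

theorem isFuture_or {v : V3} (h : form v v ≤ 0) : IsFuture v ∨ IsFuture (-v) := by
  rw [form_apply] at h
  have h' : v 0 ^ 2 ≤ v 1 * v 2 := by linarith
  have h0 : 0 ≤ v 1 * v 2 := (sq_nonneg _).trans h'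
  rcases mul_nonneg_iff.mp h0 with h1 | h1
  · exact .inl ⟨h', h1⟩
  · exact .inr ⟨by simpa using h', by simpa using h1.1, by simpa using h1.2⟩

/-- The reversed Cauchy–Schwarz inequality: |v₀w₀| is at most the geometric mean of v₁w₂ and v₂w₁,
hence at most the arithmetic mean. -/
theorem IsFuture.form_nonpos {v w : V3} (hv : IsFuture v) (hw : IsFuture w) : form v w ≤ 0 := by
  obtain ⟨h1, h2, h3⟩ := hv
  obtain ⟨k1, k2, k3⟩ := hw
  rw [form_apply]
  have h4 : (v 0 * w 0) ^ 2 ≤ ((v 1 * w 2 + v 2 * w 1) / 2) ^ 2 := by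
    have : (v 0 * w 0) ^ 2 ≤ (v 1 * v 2) * (w 1 * w 2) := by
      rw [mul_pow]; gcongr
    nlinarith [sq_nonneg (v 1 * w 2 - v 2 * w 1)]
  have := abs_le_of_sq_le_sq' h4 (by positivity)
  linarith [this.2]

/-- The orthogonal complement of a timelike vector is positive definite. Here the vanishing of the
pairing is turned into the vanishing of a sum of three nonnegative terms. -/
theorem IsFuture.eq_zero {v w : V3} (hv : form v v < 0) (hw : form w w ≤ 0)
    (h : form v w = 0) : w = 0 := by
  rw [form_apply] at hv hw h
  have h1 : 0 < v 1 * v 2 := by nlinarith [sq_nonneg (v 0)]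
  have h2 : 0 ≤ w 1 * w 2 := by nlinarith [sq_nonneg (w 0)]
  have key : (v 1 * w 2 - v 2 * w 1) ^ 2 + 4 * ((v 1 * v 2 - v 0 ^ 2) * (w 1 * w 2)) +
      4 * (v 0 ^ 2 * (w 1 * w 2 - w 0 ^ 2)) = 0 := by
    have : (v 1 * w 2 + v 2 * w 1) ^ 2 = 4 * (v 0 * w 0) ^ 2 := by
      have : v 1 * w 2 + v 2 * w 1 = 2 * (v 0 * w 0) := by linarith
      rw [this]; ring
    linear_combination this
  have k1 : 0 ≤ (v 1 * v 2 - v 0 ^ 2) * (w 1 * w 2) := mul_nonneg (by nlinarith) h2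
  have k2 : 0 ≤ v 0 ^ 2 * (w 1 * w 2 - w 0 ^ 2) := mul_nonneg (sq_nonneg _) (by nlinarith)
  have k3 : (v 1 * v 2 - v 0 ^ 2) * (w 1 * w 2) = 0 := by
    nlinarith [sq_nonneg (v 1 * w 2 - v 2 * w 1)]
  have k4 : w 1 * w 2 = 0 := (mul_eq_zero.mp k3).resolve_left (by nlinarith)
  have k5 : v 1 * w 2 - v 2 * w 1 = 0 := by
    have : (v 1 * w 2 - v 2 * w 1) ^ 2 = 0 := by
      nlinarith [sq_nonneg (v 1 * w 2 - v 2 * w 1)]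
    simpa using this
  have k6 : w 0 = 0 := by
    have : w 0 ^ 2 = 0 := by nlinarith [sq_nonneg (w 0)]
    simpa using this
  have hv1 : v 1 ≠ 0 := by rintro h0; rw [h0] at h1; simp at h1
  have hv2 : v 2 ≠ 0 := by rintro h0; rw [h0] at h1; simp at h1
  have k7 : w 1 = 0 ∧ w 2 = 0 := by
    rcases mul_eq_zero.mp k4 with h0 | h0
    · rw [h0] at k5; simp [hv1] at k5; exact ⟨h0, k5⟩
    · rw [h0] at k5; simp [hv2] at k5; exact ⟨k5, h0⟩
  ext i; fin_cases i
  · exact k6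
  · exact k7.1
  · exact k7.2

/-- Time orientation is transitive. -/
theorem form_nonpos_of_causal {u r r' : V3} (hu : form u u ≤ 0) (hr : form r r < 0)
    (hr' : form r' r' ≤ 0) (hrr : form r r' < 0) (hur : form u r ≤ 0) : form u r' ≤ 0 := by
  have main : ∀ r r' : V3, form r r < 0 → form r' r' ≤ 0 → form r r' < 0 → form u r ≤ 0 →
      IsFuture r → form u r' ≤ 0 := by
    intro r r' hr hr' hrr hur hf
    have hf' : IsFuture r' := by
      refine (isFuture_or hr').resolve_right fun h => ?_
      have := hf.form_nonpos h
      simp at this; linarith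
    rcases isFuture_or hu with h | h
    · exact h.form_nonpos hf'
    · have := h.form_nonpos hf
      simp only [map_neg, LinearMap.neg_apply] at this
      have : u = 0 := IsFuture.eq_zero hr hu (by rw [form_comm]; linarith)
      simp [this]
  rcases isFuture_or hr.le with h | h
  · exact main r r' hr hr' hrr hur h
  · refine le_of_eq_of_le ?_ (?_ : form (-u) (-r') ≤ 0)
    · simp
    · have hrn : form (-r) (-r) < 0 := by simpa using hr
      rcases isFuture_or hr' with hf' | hf'
      · have := h.form_nonpos hf'
        simp at this; linarith
      rcases isFuture_or hu with h' | h'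
      · have := h'.form_nonpos h
        simp only [map_neg] at this
        have : u = 0 := IsFuture.eq_zero hr hu (by rw [form_comm]; linarith)
        simp [this]
      · exact h'.form_nonpos hf'

theorem exists_least {S : Set ℝ} (hS : S.Nonempty) (hfin : ∀ M, {x ∈ S | x ≤ M}.Finite) :
    ∃ m ∈ S, ∀ x ∈ S, m ≤ x := by
  obtain ⟨y, hy⟩ := hS
  obtain ⟨m, hm, hmin⟩ := (hfin y).exists_minimalFor id _ ⟨y, hy, le_rfl⟩
  refine ⟨m, hm.1, fun x hx => ?_⟩
  rcases le_total x y with h | h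
  · rcases le_total m x with h' | h'
    · exact h'
    · exact hmin ⟨hx, h⟩ h'
  · exact hm.2.trans h

/-! ### The group of even words -/

/-- The transformation of a mirror: the reflection in the hyperplane of the hyperbolic space,
restricted to the circle at infinity. -/
def mirrorPSL (R : Fin 3 → V3) (i : Fin 3) : PSL(2, ℂ) := realPSL (toMat (R i))

/-- The rotation about the vertex opposite to a side. -/
def rotation (R : Fin 3 → V3) (i : Fin 3) : PSL(2, ℂ) :=
  mirrorPSL R (i + 1) * mirrorPSL R (i + 2)

/-- The group generated by the products of pairs of mirrors. -/
def evenGroup (R : Fin 3 → V3) : Subgroup PSL(2, ℂ) :=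
  Subgroup.closure (Set.range (rotation R))

/-- The coordinates of the traceless part of a matrix. -/
def tracelessPart (M : RMat) : V3 := ![(M 0 0 - M 1 1) / 2, -M 0 1, M 1 0]

theorem eq_add_toMat (M : RMat) : M = (M.trace / 2) • (1 : RMat) + toMat (tracelessPart M) := by
  ext i j
  fin_cases i <;> fin_cases j <;> simp [toMat, tracelessPart, Matrix.trace_fin_two] <;> ring

theorem form_tracelessPart (M : RMat) :
    form (tracelessPart M) (tracelessPart M) = (M.trace / 2) ^ 2 - M.det := by
  simp [form_apply, tracelessPart, Matrix.trace_fin_two, Matrix.det_fin_two]; ring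

theorem tracelessPart_smul (c : ℝ) (M : RMat) :
    tracelessPart (c • M) = c • tracelessPart M := by
  ext i; fin_cases i <;> simp [tracelessPart]; ring

theorem realPSL_eq_one_of_tracelessPart {M : RMat} (hM : M.det ≠ 0) (h : tracelessPart M = 0) :
    realPSL M = 1 := by
  have h1 := eq_add_toMat M
  have h0 : toMat 0 = 0 := by ext i j; fin_cases i <;> fin_cases j <;> simp [toMat]
  rw [h, h0, add_zero] at h1
  have h2 : M.trace / 2 ≠ 0 := by
    intro h2; rw [h1, h2] at hM; simp at hM
  rw [h1, realPSL_smul (by simp) h2, realPSL_one]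

namespace IsMirrorTriple
variable {R : Fin 3 → V3} {ν : Fin 3 → ℕ∞}

theorem mirrorPSL_sq (h : IsMirrorTriple R ν) (i : Fin 3) :
    mirrorPSL R i * mirrorPSL R i = 1 := congrArg Prod.fst (h.gen_sq i)

theorem realPSL_wordMat (h : IsMirrorTriple R ν) (L : List (Fin 3)) :
    realPSL (wordMat R L) = wordProd (mirrorPSL R) L := by
  induction L with
  | nil => simp [realPSL_one]
  | cons i L ih =>
    rw [wordProd_cons, wordMat_cons, realPSL_mul (by simp [h.det_toMat_mirror])
      (h.det_wordMat_ne_zero L), ih, mirrorPSL]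

theorem rotation_cyclic (h : IsMirrorTriple R ν) (i : Fin 3) :
    rotation R i * rotation R (i + 1) * rotation R (i + 2) = 1 := by
  simp only [rotation, show i + 1 + 1 = i + 2 by grind, show i + 1 + 2 = i by grind,
    show i + 2 + 1 = i by grind, show i + 2 + 2 = i + 1 by grind]
  have h0 := h.mirrorPSL_sq i
  have h1 := h.mirrorPSL_sq (i + 1)
  have h2 := h.mirrorPSL_sq (i + 2)
  calc _ = mirrorPSL R (i + 1) * (mirrorPSL R (i + 2) * mirrorPSL R (i + 2)) *
      (mirrorPSL R i * mirrorPSL R i) * mirrorPSL R (i + 1) := by group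
    _ = 1 := by rw [h2, h0]; simpa using h1

theorem rotation_inv (h : IsMirrorTriple R ν) (i : Fin 3) :
    (rotation R i)⁻¹ = mirrorPSL R (i + 2) * mirrorPSL R (i + 1) := by
  rw [rotation, mul_inv_rev, inv_eq_of_mul_eq_one_right (h.mirrorPSL_sq _),
    inv_eq_of_mul_eq_one_right (h.mirrorPSL_sq _)]

theorem mul_mem_evenGroup (h : IsMirrorTriple R ν) (i j : Fin 3) :
    mirrorPSL R i * mirrorPSL R j ∈ evenGroup R := by
  have hr : ∀ i, rotation R i ∈ evenGroup R := fun i => Subgroup.subset_closure ⟨i, rfl⟩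
  rcases (by grind : j = i ∨ j = i + 1 ∨ j = i + 2) with rfl | rfl | rfl
  · rw [h.mirrorPSL_sq]; exact one_mem _
  · have := hr (i + 2)
    rw [rotation, show i + 2 + 1 = i by grind, show i + 2 + 2 = i + 1 by grind] at this
    exact this
  · have := inv_mem (hr (i + 1))
    rw [h.rotation_inv, show i + 1 + 1 = i + 2 by grind, show i + 1 + 2 = i by grind] at this
    exact this

theorem mem_evenGroup_of_word (h : IsMirrorTriple R ν) : ∀ (n : ℕ) (L : List (Fin 3)),
    L.length = 2 * n → wordProd (mirrorPSL R) L ∈ evenGroup R := by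
  intro n
  induction n with
  | zero => intro L hL; obtain rfl := List.length_eq_zero_iff.mp hL; exact one_mem _
  | succ n ih =>
    rintro (_ | ⟨a, _ | ⟨b, L⟩⟩) hL
    · simp at hL
    · simp at hL; omega
    · rw [wordProd_cons, wordProd_cons, ← mul_assoc]
      exact mul_mem (h.mul_mem_evenGroup a b) (ih L (by simp at hL; omega))

theorem mem_evenGroup_iff (h : IsMirrorTriple R ν) (g : PSL(2, ℂ)) :
    g ∈ evenGroup R ↔ ∃ L : List (Fin 3), Even L.length ∧ g = wordProd (mirrorPSL R) L := by
  constructor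
  · intro hg
    induction hg using Subgroup.closure_induction with
    | mem x hx =>
      obtain ⟨i, rfl⟩ := hx
      exact ⟨[i + 1, i + 2], by simp, by simp [rotation]⟩
    | one => exact ⟨[], by simp, rfl⟩
    | mul x y _ _ hx hy =>
      obtain ⟨L, h1, rfl⟩ := hx
      obtain ⟨L', h2, rfl⟩ := hy
      exact ⟨L ++ L', by simpa using h1.add h2, by simp⟩
    | inv x _ hx =>
      obtain ⟨L, h1, rfl⟩ := hx
      exact ⟨L.reverse, by simpa using h1, (wordProd_reverse h.mirrorPSL_sq L).symm⟩
  · rintro ⟨L, ⟨n, hn⟩, rfl⟩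
    exact h.mem_evenGroup_of_word n L (by omega)

theorem evenGroup_eq_closure (h : IsMirrorTriple R ν) (i : Fin 3) :
    evenGroup R = Subgroup.closure {rotation R i, rotation R (i + 1)} := by
  apply le_antisymm
  · rw [evenGroup, Subgroup.closure_le]
    have h0 : rotation R i ∈ Subgroup.closure {rotation R i, rotation R (i + 1)} :=
      Subgroup.subset_closure (by simp)
    have h1 : rotation R (i + 1) ∈ Subgroup.closure {rotation R i, rotation R (i + 1)} :=
      Subgroup.subset_closure (by simp)
    rintro _ ⟨j, rfl⟩
    rcases (by grind : j = i ∨ j = i + 1 ∨ j = i + 2) with rfl | rfl | rfl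
    · exact h0
    · exact h1
    · rw [← inv_eq_of_mul_eq_one_right (h.rotation_cyclic i)]
      exact inv_mem (mul_mem h0 h1)
  · rw [Subgroup.closure_le]
    rintro _ (rfl | rfl) <;> exact Subgroup.subset_closure ⟨_, rfl⟩

/-! ### Chamber geometry of a mirror triple -/

theorem dual_mem_chamber (h : IsMirrorTriple R ν) (hν : IsHyperbolicSignature ν)
    (i : Fin 3) : dual R ν i ∈ chamber form R := by
  intro j
  rw [h.form_dual_eq hν.lSq_pos]
  split_ifs <;> simp

theorem form_weylVector (h : IsMirrorTriple R ν) (hν : IsHyperbolicSignature ν)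
    (i : Fin 3) : form (weylVector R ν) (R i) = 1 := by
  simp [weylVector, LinearMap.sum_apply, map_sum, h.form_dual_eq hν.lSq_pos]

theorem form_dual_nonpos (h : IsMirrorTriple R ν) (hν : IsHyperbolicSignature ν)
    (i j : Fin 3) : form (dual R ν i) (dual R ν j) ≤ 0 := by
  obtain ⟨h1, h2, h3⟩ := h.form_dual_dual hν.lSq_pos i
  have hl := hν.lSq_pos
  have q := fun i => cosPi_nonneg (hν.1 i)
  rcases (by grind : j = i ∨ j = i + 1 ∨ j = i + 2) with rfl | rfl | rfl
  · rw [h1, neg_nonpos]; positivity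
  · rw [h2, neg_nonpos]
    exact div_nonneg (add_nonneg (mul_nonneg (q _) (q _)) (q _)) hl.le
  · rw [h3, neg_nonpos]
    exact div_nonneg (add_nonneg (mul_nonneg (q _) (q _)) (q _)) hl.le

theorem form_dual_neg (h : IsMirrorTriple R ν) (hν : IsHyperbolicSignature ν)
    {i j : Fin 3} (hij : i ≠ j) : form (dual R ν i) (dual R ν j) < 0 := by
  obtain ⟨h1, h2, h3⟩ := h.form_dual_dual hν.lSq_pos i
  have hl := hν.lSq_pos
  rcases (by grind : j = i ∨ j = i + 1 ∨ j = i + 2) with rfl | rfl | rfl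
  · exact absurd rfl hij
  · rw [h2, neg_lt_zero]
    have := hν.cos_cross_pos (i + 2)
    rw [show i + 2 + 1 = i by grind, show i + 2 + 2 = i + 1 by grind] at this
    exact div_pos this hl
  · rw [h3, neg_lt_zero]
    have := hν.cos_cross_pos (i + 1)
    rw [show i + 1 + 1 = i + 2 by grind, show i + 1 + 2 = i by grind, mul_comm] at this
    exact div_pos this hl

theorem form_weylVector_neg (h : IsMirrorTriple R ν) (hν : IsHyperbolicSignature ν)
    : form (weylVector R ν) (weylVector R ν) < 0 := by
  have h1 := h.form_dual_neg hν (show (0 : Fin 3) ≠ 1 by decide)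
  have h2 := h.form_dual_nonpos hν
  simp only [weylVector, Fin.sum_univ_three, map_add, LinearMap.add_apply]
  linarith [h2 0 0, h2 0 2, h2 1 0, h2 1 1, h2 1 2, h2 2 0, h2 2 1, h2 2 2]

theorem sum_form_dual (h : IsMirrorTriple R ν) (hν : IsHyperbolicSignature ν)
    (v : V3) : v = ∑ j, form v (R j) • dual R ν j := by
  have key : ∀ w : V3, (∀ j, form w (R j) = 0) → w = 0 := by
    intro w hw
    rw [h.sum_form_smul hν.lSq_pos w]
    refine Finset.sum_eq_zero fun j _ => ?_
    rw [h.sum_form_smul hν.lSq_pos (dual R ν j)]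
    simp [hw]
  rw [← sub_eq_zero]
  apply key
  intro i
  simp [LinearMap.sum_apply, map_sum, h.form_dual_eq hν.lSq_pos]

theorem form_wordAct (h : IsMirrorTriple R ν) (hν : IsHyperbolicSignature ν)
    (L : List (Fin 3)) (v w : V3) :
    form (wordAct R L v) (wordAct R L w) = form v w := by
  rw [← h.rep_wordProd, ← h.rep_wordProd, (h.isReflectionSystem hν.1).bilin_word]

theorem form_wordAct_left (h : IsMirrorTriple R ν) (hν : IsHyperbolicSignature ν)
    (L : List (Fin 3)) (v w : V3) :
    form (wordAct R L v) w = form v (wordAct R L.reverse w) := by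
  rw [← h.rep_wordProd, ← h.rep_wordProd, (h.isReflectionSystem hν.1).bilin_word_left]

theorem wordAct_smul (h : IsMirrorTriple R ν) (L : List (Fin 3)) (c : ℝ) (v : V3) :
    wordAct R L (c • v) = c • wordAct R L v := by
  rw [← h.rep_wordProd, ← h.rep_wordProd, map_smul]

/-- The root b = w⁻¹R_i is nonnegative on the chamber, so b is a combination of the normals with
coefficients x, y, z ≥ 0. All Gram entries off the diagonal are ≤ 0, hence 1 = form b b ≤ (x + y +
z)², while x + y + z is the pairing of b with the Weyl vector. -/
theorem one_le_form (h : IsMirrorTriple R ν) (hν : IsHyperbolicSignature ν)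
    (L : List (Fin 3)) (i : Fin 3)
    (hL : ∀ d ∈ chamber form R, 0 ≤ form (wordAct R L d) (R i)) :
    1 ≤ form (wordAct R L (weylVector R ν)) (R i) := by
  set b := wordAct R L.reverse (R i) with hb
  have hc : ∀ d, form (wordAct R L d) (R i) = form b d := fun d => by
    rw [h.form_wordAct_left hν, form_comm]
  have h1 : form b b = 1 := by rw [hb, h.form_wordAct hν, h.norm]
  have h2 : ∀ j, 0 ≤ form b (dual R ν j) := fun j => by
    rw [← hc]; exact hL _ (h.dual_mem_chamber hν j)
  have h3 : form b (weylVector R ν) =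
      form b (dual R ν 0) + form b (dual R ν 1) + form b (dual R ν 2) := by
    simp [weylVector, Fin.sum_univ_three]
  rw [hc, h3]
  have h4 := h.sum_form_smul hν.lSq_pos b
  rw [Fin.sum_univ_three] at h4
  have hx := h2 0
  have hy := h2 1
  have hz := h2 2
  clear h2
  generalize form b (dual R ν 0) = x, form b (dual R ν 1) = y, form b (dual R ν 2) = z
    at hx hy hz h4 ⊢
  obtain ⟨g1, g2, g3, g4, g5, g6⟩ := h.gram_cyclic 0
  simp only [zero_add, Fin.isValue] at g1 g2 g3 g4 g5 g6
  rw [h4] at h1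
  simp only [map_add, map_smul, LinearMap.add_apply, LinearMap.smul_apply, smul_eq_mul, g1, g2, g3,
    g4, g5, g6, h.norm] at h1
  have q := fun i => cosPi_nonneg (hν.1 i)
  have e1 := mul_nonneg (mul_nonneg hx hy) (q 2)
  have e2 := mul_nonneg (mul_nonneg hx hz) (q 1)
  have e3 := mul_nonneg (mul_nonneg hy hz) (q 0)
  have e4 : 1 ≤ (x + y + z) ^ 2 := by
    nlinarith [mul_nonneg hx hy, mul_nonneg hx hz, mul_nonneg hy hz]
  nlinarith

end IsMirrorTriple

/-! ### Discreteness, reduction to the chamber, stabilizers -/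

namespace IsMirrorTriple
variable {R : Fin 3 → V3} {ν : Fin 3 → ℕ∞}

/-- The mirror group acts discretely. -/
theorem finite_weylVector (h : IsMirrorTriple R ν) (hν : IsHyperbolicSignature ν) (M : ℝ) :
    {x : PSL(2, ℂ) × ℝ | ∃ L, x = (wordProd (mirrorPSL R) L,
      form (wordAct R L (weylVector R ν)) (weylVector R ν)) ∧ -M ≤ x.2}.Finite := by
  have h1 := (h.isReflectionSystem hν.1).finite_bilin_word zero_lt_one (h.form_weylVector hν)
    (fun L i hL => by
      rw [h.rep_wordProd]
      exact h.one_le_form hν L i fun d hd => by rw [← h.rep_wordProd]; exact hL d hd) M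
  refine (h1.image fun w => (w.1, form (mirrorRep w (weylVector R ν)) (weylVector R ν))).subset ?_
  rintro _ ⟨L, rfl, hL⟩
  refine ⟨wordProd h.gen L, ⟨L, rfl, ?_⟩, ?_⟩
  · rw [h.rep_wordProd]; exact hL
  · simp only [h.rep_wordProd, h.fst_wordProd, h.realPSL_wordMat]

/-- A causal vector whose orbit has a point next to the base point is equivalent to a point of
the chamber. -/
theorem exists_mem_chamber (h : IsMirrorTriple R ν) (hν : IsHyperbolicSignature ν) {u : V3}
    (hu : form u u ≤ 0)
    (hfin : ∀ M, {x : ℝ | ∃ L, x = form (wordAct R L u) (weylVector R ν) ^ 2 ∧ x ≤ M}.Finite) :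
    ∃ (L : List (Fin 3)) (e : ℝ), (e = 1 ∨ e = -1) ∧ e • wordAct R L u ∈ chamber form R := by
  -- The orbit vector nearest to the Weyl vector; the square makes the choice independent of the
  -- time orientation of `u`.
  obtain ⟨_, ⟨L, rfl⟩, hmin⟩ := exists_least
    (S := {x : ℝ | ∃ L, x = form (wordAct R L u) (weylVector R ν) ^ 2}) ⟨_, [], rfl⟩
    (fun M => (hfin M).subset (by rintro x ⟨⟨L, hL⟩, hx⟩; exact ⟨L, hL, hx⟩))
  set r := weylVector R ν with hr
  have key : ∀ e : ℝ, (e = 1 ∨ e = -1) → form (e • wordAct R L u) r ≤ 0 →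
      e • wordAct R L u ∈ chamber form R := by
    intro e he hneg i
    by_contra! hlt
    set w := e • wordAct R L u with hw
    have hww : form w w ≤ 0 := by
      rw [hw]
      simp only [map_smul, LinearMap.smul_apply, smul_eq_mul, h.form_wordAct hν]
      rcases he with rfl | rfl <;> linarith
    have hrr := h.form_weylVector_neg hν
    have h1 : form (R i) r = 1 := by rw [form_comm]; exact h.form_weylVector hν i
    have h2 : form (reflect (R i) w) r = form w r - 2 * form w (R i) := by
      simp [reflect, h1]
    have h3 : form (reflect (R i) w) r = form w (reflect (R i) r) := by
      rw [h2]; simp [reflect, h.form_weylVector hν i, hr]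
    have h4 : form r (reflect (R i) r) = form r r - 2 := by
      simp [reflect, h.form_weylVector hν i, hr]
    have h5 : form (reflect (R i) r) (reflect (R i) r) = form r r :=
      h.form_wordAct hν [i] r r
    -- Reflection preserves time orientation, so the pairing of the reflected vector with `r` is
    -- still ≤ 0. It exceeds form w r by −2 form w (R i) > 0, hence has a smaller square, against
    -- minimality.
    have h6 := form_nonpos_of_causal hww hrr (by rw [h5]; exact hrr.le) (by rw [h4]; linarith)
      hneg
    rw [← h3, h2] at h6
    have h7 := hmin _ ⟨i :: L, rfl⟩
    have h8 : form (wordAct R (i :: L) u) r ^ 2 = form (reflect (R i) w) r ^ 2 := by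
      have : reflect (R i) w = e • wordAct R (i :: L) u := by
        rw [hw]; exact h.wordAct_smul [i] e _
      rw [this]
      rcases he with rfl | rfl <;> simp
    have h9 : form (wordAct R L u) r ^ 2 = form w r ^ 2 := by
      rw [hw]
      rcases he with rfl | rfl <;> simp
    rw [h8, h9, h2] at h7
    nlinarith
  rcases le_total (form (wordAct R L u) r) 0 with h0 | h0
  · exact ⟨L, 1, .inl rfl, key 1 (.inl rfl) (by simpa using h0)⟩
  · exact ⟨L, -1, .inr rfl, key (-1) (.inr rfl) (by simpa using h0)⟩

/-- Words in the two mirrors through a vertex form a dihedral group whose even part is generated by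
the rotation. The induction needs both parities; an odd word is completed by the mirror i + 1,
conjugation with which inverts the rotation. -/
theorem mem_zpowers_of_word (h : IsMirrorTriple R ν) (i : Fin 3) (L : List (Fin 3))
    (hL : ∀ j ∈ L, j ≠ i) :
    (Even L.length → wordProd (mirrorPSL R) L ∈ Subgroup.zpowers (rotation R i)) ∧
    (¬ Even L.length → wordProd (mirrorPSL R) L * mirrorPSL R (i + 1) ∈
      Subgroup.zpowers (rotation R i)) := by
  have sq := h.mirrorPSL_sq
  have hconj : ∀ w ∈ Subgroup.zpowers (rotation R i),
      mirrorPSL R (i + 1) * w * mirrorPSL R (i + 1) ∈ Subgroup.zpowers (rotation R i) := by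
    rintro _ ⟨n, rfl⟩
    refine ⟨-n, ?_⟩
    have h1 : mirrorPSL R (i + 1) = (mirrorPSL R (i + 1))⁻¹ :=
      (inv_eq_of_mul_eq_one_right (sq _)).symm
    have h2 : mirrorPSL R (i + 1) * (rotation R i) ^ n * mirrorPSL R (i + 1) =
        mirrorPSL R (i + 1) * (rotation R i) ^ n * (mirrorPSL R (i + 1))⁻¹ := by rw [← h1]
    simp only
    rw [h2, ← conj_zpow, zpow_neg, ← inv_zpow, h.rotation_inv]
    congr 1
    rw [rotation, ← mul_assoc, sq, one_mul, ← h1]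
  induction L with
  | nil => simp [one_mem]
  | cons j L ih =>
    obtain ⟨ih1, ih2⟩ := ih fun j hj => hL j (List.mem_cons_of_mem _ hj)
    have hj : j = i + 1 ∨ j = i + 2 := by
      have := hL j (by simp); grind
    have hrj : mirrorPSL R j * mirrorPSL R (i + 1) ∈ Subgroup.zpowers (rotation R i) := by
      rcases hj with rfl | rfl
      · rw [sq]; exact one_mem _
      · rw [← h.rotation_inv]; exact inv_mem (Subgroup.mem_zpowers _)
    have sq' : ∀ x, mirrorPSL R (i + 1) * (mirrorPSL R (i + 1) * x) = x := fun x => by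
      rw [← mul_assoc, sq, one_mul]
    rw [wordProd_cons, List.length_cons, Nat.even_add_one]
    constructor
    · intro hodd
      have := mul_mem hrj (hconj _ (ih2 hodd))
      simpa only [mul_assoc, sq', sq, mul_one] using this
    · intro hev
      have hev := not_not.mp hev
      have := mul_mem hrj (hconj _ (ih1 hev))
      simpa only [mul_assoc, sq', sq, mul_one] using this

/-- The stabilizer of a point of the chamber in the group of even words. -/
theorem stabilizer (h : IsMirrorTriple R ν) (hν : IsHyperbolicSignature ν) {d : V3}
    (hd : d ∈ chamber form R) (hd0 : d ≠ 0) {L : List (Fin 3)} (hL : Even L.length)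
    (hfix : wordAct R L d = d) (hne : wordProd (mirrorPSL R) L ≠ 1) :
    ∃ i, ∃ c : ℝ, 0 < c ∧ d = c • dual R ν i ∧
      wordProd (mirrorPSL R) L ∈ Subgroup.zpowers (rotation R i) := by
  obtain ⟨-, L', h1, h2⟩ := (h.isReflectionSystem hν.1).exists_word_of_mem_chamber hd hd L
    (by rw [h.rep_wordProd, hfix])
  have hw : wordProd (mirrorPSL R) L' = wordProd (mirrorPSL R) L := by
    rw [← h.realPSL_wordMat, ← h.realPSL_wordMat, ← h.fst_wordProd, ← h.fst_wordProd, h1]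
  -- The word made of mirrors through `d` may have another length, but the sign component shows that
  -- its parity is the same.
  have hev : Even L'.length := by
    have h3 := h.sign_wordProd L'
    rw [h1, h.sign_wordProd, hL.neg_one_pow] at h3
    by_contra hodd
    rw [(Nat.not_even_iff_odd.mp hodd).neg_one_pow] at h3
    exact absurd h3 (by decide)
  rw [← hw] at hne ⊢
  have hsum := h.sum_form_dual hν d
  have hex : ∃ i, form d (R i) ≠ 0 := by
    by_contra! hall
    apply hd0
    rw [hsum]; simp [hall]
  obtain ⟨i, hi⟩ := hex
  have hLi : ∀ j ∈ L', j ≠ i := by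
    rintro j hj rfl; exact hi (h2 j hj)
  have hz := (h.mem_zpowers_of_word i L' hLi).1 hev
  refine ⟨i, form d (R i), lt_of_le_of_ne (hd i) (Ne.symm hi), ?_, hz⟩
  -- An even word in a single mirror is trivial. So the word uses two mirrors, both contain `d`, and
  -- `d` is a multiple of the vertex where they meet.
  have hsame : ∀ k, (∀ j ∈ L', j = k) → False := by
    intro k hk
    apply hne
    have : L' = List.replicate L'.length k := List.eq_replicate_of_mem hk
    rw [this]
    obtain ⟨n, hn⟩ := hev
    rw [wordProd, List.map_replicate, List.prod_replicate, hn, ← two_mul, pow_mul, pow_two,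
      h.mirrorPSL_sq, one_pow]
  have hz' : ∀ j, j ≠ i → form d (R j) = 0 := by
    intro j hj
    by_contra hj'
    have hLj : ∀ k ∈ L', k ≠ j := by
      rintro k hk rfl; exact hj' (h2 k hk)
    have third : ∀ i j : Fin 3, j ≠ i → ∃ k, ∀ m : Fin 3, m ≠ i → m ≠ j → m = k := by decide
    obtain ⟨k, hk⟩ := third i j hj
    exact hsame k fun m hm => hk m (hLi m hm) (hLj m hm)
  conv_lhs => rw [hsum]
  rw [Finset.sum_eq_single i]
  · intro j _ hj; rw [hz' j hj, zero_smul]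
  · simp

/-- Isotropic vectors of the chamber. -/
theorem isotropic_mem_chamber (h : IsMirrorTriple R ν) (hν : IsHyperbolicSignature ν) {d : V3}
    (hd : d ∈ chamber form R) (hd0 : d ≠ 0) (hiso : form d d = 0) :
    ∃ i, ν i = ⊤ ∧ ∃ c : ℝ, 0 < c ∧ d = c • dual R ν i := by
  have hsum := h.sum_form_dual hν d
  have hex : ∃ i, form d (R i) ≠ 0 := by
    by_contra! hall
    apply hd0
    rw [hsum]; simp [hall]
  obtain ⟨i, hi⟩ := hex
  have hi' : 0 < form d (R i) := lt_of_le_of_ne (hd i) (Ne.symm hi)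
  have hexp : form d d = ∑ j, ∑ k, form d (R j) * form d (R k) * form (dual R ν j) (dual R ν k)
      := by
    conv_lhs => rw [hsum]
    simp only [map_sum, LinearMap.sum_apply, map_smul, LinearMap.smul_apply, smul_eq_mul]
    rw [Finset.sum_comm]
    refine Finset.sum_congr rfl fun j _ => ?_
    rw [Finset.mul_sum]
    exact Finset.sum_congr rfl fun k _ => by ring
  have hterm : ∀ j k, form d (R j) * form d (R k) * form (dual R ν j) (dual R ν k) ≤ 0 :=
    fun j k => mul_nonpos_of_nonneg_of_nonpos (mul_nonneg (hd j) (hd k))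
      (h.form_dual_nonpos hν j k)
  -- Nonnegative coordinates and nonpositive pairings of the dual basis: a vanishing norm kills
  -- every term. Distinct vertices pair strictly negatively, so only one coordinate survives, and
  -- that vertex is itself isotropic.
  have hzero : ∀ j k, form d (R j) * form d (R k) * form (dual R ν j) (dual R ν k) = 0 := by
    rw [hiso] at hexp
    intro j k
    have h1 := (Finset.sum_eq_zero_iff_of_nonpos fun j _ =>
      Finset.sum_nonpos fun k _ => hterm j k).mp hexp.symm j (Finset.mem_univ _)
    exact (Finset.sum_eq_zero_iff_of_nonpos fun k _ => hterm j k).mp h1 k (Finset.mem_univ _)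
  have hz' : ∀ j, j ≠ i → form d (R j) = 0 := by
    intro j hj
    have := hzero i j
    rw [mul_eq_zero, mul_eq_zero] at this
    rcases this with (h1 | h1) | h1
    · exact absurd h1 hi
    · exact h1
    · exact absurd h1 (h.form_dual_neg hν (Ne.symm hj)).ne
  refine ⟨i, ?_, form d (R i), hi', ?_⟩
  · by_contra ht
    have h1 := hzero i i
    rw [(h.form_dual_dual hν.lSq_pos i).1, mul_eq_zero, mul_eq_zero, or_self,
      or_iff_right hi] at h1
    have := sinPi_pos (hν.1 i) ht
    have h3 := hν.lSq_pos
    have : 0 < sinPi (ν i) ^ 2 / lSq ν := by positivity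
    linarith
  conv_lhs => rw [hsum]
  rw [Finset.sum_eq_single i]
  · intro j _ hj; rw [hz' j hj, zero_smul]
  · simp

/-- Vertices of different types have at least the distance of the vertices of a triangle. -/
theorem form_wordAct_dual_le (h : IsMirrorTriple R ν) (hν : IsHyperbolicSignature ν)
    (L : List (Fin 3)) (i j : Fin 3) :
    form (wordAct R L (dual R ν i)) (dual R ν j) ≤ form (dual R ν i) (dual R ν j) := by
  rw [← h.rep_wordProd]
  exact (h.isReflectionSystem hν.1).bilin_word_le (h.dual_mem_chamber hν i)
    (h.dual_mem_chamber hν j) L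

/-- Distinct vertices of the same type have at least twice the distance of a vertex from the
opposite side of a triangle. -/
theorem form_wordAct_dual_self_le (h : IsMirrorTriple R ν) (hν : IsHyperbolicSignature ν)
    (L : List (Fin 3)) (i : Fin 3) (hne : wordAct R L (dual R ν i) ≠ dual R ν i) :
    form (wordAct R L (dual R ν i)) (dual R ν i) ≤ form (dual R ν i) (dual R ν i) - 2 := by
  rw [← h.rep_wordProd] at hne ⊢
  refine ((h.isReflectionSystem hν.1).bilin_word_le_of_ne (h.dual_mem_chamber hν i)
    (h.dual_mem_chamber hν i) (j := i) (fun j hj => ?_) L hne).trans (le_of_eq ?_)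
  · rw [h.form_dual_eq hν.lSq_pos, if_neg (Ne.symm hj)]
  · have : form (R i) (dual R ν i) = 1 := by
      rw [form_comm, h.form_dual_eq hν.lSq_pos, if_pos rfl]
    rw [(h.isReflectionSystem hν.1).act, h.form_dual_eq hν.lSq_pos, if_pos rfl]
    simp [this]

/-! ### Elements with a fixed point in the closed hyperbolic plane -/

/-- A matrix commutes with its traceless part, and an even word has determinant one; so this is the
vector of the fixed point or of the axis. -/
theorem wordAct_tracelessPart (h : IsMirrorTriple R ν) {L : List (Fin 3)} (hL : Even L.length) :
    wordAct R L (tracelessPart (wordMat R L)) = tracelessPart (wordMat R L) := by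
  apply toMat_injective
  rw [h.toMat_wordAct]
  have hd := h.det_wordMat L
  rw [hL.neg_one_pow] at hd
  set M := wordMat R L
  have h1 : toMat (tracelessPart M) = M - (M.trace / 2) • 1 :=
    eq_sub_of_add_eq' (eq_add_toMat M).symm
  rw [h1, mul_sub, sub_mul, mul_assoc, Matrix.mul_adjugate, hd]
  simp [Matrix.mul_adjugate, hd]

/-- The displacement of x by an element depends only on the trace and on the pairing of x with the
fixed vector. This converts finiteness of elements into finiteness of values of that pairing. -/
theorem form_wordAct_self (h : IsMirrorTriple R ν) {L : List (Fin 3)} (hL : Even L.length)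
    (x : V3) : form (wordAct R L x) x =
      ((wordMat R L).trace ^ 2 / 2 - 1) * form x x - 2 * form (tracelessPart (wordMat R L)) x ^ 2
    := by
  have hd := h.det_wordMat L
  rw [hL.neg_one_pow, Matrix.det_fin_two] at hd
  have h1 := h.toMat_wordAct L x
  have h2 := trace_toMat_mul (wordAct R L x) x
  rw [h1] at h2
  set M := wordMat R L
  rw [Matrix.adjugate_fin_two, Matrix.trace_fin_two] at h2
  simp only [toMat, Matrix.mul_apply, Fin.sum_univ_two, Matrix.of_apply, Matrix.cons_val_zero,
    Matrix.cons_val_one, Matrix.cons_val', Matrix.cons_val_fin_one] at h2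
  have h3 : form (wordAct R L x) x = (2 * form (wordAct R L x) x) / 2 := by ring
  rw [h3, ← h2, Matrix.trace_fin_two]
  simp only [form_apply, tracelessPart, Matrix.cons_val_zero, Matrix.cons_val_one,
    Matrix.cons_val]
  linear_combination (-(x 0 ^ 2 - x 1 * x 2)) * hd

/-- An element with a fixed point in the closed hyperbolic plane is conjugate to a power of a
rotation about a vertex. -/
theorem exists_conj_rotation (h : IsMirrorTriple R ν) (hν : IsHyperbolicSignature ν)
    {L₀ : List (Fin 3)} (hL₀ : Even L₀.length) (hne : wordProd (mirrorPSL R) L₀ ≠ 1)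
    (htr : (wordMat R L₀).trace ^ 2 ≤ 4) :
    ∃ (L : List (Fin 3)) (i : Fin 3) (c : ℝ), c ≠ 0 ∧
      wordAct R L (tracelessPart (wordMat R L₀)) = c • dual R ν i ∧
      wordProd (mirrorPSL R) L * wordProd (mirrorPSL R) L₀ * (wordProd (mirrorPSL R) L)⁻¹ ∈
        Subgroup.zpowers (rotation R i) := by
  set u := tracelessPart (wordMat R L₀) with hu
  set r := weylVector R ν with hr
  have hd := h.det_wordMat L₀
  rw [hL₀.neg_one_pow] at hd
  -- The displacement of `r` by a conjugate is a fixed number minus 2 form(wu, r)². Since only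
  -- finitely many elements displace `r` by a bounded amount, the squares below any bound are finite
  -- in number, as `exists_mem_chamber` requires.
  have hfix : ∀ L, form (wordAct R (L ++ L₀ ++ L.reverse) r) r =
      ((wordMat R L₀).trace ^ 2 / 2 - 1) * form r r - 2 * form (wordAct R L u) r ^ 2 := by
    intro L
    rw [wordAct_append, wordAct_append, h.form_wordAct_left hν L, h.form_wordAct_self hL₀,
      h.form_wordAct_left hν L, h.form_wordAct hν]
  have hcausal : form u u ≤ 0 := by
    rw [hu, form_tracelessPart, hd]; linarith
  obtain ⟨L, e, he, hmem⟩ := h.exists_mem_chamber hν hcausal (by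
    intro M
    refine ((h.finite_weylVector hν
      (-(((wordMat R L₀).trace ^ 2 / 2 - 1) * form r r - 2 * M))).image
      fun x => (((wordMat R L₀).trace ^ 2 / 2 - 1) * form r r - x.2) / 2).subset ?_
    rintro _ ⟨L, rfl, hM⟩
    refine ⟨_, ⟨L ++ L₀ ++ L.reverse, rfl, ?_⟩, ?_⟩
    · simp only [← hr]
      rw [hfix]; linarith
    · simp only [← hr]
      rw [hfix]; ring)
  have he0 : e ≠ 0 := by rcases he with rfl | rfl <;> simp
  have hee : e * e = 1 := by rcases he with rfl | rfl <;> simp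
  have hback : ∀ v, wordAct R L.reverse (wordAct R L v) = v := by
    intro v
    rw [← h.rep_wordProd, ← h.rep_wordProd, wordProd_reverse h.gen_sq,
      ← Module.End.mul_apply, ← map_mul]
    simp
  have hu0 : u ≠ 0 := by
    intro hu0
    apply hne
    rw [← h.realPSL_wordMat]
    exact realPSL_eq_one_of_tracelessPart (by rw [hd]; simp) hu0
  have hd0 : e • wordAct R L u ≠ 0 := by
    intro h0
    rw [smul_eq_zero, or_iff_right he0] at h0
    apply hu0
    have := hback u
    rw [h0] at this
    rw [← this]
    have h1 := h.wordAct_smul L.reverse 0 0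
    simpa using h1
  have hconj : wordProd (mirrorPSL R) (L ++ L₀ ++ L.reverse) = wordProd (mirrorPSL R) L *
      wordProd (mirrorPSL R) L₀ * (wordProd (mirrorPSL R) L)⁻¹ := by
    rw [wordProd_append, wordProd_append, wordProd_reverse h.mirrorPSL_sq]
  obtain ⟨i, c, hc, hci, hz⟩ := h.stabilizer hν hmem hd0 (L := L ++ L₀ ++ L.reverse)
    (by
      have : Even (L.length + (L₀.length + L.length)) := by
        obtain ⟨n, hn⟩ := hL₀
        exact ⟨L.length + n, by omega⟩
      simpa using this)
    (by
      rw [wordAct_append, wordAct_append, h.wordAct_smul, hback, h.wordAct_smul, hu,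
        h.wordAct_tracelessPart hL₀, h.wordAct_smul])
    (by
      rw [hconj]
      intro h1
      apply hne
      rw [mul_inv_eq_one] at h1
      exact mul_eq_left.mp h1)
  refine ⟨L, i, e * c, mul_ne_zero he0 hc.ne', ?_, by rw [← hconj]; exact hz⟩
  rw [mul_smul, ← hci, smul_smul, hee, one_smul]

end IsMirrorTriple

/-! ### The limit set of a mirror group -/

theorem coe_mem_realLine (z : ℂ) : (z : OnePoint ℂ) ∈ SphereCircle.realLine.points ↔ z.im = 0 := by
  constructor
  · rintro (⟨h, -⟩ | ⟨w, h, h2⟩)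
    · simp at h
    · obtain rfl := OnePoint.coe_injective h
      simpa [SphereCircle.realLine] using h2
  · intro h
    exact .inr ⟨z, rfl, by simp [SphereCircle.realLine, h]⟩

theorem infty_mem_realLine : (∞ : OnePoint ℂ) ∈ SphereCircle.realLine.points := .inl ⟨rfl, rfl⟩

theorem abs_mul_apply_le {A B : RMat} {a b : ℝ} (hA : ∀ i j, |A i j| ≤ a)
    (hB : ∀ i j, |B i j| ≤ b) (i j : Fin 2) : |(A * B) i j| ≤ 2 * a * b := by
  have ha : 0 ≤ a := (abs_nonneg _).trans (hA 0 0)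
  have key : ∀ k, |A i k * B k j| ≤ a * b := fun k => by
    rw [abs_mul]; exact mul_le_mul (hA _ _) (hB _ _) (abs_nonneg _) ha
  rw [Matrix.mul_apply, Fin.sum_univ_two]
  linarith [abs_add_le (A i 0 * B 0 j) (A i 1 * B 1 j), key 0, key 1]

theorem realPSL_mobius_coe {M : RMat} (hM : M.det ≠ 0) (z w : ℂ) :
    mobius (realPSL M) z = w ↔ (M 1 0 * z + M 1 1 : ℂ) ≠ 0 ∧
      (M 0 0 * z + M 0 1 : ℂ) = w * (M 1 0 * z + M 1 1) := by
  rw [realPSL, mobius_coe_eq_coe (det_map_ne_zero hM)]; rfl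

theorem realPSL_pow {X : RMat} (hX : X.det ≠ 0) (n : ℕ) : realPSL X ^ n = realPSL (X ^ n) := by
  induction n with
  | zero => simp [realPSL_one]
  | succ n ih =>
    rw [pow_succ, pow_succ, ih, realPSL_mul (by rw [Matrix.det_pow]; positivity) hX]

namespace IsMirrorTriple
variable {R : Fin 3 → V3} {ν : Fin 3 → ℕ∞}

/-- Bounded entries bound the displacement of the Weyl vector, through the trace formula for the
form. -/
theorem finite_bounded (h : IsMirrorTriple R ν) (hν : IsHyperbolicSignature ν) (K : ℝ) :
    {g : PSL(2, ℂ) | ∃ L, g = wordProd (mirrorPSL R) L ∧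
      ∀ i j, |wordMat R L i j| ≤ K}.Finite := by
  set r := weylVector R ν with hr
  set C := |r 0| + |r 1| + |r 2|
  refine ((h.finite_weylVector hν (2 * (2 * (2 * K * C) * K) * C)).image Prod.fst).subset ?_
  rintro _ ⟨L, rfl, hK⟩
  refine ⟨_, ⟨L, rfl, ?_⟩, rfl⟩
  have h1 : ∀ i j, |toMat r i j| ≤ C := by
    have h0 := abs_nonneg (r 0)
    have h1 := abs_nonneg (r 1)
    have h2 := abs_nonneg (r 2)
    intro i j
    fin_cases i <;> fin_cases j <;> simp [toMat, C] <;> linarith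
  have h2 : ∀ i j, |(wordMat R L).adjugate i j| ≤ K := by
    rw [Matrix.adjugate_fin_two]
    intro i j
    fin_cases i <;> fin_cases j <;> simp <;> exact hK _ _
  have h3 := abs_mul_apply_le (abs_mul_apply_le (abs_mul_apply_le hK h1) h2) h1
  have h4 := trace_toMat_mul (wordAct R L r) r
  rw [h.toMat_wordAct, Matrix.trace_fin_two] at h4
  have h5 := (abs_le.mp (h3 0 0)).1
  have h6 := (abs_le.mp (h3 1 1)).1
  simp only [← hr]
  linarith

/-- If a group element maps a point near z to a point near z, comparing imaginary parts bounds cw +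
d, hence also aw + b; since Im w stays away from 0, all four entries are bounded. -/
theorem mem_discontinuitySet (h : IsMirrorTriple R ν) (hν : IsHyperbolicSignature ν) {z : ℂ}
    (hz : z.im ≠ 0) : (z : OnePoint ℂ) ∈ discontinuitySet (evenGroup R) := by
  set y := |z.im| with hy
  have hy0 : 0 < y := abs_pos.mpr hz
  set C := ‖z‖ + y with hC
  have hC0 : 0 ≤ C := by positivity
  -- The sum of the bounds obtained below for c, d, a and b.
  set K := 4 / y + (2 + 4 / y * C) + 4 * C / y + (2 * C + 4 * C / y * C) with hK
  refine ⟨(↑) '' Metric.ball z (y / 2), OnePoint.isOpenEmbedding_coe.isOpenMap _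
    Metric.isOpen_ball, ⟨z, Metric.mem_ball_self (by positivity), rfl⟩, ?_⟩
  refine (h.finite_bounded hν K).subset ?_
  rintro g ⟨hg, _, ⟨_, ⟨w, hw, rfl⟩, rfl⟩, ⟨w', hw', hww⟩⟩
  obtain ⟨L, hL, rfl⟩ := (h.mem_evenGroup_iff g).mp hg
  refine ⟨L, rfl, ?_⟩
  rw [← h.realPSL_wordMat] at hww
  obtain ⟨h1, h2⟩ := (realPSL_mobius_coe (h.det_wordMat_ne_zero L) _ _).mp hww.symm
  have hd := h.det_wordMat L
  rw [hL.neg_one_pow, Matrix.det_fin_two] at hd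
  generalize wordMat R L = N at h1 h2 hd ⊢
  have bnd : ∀ w ∈ Metric.ball z (y / 2), y / 2 ≤ |w.im| ∧ |w.im| ≤ 3 / 2 * y ∧ ‖w‖ ≤ C := by
    intro w hw
    rw [Metric.mem_ball, dist_eq_norm] at hw
    have e1 := (Complex.abs_im_le_norm (w - z))
    rw [Complex.sub_im] at e1
    have e2 := abs_sub_abs_le_abs_sub w.im z.im
    have e3 := abs_sub_abs_le_abs_sub z.im w.im
    rw [abs_sub_comm z.im] at e3
    have e4 := norm_sub_norm_le w z
    refine ⟨by linarith, by linarith, by linarith⟩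
  obtain ⟨a1, a2, a3⟩ := bnd w hw
  obtain ⟨b1, b2, b3⟩ := bnd w' hw'
  set D : ℂ := N 1 0 * w + N 1 1 with hD
  have him : w'.im * ‖D‖ ^ 2 = w.im := by
    have e1 : w' * (‖D‖ ^ 2 : ℝ) = (N 0 0 * w + N 0 1) * conj D := by
      rw [h2, mul_assoc, Complex.mul_conj, Complex.normSq_eq_norm_sq]
    have e2 := congrArg Complex.im e1
    rw [Complex.im_mul_ofReal, hD] at e2
    rw [e2]
    simp
    linear_combination w.im * hd
  have hD2 : ‖D‖ ≤ 2 := by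
    have e1 : |w'.im| * ‖D‖ ^ 2 = |w.im| := by
      rw [← him, abs_mul, abs_of_nonneg (sq_nonneg ‖D‖)]
    have e2 : ‖D‖ ^ 2 ≤ 3 := by
      by_contra! hlt
      have : y / 2 * 3 < |w'.im| * ‖D‖ ^ 2 := by
        have := mul_le_mul_of_nonneg_right b1 (sq_nonneg ‖D‖)
        nlinarith
      linarith
    nlinarith [norm_nonneg D]
  have main : ∀ a b : ℝ, ∀ w : ℂ, y / 2 ≤ |w.im| → ‖w‖ ≤ C → ∀ B, ‖(a * w + b : ℂ)‖ ≤ B →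
      |a| ≤ 2 * B / y ∧ |b| ≤ B + 2 * B / y * C := by
    intro a b w e1 e2 B e3
    have e4 : |a| ≤ 2 * B / y := by
      have := (Complex.abs_im_le_norm (a * w + b)).trans e3
      simp [abs_mul] at this
      rw [le_div_iff₀ hy0]
      nlinarith [abs_nonneg a]
    refine ⟨e4, ?_⟩
    have e5 : (b : ℂ) = (a * w + b) - a * w := by ring
    have e6 : |b| = ‖(b : ℂ)‖ := by simp
    rw [e6, e5]
    refine (norm_sub_le _ _).trans (add_le_add e3 ?_)
    rw [norm_mul, Complex.norm_real, Real.norm_eq_abs]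
    exact mul_le_mul e4 e2 (norm_nonneg _) ((abs_nonneg _).trans e4)
  obtain ⟨c1, c2⟩ := main _ _ w a1 a3 2 hD2
  obtain ⟨c3, c4⟩ := main (N 0 0) (N 0 1) w a1 a3 (C * 2) (by
    rw [h2, norm_mul]; exact mul_le_mul b3 hD2 (norm_nonneg _) hC0)
  have p1 : 0 ≤ 4 / y := by positivity
  have p2 : 0 ≤ 4 * C / y := by positivity
  have p3 : 0 ≤ 4 / y * C := by positivity
  have p4 : 0 ≤ 4 * C / y * C := by positivity
  have q1 : 2 * 2 / y = 4 / y := by norm_num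
  have q2 : 2 * (C * 2) / y = 4 * C / y := by ring
  rw [q1] at c1 c2
  rw [q2] at c3 c4
  intro i j
  fin_cases i <;> fin_cases j <;> simp only [Fin.zero_eta, Fin.mk_one, Fin.isValue] <;> linarith

/-- The matrix of this isotropic vector is the product of the column (x, 1) and the row (1, −x), so
the word acts through its image of (x, 1). -/
theorem wordAct_isotropic (h : IsMirrorTriple R ν) (L : List (Fin 3)) (x : ℝ) :
    wordAct R L ![x, x ^ 2, 1] =
      ![(wordMat R L 0 0 * x + wordMat R L 0 1) * (wordMat R L 1 0 * x + wordMat R L 1 1),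
        (wordMat R L 0 0 * x + wordMat R L 0 1) ^ 2,
        (wordMat R L 1 0 * x + wordMat R L 1 1) ^ 2] := by
  apply toMat_injective
  rw [h.toMat_wordAct, Matrix.adjugate_fin_two]
  ext i j
  fin_cases i <;> fin_cases j <;> simp [toMat, Matrix.mul_apply] <;> ring

/-- At an ideal vertex the negative of the rotation matrix has trace 2, and its power n + 1 is (n +
1)(−X) − n. This is scalar only for scalar X, and then the two mirrors would be proportional,
against the dual basis. -/
theorem rotation_pow_ne_one (h : IsMirrorTriple R ν) (hν : IsHyperbolicSignature ν) {i : Fin 3}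
    (hi : ν i = ⊤) {n : ℕ} (hn : n ≠ 0) : rotation R i ^ n ≠ 1 := by
  obtain ⟨X, hX⟩ : ∃ X, X = toMat (R (i + 1)) * toMat (R (i + 2)) := ⟨_, rfl⟩
  have hdX : X.det = 1 := by
    rw [hX, Matrix.det_mul, h.det_toMat_mirror, h.det_toMat_mirror]; norm_num
  have hr : rotation R i = realPSL X := by
    rw [hX, realPSL_mul (by simp [h.det_toMat_mirror]) (by simp [h.det_toMat_mirror])]; rfl
  obtain ⟨n, rfl⟩ := Nat.exists_eq_succ_of_ne_zero hn
  have hY := pow_succ_eq_sinRatio (Y := -X) (q := 1) (by rw [Matrix.det_neg, hdX]; simp)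
    (by rw [Matrix.trace_neg, hX, trace_toMat_mul, h.gram, hi]; simp) n
  rw [sinRatio_one, sinRatio_one] at hY
  intro h1
  rw [hr, realPSL_pow (by simp [hdX]), ← realPSL_one] at h1
  obtain ⟨c, hc, h2⟩ := eq_smul_of_realPSL_eq (by rw [Matrix.det_pow, hdX]; simp) (by simp) h1
  have hX0 : tracelessPart X = 0 := by
    have e1 : tracelessPart (X ^ (n + 1)) = 0 := by
      have := congrArg tracelessPart h2
      rw [tracelessPart_smul] at this
      have e2 : tracelessPart (1 : RMat) = 0 := by
        ext i; fin_cases i <;> simp [tracelessPart]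
      rw [e2] at this
      exact (smul_eq_zero.mp this.symm).resolve_left hc
    have e3 : tracelessPart ((-X) ^ (n + 1)) = 0 := by
      rcases Nat.even_or_odd (n + 1) with hp | hp
      · rw [hp.neg_pow, e1]
      · rw [hp.neg_pow, ← neg_one_smul ℝ, tracelessPart_smul, e1, smul_zero]
    rw [hY] at e3
    have e4 : tracelessPart (((n + 1 : ℕ) : ℝ) • (-X) - (n : ℝ) • (1 : RMat)) =
        (-((n + 1 : ℕ) : ℝ)) • tracelessPart X := by
      ext i; fin_cases i <;> simp [tracelessPart] <;> ring
    rw [e4, smul_eq_zero] at e3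
    exact e3.resolve_left (neg_ne_zero.mpr (by positivity))
  have hX1 := eq_add_toMat X
  have h0 : toMat 0 = 0 := by ext i j; fin_cases i <;> fin_cases j <;> simp [toMat]
  rw [hX0, h0, add_zero] at hX1
  have h3 : toMat (R (i + 1)) * X = toMat (R (i + 2)) := by
    have hs : toMat (R (i + 1)) * toMat (R (i + 1)) = 1 := by
      have hn := h.norm (i + 1)
      rw [form_apply] at hn
      ext a b; fin_cases a <;> fin_cases b <;> simp [toMat, Matrix.mul_apply] <;> linarith
    rw [hX, ← mul_assoc, hs, one_mul]
  have h4 : R (i + 2) = (X.trace / 2) • R (i + 1) := by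
    apply toMat_injective
    rw [← h3, hX1]
    ext a b; fin_cases a <;> fin_cases b <;> simp [toMat]
  have h5 := h.form_dual_eq hν.lSq_pos (i + 2) (i + 2)
  have h6 := h.form_dual_eq hν.lSq_pos (i + 2) (i + 1)
  rw [h4, map_smul, h6, if_neg (by grind)] at h5
  simp at h5

/-- The linear action depends on the Moebius transformation alone: representing matrices differ by a
sign, which conjugation does not see. -/
theorem form_word_eq_of_eq (h : IsMirrorTriple R ν) {L L' : List (Fin 3)}
    (hL : wordProd (mirrorPSL R) L = wordProd (mirrorPSL R) L') (v : V3) :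
    wordAct R L v = wordAct R L' v := by
  rw [← h.realPSL_wordMat, ← h.realPSL_wordMat] at hL
  obtain ⟨c, hc, h1⟩ := eq_smul_of_realPSL_eq (h.det_wordMat_ne_zero L)
    (h.det_wordMat_ne_zero L') hL
  have h2 := h.det_wordMat L'
  rw [h1, Matrix.det_smul, h.det_wordMat, Fintype.card_fin] at h2
  have hcc : c * c = 1 := by
    have h3 : |c ^ 2 * (-1) ^ L.length| = |(-1) ^ L'.length| := congrArg _ h2
    rw [abs_mul, abs_pow (-1 : ℝ), abs_pow (-1 : ℝ), abs_neg, abs_one, one_pow, one_pow, mul_one,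
      abs_of_nonneg (sq_nonneg c)] at h3
    rw [← pow_two]; exact h3
  apply toMat_injective
  rw [h.toMat_wordAct, h.toMat_wordAct, h1, Matrix.adjugate_smul]
  simp [smul_smul, hcc]

/-- The Weyl vector is timelike, so the part of the light cone of bounded pairing with it is
bounded. The constant comes from the identity `h2`, where D(p² + q²) plus two squares equals the
pairing times −2(r₁ + r₂). -/
theorem exists_bound_isotropic (h : IsMirrorTriple R ν) (hν : IsHyperbolicSignature ν)
    (M : ℝ) : ∃ B, 0 ≤ B ∧ ∀ p q : ℝ,
      form ![p * q, p ^ 2, q ^ 2] (weylVector R ν) ^ 2 ≤ M → p ^ 2 + q ^ 2 ≤ B := by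
  have hr := h.form_weylVector_neg hν
  set r := weylVector R ν
  rw [form_apply] at hr
  set D := r 1 * r 2 - r 0 ^ 2 with hD
  have hD0 : 0 < D := by rw [hD]; linarith
  refine ⟨|r 1 + r 2| * (2 * √|M|) / D, by positivity, fun p q hpq => ?_⟩
  set Q := form ![p * q, p ^ 2, q ^ 2] r with hQ
  have h1 : |Q| ≤ √|M| := by
    rw [← Real.sqrt_sq_eq_abs]
    exact Real.sqrt_le_sqrt (hpq.trans (le_abs_self M))
  have h2 : (r 1 + r 2) * (-2 * Q) = D * (p ^ 2 + q ^ 2) + (p * r 2 - q * r 0) ^ 2 +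
      (q * r 1 - p * r 0) ^ 2 := by
    rw [hQ, form_apply]; simp [hD]; ring
  have h3 : D * (p ^ 2 + q ^ 2) ≤ (r 1 + r 2) * (-2 * Q) := by
    rw [h2]; nlinarith [sq_nonneg (p * r 2 - q * r 0), sq_nonneg (q * r 1 - p * r 0)]
  rw [le_div_iff₀ hD0, mul_comm]
  refine h3.trans ((le_abs_self _).trans ?_)
  rw [abs_mul, abs_mul]
  gcongr
  simp

/-- Near a real point of discontinuity, the stretching factors of the group are discrete. -/
theorem finite_of_mem_discontinuitySet (h : IsMirrorTriple R ν) (hν : IsHyperbolicSignature ν)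
    {x : ℝ} (hx : ((x : ℂ) : OnePoint ℂ) ∈ discontinuitySet (evenGroup R)) (M : ℝ) :
    {g : PSL(2, ℂ) | ∃ L, g = wordProd (mirrorPSL R) L ∧
      form (wordAct R L ![x, x ^ 2, 1]) (weylVector R ν) ^ 2 ≤ M}.Finite := by
  obtain ⟨U, hUo, hxU, hfin⟩ := hx
  obtain ⟨ε, hε, hball⟩ := Metric.isOpen_iff.mp (hUo.preimage OnePoint.continuous_coe) _ hxU
  obtain ⟨B, hB0, hB⟩ := h.exists_bound_isotropic hν M
  set K := B / ε ^ 2 with hK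
  have hK0 : 0 ≤ K := by positivity
  set K' := (K + 1) + (B + 1 + (K + 1) * |x|) with hK'
  -- With (p, q) the image of (x, 1), the squared distance of x from the preimage of `I` is (p² +
  -- q²)/(a² + c²), and p² + q² ≤ B. If a² + c² > B/ε² the preimage lies in `U`; otherwise a, c, p,
  -- q and so all entries are bounded.
  have key : ∀ L, form (wordAct R L ![x, x ^ 2, 1]) (weylVector R ν) ^ 2 ≤ M →
      (∀ i j, |wordMat R L i j| ≤ K') ∨
      ∃ z : ℂ, (z : OnePoint ℂ) ∈ U ∧
        mobius (wordProd (mirrorPSL R) L)⁻¹ (Complex.I : ℂ) = z := by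
    intro L hL
    rw [h.wordAct_isotropic] at hL
    have h1 := hB _ _ hL
    have hd := h.det_wordMat_ne_zero L
    rw [← h.realPSL_wordMat, realPSL_inv hd]
    have hda : (wordMat R L).adjugate.det ≠ 0 := by
      rw [Matrix.det_adjugate]; simpa using hd
    have hmob := realPSL_mobius_coe hda Complex.I
    rw [Matrix.adjugate_fin_two] at hmob ⊢
    rw [Matrix.det_fin_two] at hd
    generalize wordMat R L = N at h1 hd hmob ⊢
    obtain ⟨a, ha⟩ : ∃ a, a = N 0 0 := ⟨_, rfl⟩
    obtain ⟨b, hb⟩ : ∃ a, a = N 0 1 := ⟨_, rfl⟩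
    obtain ⟨c, hc⟩ : ∃ a, a = N 1 0 := ⟨_, rfl⟩
    obtain ⟨d, hd'⟩ : ∃ a, a = N 1 1 := ⟨_, rfl⟩
    simp only [Matrix.of_apply, Matrix.cons_val', Matrix.cons_val_zero, Matrix.cons_val_one,
      Matrix.cons_val_fin_one] at hmob
    rw [← ha, ← hb, ← hc, ← hd'] at h1 hd hmob ⊢
    set p := a * x + b with hp
    set q := c * x + d with hq
    rcases le_or_gt (a ^ 2 + c ^ 2) K with hle | hgt
    · left
      have habs : ∀ t : ℝ, ∀ K : ℝ, 0 ≤ K → t ^ 2 ≤ K → |t| ≤ K + 1 := by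
        intro t K hK ht
        rw [abs_le]; constructor <;> nlinarith [sq_nonneg (t + 1), sq_nonneg (t - 1)]
      have ha1 := habs a K hK0 (by nlinarith [sq_nonneg c])
      have hc1 := habs c K hK0 (by nlinarith [sq_nonneg a])
      have hp1 := habs p B hB0 (by nlinarith [sq_nonneg q])
      have hq1 := habs q B hB0 (by nlinarith [sq_nonneg p])
      have hsub : ∀ s t u : ℝ, |s| ≤ K + 1 → |u| ≤ B + 1 → u = s * x + t →
          |t| ≤ B + 1 + (K + 1) * |x| := by
        intro s t u hs hu hst
        have : t = u - s * x := by linarith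
        rw [this]
        refine (abs_sub _ _).trans (add_le_add hu ?_)
        rw [abs_mul]; gcongr
      have hb1 := hsub a b p ha1 hp1 hp
      have hd1 := hsub c d q hc1 hq1 hq
      have e1 : 0 ≤ (K + 1) * |x| := by positivity
      intro i j
      fin_cases i <;> fin_cases j <;>
        simp only [Fin.zero_eta, Fin.mk_one, Fin.isValue, ← ha, ← hb, ← hc, ← hd'] <;> linarith
    · right
      have hac : 0 < a ^ 2 + c ^ 2 := hK0.trans_lt hgt
      have hden : ((-c : ℝ) * Complex.I + (a : ℝ) : ℂ) ≠ 0 := by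
        intro h0
        have e1 := congrArg Complex.re h0
        have e2 := congrArg Complex.im h0
        simp at e1 e2
        rw [e1, e2] at hac; simp at hac
      refine ⟨((d : ℝ) * Complex.I + (-b : ℝ)) / ((-c : ℝ) * Complex.I + (a : ℝ)), ?_, ?_⟩
      · apply hball
        rw [Metric.mem_ball, dist_eq_norm]
        have e1 : ((d : ℝ) * Complex.I + (-b : ℝ)) / ((-c : ℝ) * Complex.I + (a : ℝ)) - (x : ℂ) =
            (-(p : ℂ) + q * Complex.I) / ((-c : ℝ) * Complex.I + (a : ℝ)) := by
          rw [eq_div_iff hden, sub_mul, div_mul_cancel₀ _ hden, hp, hq]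
          push_cast; ring
        rw [e1, norm_div]
        have n1 : ‖(-(p : ℂ) + q * Complex.I)‖ ^ 2 = p ^ 2 + q ^ 2 := by
          rw [← Complex.normSq_eq_norm_sq, Complex.normSq_apply]; simp; ring
        have n2 : ‖((-c : ℝ) * Complex.I + (a : ℝ) : ℂ)‖ ^ 2 = a ^ 2 + c ^ 2 := by
          rw [← Complex.normSq_eq_norm_sq, Complex.normSq_apply]; simp; ring
        refine lt_of_pow_lt_pow_left₀ 2 hε.le ?_
        rw [div_pow, n1, n2, div_lt_iff₀ hac]
        rw [hK, div_lt_iff₀ (by positivity)] at hgt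
        linarith
      · rw [hmob]
        refine ⟨hden, ?_⟩
        rw [div_mul_cancel₀ _ hden]
  -- The elements whose preimage of `I` lies in `U` are split by parity. Two of the same parity
  -- differ by an even element that carries one point of `U` to another, and there are finitely many
  -- of these.
  refine Set.Finite.subset ((h.finite_bounded hν K').union (Set.Finite.union
    (s := {g | ∃ L, Even L.length ∧ g = wordProd (mirrorPSL R) L ∧
      ∃ z : ℂ, (z : OnePoint ℂ) ∈ U ∧ mobius g⁻¹ (Complex.I : ℂ) = z})
    (t := {g | ∃ L, ¬ Even L.length ∧ g = wordProd (mirrorPSL R) L ∧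
      ∃ z : ℂ, (z : OnePoint ℂ) ∈ U ∧ mobius g⁻¹ (Complex.I : ℂ) = z}) ?_ ?_)) ?_
  rotate_right
  · rintro g ⟨L, rfl, hL⟩
    rcases key L hL with h1 | h1
    · exact .inl ⟨L, rfl, h1⟩
    · by_cases hev : Even L.length
      · exact .inr (.inl ⟨L, hev, rfl, h1⟩)
      · exact .inr (.inr ⟨L, hev, rfl, h1⟩)
  all_goals
    rw [← Set.not_infinite]
    intro hinf
    obtain ⟨g₁, L₁, hev₁, rfl, z₁, hz₁, hg₁⟩ := hinf.nonempty
    refine hinf ((hfin.image fun g => wordProd (mirrorPSL R) L₁ * g⁻¹).subset ?_)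
    rintro _ ⟨L, hev, rfl, z, hz, hg⟩
    refine ⟨(wordProd (mirrorPSL R) L)⁻¹ * wordProd (mirrorPSL R) L₁, ⟨?_, z, ⟨z₁, hz₁, ?_⟩, hz⟩,
      by group⟩
    · rw [h.mem_evenGroup_iff]
      refine ⟨L.reverse ++ L₁, ?_, ?_⟩
      · rw [List.length_append, List.length_reverse, Nat.even_add]
        simp only [hev, hev₁]
      · rw [wordProd_append, wordProd_reverse h.mirrorPSL_sq]
    · rw [← hg₁, ← Equiv.Perm.mul_apply, ← map_mul, mul_assoc, mul_inv_cancel, mul_one, hg]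

/-- Otherwise the orbit of the isotropic vector of x has discrete pairings with the Weyl vector and
reaches the chamber, where only ideal vertices are isotropic. So x is fixed by a conjugate of a
parabolic rotation, whose infinitely many powers all return x to any neighbourhood. -/
theorem coe_real_notMem_discontinuitySet (h : IsMirrorTriple R ν) (hν : IsHyperbolicSignature ν)
    (x : ℝ) : ((x : ℂ) : OnePoint ℂ) ∉ discontinuitySet (evenGroup R) := by
  intro hx
  set u : V3 := ![x, x ^ 2, 1] with hu
  have huu : form u u = 0 := by simp [hu, form_apply]; ring
  have hu0 : u ≠ 0 := by
    intro h0
    have := congrFun h0 2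
    simp [hu] at this
  obtain ⟨L, e, he, hmem⟩ := h.exists_mem_chamber hν huu.le (by
    intro M
    -- `Function.invFun` chooses one word for each element; the value does not depend on the choice
    -- by `form_word_eq_of_eq`.
    refine ((h.finite_of_mem_discontinuitySet hν hx M).image fun g =>
      Function.invFun (fun L => wordProd (mirrorPSL R) L) g |> fun L =>
        form (wordAct R L u) (weylVector R ν) ^ 2).subset ?_
    rintro _ ⟨L, rfl, hL⟩
    refine ⟨_, ⟨L, rfl, hL⟩, ?_⟩
    simp only
    rw [h.form_word_eq_of_eq (Function.invFun_eq (f := fun L => wordProd (mirrorPSL R) L)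
      ⟨L, rfl⟩)])
  have he0 : e ≠ 0 := by rcases he with rfl | rfl <;> simp
  have hback : ∀ v, wordAct R L.reverse (wordAct R L v) = v := by
    intro v
    rw [← h.rep_wordProd, ← h.rep_wordProd, wordProd_reverse h.gen_sq,
      ← Module.End.mul_apply, ← map_mul]
    simp
  have hd0 : e • wordAct R L u ≠ 0 := by
    intro h0
    rw [smul_eq_zero, or_iff_right he0] at h0
    apply hu0
    have := hback u
    rw [h0] at this
    rw [← this]
    simpa using h.wordAct_smul L.reverse 0 0
  obtain ⟨i, hi, c, hc, hci⟩ := h.isotropic_mem_chamber hν hmem hd0 (by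
    simp [h.form_wordAct hν, huu])
  have hw : wordAct R L u = (e⁻¹ * c) • dual R ν i := by
    rw [mul_smul, ← hci, smul_smul, inv_mul_cancel₀ he0, one_smul]
  have hrot : wordAct R [i + 1, i + 2] (dual R ν i) = dual R ν i := by
    obtain ⟨-, h2, h3⟩ := h.form_dual hν.lSq_pos i
    simp [reflect, h2, h3]
  set L' := L.reverse ++ ([i + 1, i + 2] ++ L) with hL'
  have hfix : wordAct R L' u = u := by
    rw [hL', wordAct_append, wordAct_append, hw, h.wordAct_smul, hrot, ← hw, hback]
  have hgrp : wordProd (mirrorPSL R) L' = (wordProd (mirrorPSL R) L)⁻¹ * rotation R i *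
      ((wordProd (mirrorPSL R) L)⁻¹)⁻¹ := by
    rw [hL', wordProd_append, wordProd_append, wordProd_reverse h.mirrorPSL_sq, inv_inv,
      mul_assoc]
    simp [rotation]
  have hev : Even L'.length := by
    rw [hL']; simp only [List.length_append, List.length_reverse, List.length_cons,
      List.length_nil]
    exact ⟨L.length + 1, by omega⟩
  have hmob : mobius (wordProd (mirrorPSL R) L') ((x : ℂ) : OnePoint ℂ) = (x : ℂ) := by
    rw [hu, h.wordAct_isotropic] at hfix
    have e0 := congrFun hfix 0
    have e2 := congrFun hfix 2
    simp at e0 e2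
    rw [← h.realPSL_wordMat, realPSL_mobius_coe (h.det_wordMat_ne_zero _)]
    generalize wordMat R L' = N at e0 e2
    have e3 : N 1 0 * x + N 1 1 ≠ 0 := by
      rcases e2 with e2 | e2 <;> rw [e2] <;> norm_num
    have e4 : N 0 0 * x + N 0 1 = x * (N 1 0 * x + N 1 1) := by
      rcases e2 with e2 | e2 <;> rw [e2] at e0 ⊢ <;> linarith
    constructor
    · exact_mod_cast e3
    · exact_mod_cast e4
  obtain ⟨U, hUo, hxU, hfin⟩ := hx
  have hsub : (Subgroup.zpowers (wordProd (mirrorPSL R) L') : Set PSL(2, ℂ)) ⊆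
      {g | g ∈ evenGroup R ∧ (mobius g '' U ∩ U).Nonempty} := by
    rintro _ ⟨n, rfl⟩
    refine ⟨zpow_mem ((h.mem_evenGroup_iff _).mpr ⟨L', hev, rfl⟩) n, _, ⟨_, hxU, ?_⟩, hxU⟩
    rw [map_zpow]
    exact Function.IsFixedPt.perm_zpow hmob n
  have hfo : IsOfFinOrder (wordProd (mirrorPSL R) L') := by
    rw [← finite_zpowers]
    exact hfin.subset hsub
  obtain ⟨n, hn, h1⟩ := isOfFinOrder_iff_pow_eq_one.mp hfo
  rw [hgrp, conj_pow, conj_eq_one_iff] at h1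
  exact h.rotation_pow_ne_one hν hi hn.ne' h1

theorem limitSet_evenGroup (h : IsMirrorTriple R ν) (hν : IsHyperbolicSignature ν) :
    limitSet (evenGroup R) = SphereCircle.realLine.points := by
  ext z
  rw [limitSet, Set.mem_compl_iff]
  cases z with
  | infty =>
    refine iff_of_true ?_ infty_mem_realLine
    -- A neighbourhood of ∞ on which the group acts discontinuously would contain large real
    -- numbers.
    rintro ⟨U, hUo, hxU, hfin⟩
    have hcl : IsCompact ((↑) ⁻¹' U : Set ℂ)ᶜ := (OnePoint.isOpen_def.mp hUo).1 hxU
    obtain ⟨C, hC⟩ := hcl.isBounded.exists_norm_le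
    refine h.coe_real_notMem_discontinuitySet hν (|C| + 1) ⟨U, hUo, ?_, hfin⟩
    by_contra hn
    have := hC _ hn
    rw [Complex.norm_real, Real.norm_eq_abs] at this
    have h1 := le_abs_self C
    have h2 := le_abs_self (|C| + 1)
    linarith
  | coe z =>
    rw [coe_mem_realLine]
    constructor
    · intro hz
      by_contra h0
      exact hz (h.mem_discontinuitySet hν h0)
    · intro hz
      have : z = (z.re : ℂ) := by apply Complex.ext <;> simp [hz]
      rw [this]
      exact h.coe_real_notMem_discontinuitySet hν _

theorem isKleinian_evenGroup (h : IsMirrorTriple R ν) (hν : IsHyperbolicSignature ν) :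
    IsKleinian (evenGroup R) := ⟨_, h.mem_discontinuitySet hν (z := Complex.I) (by simp)⟩

end IsMirrorTriple

/-! ### Circles orthogonal to the real line -/

/-- The defining function of the circle orthogonal to the real line given by a vector. -/
def height (s : V3) : OnePoint ℂ → ℝ
  | none => s 2
  | some z => s 2 * Complex.normSq z - 2 * s 0 * z.re + s 1

@[simp] theorem height_infty (s : V3) : height s ∞ = s 2 := rfl

@[simp] theorem height_coe (s : V3) (z : ℂ) :
    height s (z : OnePoint ℂ) = s 2 * Complex.normSq z - 2 * s 0 * z.re + s 1 := rfl

theorem height_smul (c : ℝ) (s : V3) (x : OnePoint ℂ) : height (c • s) x = c * height s x := by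
  cases x with
  | infty => simp
  | coe z => simp; ring

/-- The vector of a circle orthogonal to the real line. -/
def circleVec (C : SphereCircle) : V3 := ![-C.β.re, C.γ, C.α]

theorem orthogonal_realLine_iff (C : SphereCircle) :
    C.Orthogonal SphereCircle.realLine ↔ C.β.im = 0 := by
  simp [SphereCircle.Orthogonal, SphereCircle.realLine]

theorem mem_points_iff {C : SphereCircle} (hC : C.β.im = 0) (x : OnePoint ℂ) :
    x ∈ C.points ↔ height (circleVec C) x = 0 := by
  cases x with
  | infty => simp [SphereCircle.points, circleVec]
  | coe z =>
    simp only [SphereCircle.points, Set.mem_ofPred_eq, OnePoint.coe_ne_infty, false_and, false_or,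
      height_coe, circleVec]
    constructor
    · rintro ⟨w, hw, h⟩
      obtain rfl := OnePoint.coe_injective hw
      simp [hC] at h ⊢; linarith
    · intro h
      refine ⟨z, rfl, ?_⟩
      simp [hC] at h ⊢; linarith

theorem form_circleVec_pos {C : SphereCircle} (hC : C.β.im = 0) :
    0 < form (circleVec C) (circleVec C) := by
  have := C.nondeg
  rw [Complex.normSq_apply, hC] at this
  simp [form_apply, circleVec]; linarith

/-- A circle orthogonal to the real line is determined by two of its points there. -/
theorem eq_zero_of_height {s : V3} {x y z : OnePoint ℂ} (hx : x ∈ SphereCircle.realLine.points)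
    (hy : y ∈ SphereCircle.realLine.points) (hz : z ∈ SphereCircle.realLine.points)
    (hxy : x ≠ y) (hxz : x ≠ z) (hyz : y ≠ z) (h1 : height s x = 0) (h2 : height s y = 0)
    (h3 : height s z = 0) : s = 0 := by
  have two : ∀ x y : OnePoint ℂ, x ∈ SphereCircle.realLine.points →
      y ∈ SphereCircle.realLine.points → x ≠ y → s 2 = 0 → x ≠ ∞ → y ≠ ∞ → height s x = 0 →
      height s y = 0 → s = 0 := by
    intro x y hx hy hxy h0 hx' hy' h1 h2
    cases x with
    | infty => exact absurd rfl hx'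
    | coe x =>
    cases y with
    | infty => exact absurd rfl hy'
    | coe y =>
    rw [coe_mem_realLine] at hx hy
    rw [height_coe, h0] at h1 h2
    have hne : x.re - y.re ≠ 0 := by
      intro h; apply hxy; congr 1; apply Complex.ext
      · linarith
      · rw [hx, hy]
    have h4 : s 0 = 0 := by
      have : s 0 * (x.re - y.re) = 0 := by linarith
      exact (mul_eq_zero.mp this).resolve_right hne
    have h5 : s 1 = 0 := by rw [h4] at h1; linarith
    ext i; fin_cases i <;> assumption
  by_cases hx' : x = ∞
  · exact two y z hy hz hyz (by simpa [hx'] using h1) (by rw [← hx']; exact hxy.symm)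
      (by rw [← hx']; exact hxz.symm) h2 h3
  by_cases hy' : y = ∞
  · exact two x z hx hz hxz (by simpa [hy'] using h2) hx' (by rw [← hy']; exact hyz.symm) h1 h3
  by_cases hz' : z = ∞
  · exact two x y hx hy hxy (by simpa [hz'] using h3) hx' hy' h1 h2
  refine two x y hx hy hxy ?_ hx' hy' h1 h2
  lift x to ℂ using hx'
  lift y to ℂ using hy'
  lift z to ℂ using hz'
  rw [coe_mem_realLine] at hx hy hz
  have hne : ∀ {x y : ℂ}, x.im = 0 → y.im = 0 → (x : OnePoint ℂ) ≠ y → x.re - y.re ≠ 0 := by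
    intro x y hx hy hxy h; apply hxy; congr 1; apply Complex.ext
    · linarith
    · rw [hx, hy]
  have e1 := hne hx hy hxy
  have e2 := hne hx hz hxz
  have e3 := hne hy hz hyz
  rw [height_coe, Complex.normSq_apply] at h1 h2 h3
  rw [hx] at h1; rw [hy] at h2; rw [hz] at h3
  have f1 : s 2 * (x.re + y.re) - 2 * s 0 = 0 := by
    apply (mul_eq_zero.mp (?_ : (x.re - y.re) * _ = 0)).resolve_left e1
    linear_combination h1 - h2
  have f2 : s 2 * (x.re + z.re) - 2 * s 0 = 0 := by
    apply (mul_eq_zero.mp (?_ : (x.re - z.re) * _ = 0)).resolve_left e2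
    linear_combination h1 - h3
  apply (mul_eq_zero.mp (?_ : (y.re - z.re) * _ = 0)).resolve_left e3
  linear_combination f1 - f2

/-! ### Angles -/

/-- Points of the closed upper half-plane. -/
def IsUpper (x : OnePoint ℂ) : Prop := x = ∞ ∨ ∃ z : ℂ, x = z ∧ 0 ≤ z.im

/-- Under `centered w` a geodesic through w becomes a diameter with direction s₂w − s₀, and the real
part is the inner product with the perpendicular direction. It is a negative multiple of the height,
with a factor that serves all geodesics through w. -/
theorem re_centered {w : ℂ} (hw : 0 < w.im) {x : OnePoint ℂ} (hx : IsUpper x) :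
    ∃ k : ℝ, 0 < k ∧ ∀ s : V3, height s (w : OnePoint ℂ) = 0 →
      (conj (centered w x) * (Complex.I * (s 2 * w - s 0))).re = -k * height s x := by
  rcases hx with rfl | ⟨z, rfl, hz⟩
  · refine ⟨w.im, hw, fun s _ => ?_⟩
    have : centered w ∞ = 1 := rfl
    rw [this]; simp; ring
  · have hne : z - conj w ≠ 0 := by
      intro h
      have := congrArg Complex.im h
      simp at this; linarith
    have hns : 0 < Complex.normSq (z - conj w) := Complex.normSq_pos.mpr hne
    refine ⟨w.im / Complex.normSq (z - conj w), by positivity, fun s hs => ?_⟩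
    have h1 : centered w (z : OnePoint ℂ) = (z - w) / (z - conj w) := rfl
    have h2 : conj (centered w (z : OnePoint ℂ)) * (Complex.I * (s 2 * w - s 0)) =
        ((Complex.normSq (z - conj w))⁻¹ : ℝ) *
          (conj (z - w) * (z - conj w) * (Complex.I * (s 2 * w - s 0))) := by
      have h0 : conj (z - conj w) ≠ 0 := (map_ne_zero _).mpr hne
      rw [h1, map_div₀, Complex.ofReal_inv, ← Complex.mul_conj]
      field_simp
    rw [h2, Complex.re_ofReal_mul]
    have h3 : (conj (z - w) * (z - conj w) * (Complex.I * (s 2 * w - s 0))).re =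
        - w.im * height s (z : OnePoint ℂ) := by
      rw [height_coe] at hs ⊢
      rw [Complex.normSq_apply] at hs ⊢
      simp
      linear_combination w.im * hs
    rw [h3]; ring

/-- The angle between the diameters of two geodesics through w is thus computed by the form of their
normals. -/
theorem re_tangent {w : ℂ} {s t : V3} (hs : height s (w : OnePoint ℂ) = 0)
    (ht : height t (w : OnePoint ℂ) = 0) :
    (conj (s 2 * w - s 0 : ℂ) * (t 2 * w - t 0)).re = form s t := by
  rw [height_coe, Complex.normSq_apply] at hs ht
  rw [form_apply]
  simp
  linear_combination (t 2 / 2) * hs + (s 2 / 2) * ht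

theorem eq_smul_of_re {ζ τ : ℂ} (hτ : Complex.normSq τ = 1)
    (h : (conj ζ * (Complex.I * τ)).re = 0) : ∃ r : ℝ, ζ = r • τ := by
  rw [Complex.normSq_apply] at hτ
  simp at h
  refine ⟨ζ.re * τ.re + ζ.im * τ.im, ?_⟩
  apply Complex.ext
  · simp; linear_combination (-ζ.re) * hτ - τ.im * h
  · simp; linear_combination (-ζ.im) * hτ + τ.re * h

/-- ζ and ζ' are real multiples of τ' and τ. The two inequalities make these multiples of opposite
sign, hence the minus. -/
theorem cos_angle_of_re {ζ ζ' τ τ' : ℂ} (hτ : Complex.normSq τ = 1) (hτ' : Complex.normSq τ' = 1)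
    (h1 : (conj ζ * (Complex.I * τ')).re = 0) (h2 : (conj ζ * (Complex.I * τ)).re < 0)
    (h3 : (conj ζ' * (Complex.I * τ)).re = 0) (h4 : (conj ζ' * (Complex.I * τ')).re < 0) :
    Real.cos (InnerProductGeometry.angle ζ ζ') = -(conj τ * τ').re := by
  obtain ⟨r, rfl⟩ := eq_smul_of_re hτ' h1
  obtain ⟨r', rfl⟩ := eq_smul_of_re hτ h3
  have n1 : ‖τ‖ = 1 := by
    rw [Complex.normSq_eq_norm_sq] at hτ
    exact (pow_eq_one_iff_of_nonneg (norm_nonneg _) two_ne_zero).mp hτ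
  have n2 : ‖τ'‖ = 1 := by
    rw [Complex.normSq_eq_norm_sq] at hτ'
    exact (pow_eq_one_iff_of_nonneg (norm_nonneg _) two_ne_zero).mp hτ'
  set m := τ'.re * τ.im - τ'.im * τ.re with hm
  have e2 : 0 < r * m := by
    simp at h2
    rw [hm]; linarith
  have e4 : r' * m < 0 := by
    simp at h4
    rw [hm]; linarith
  have hrr : r * r' < 0 := by
    have h5 : (r * r') * (m * m) < 0 := by nlinarith [mul_pos_of_neg_of_neg e4 (neg_lt_zero.mpr e2)]
    by_contra! h6
    have := mul_nonneg h6 (mul_self_nonneg m)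
    linarith
  rw [InnerProductGeometry.cos_angle, norm_smul, norm_smul, n1, n2, mul_one, mul_one,
    Complex.inner, Real.norm_eq_abs, Real.norm_eq_abs, ← abs_mul, abs_of_neg hrr]
  rw [div_eq_iff (by linarith)]
  simp
  ring

/-- The angle at a finite vertex. -/
theorem cos_angleAt {w : ℂ} (hw : 0 < w.im) {x y : OnePoint ℂ} (hx : IsUpper x) (hy : IsUpper y)
    {s t : V3} (hs1 : form s s = 1) (ht1 : form t t = 1) (hs : height s (w : OnePoint ℂ) = 0)
    (ht : height t (w : OnePoint ℂ) = 0) (htx : height t x = 0) (hsx : 0 < height s x)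
    (hsy : height s y = 0) (hty : 0 < height t y) : Real.cos (angleAt w x y) = - form s t := by
  obtain ⟨k, hk, hk'⟩ := re_centered hw hx
  obtain ⟨l, hl, hl'⟩ := re_centered hw hy
  rw [← re_tangent hs ht]
  apply cos_angle_of_re
  · rw [← hs1, ← re_tangent hs hs, ← Complex.normSq_eq_conj_mul_self, Complex.ofReal_re]
  · rw [← ht1, ← re_tangent ht ht, ← Complex.normSq_eq_conj_mul_self, Complex.ofReal_re]
  · rw [hk' t ht, htx, mul_zero]
  · rw [hk' s hs]; nlinarith
  · rw [hl' s hs, hsy, mul_zero]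
  · rw [hl' t ht]; nlinarith

/-- The angle between two rays of one geodesic. -/
theorem sq_cos_angleAt {w : ℂ} (hw : 0 < w.im) {x y : OnePoint ℂ} (hx : IsUpper x)
    (hy : IsUpper y) (hxw : x ≠ w) (hyw : y ≠ w) {s : V3} (hs1 : form s s = 1)
    (hs : height s (w : OnePoint ℂ) = 0) (hsx : height s x = 0) (hsy : height s y = 0) :
    Real.cos (angleAt w x y) ^ 2 = 1 := by
  obtain ⟨k, hk, hk'⟩ := re_centered hw hx
  obtain ⟨l, hl, hl'⟩ := re_centered hw hy
  have hτ : Complex.normSq (s 2 * w - s 0 : ℂ) = 1 := by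
    rw [← hs1, ← re_tangent hs hs, ← Complex.normSq_eq_conj_mul_self, Complex.ofReal_re]
  have hne : ∀ x : OnePoint ℂ, IsUpper x → x ≠ w → centered w x ≠ 0 := by
    rintro x (rfl | ⟨z, rfl, hz⟩) hx
    · exact one_ne_zero
    · have h0 : z - conj w ≠ 0 := by
        intro h
        have := congrArg Complex.im h
        simp at this; linarith
      exact div_ne_zero (sub_ne_zero.mpr fun h => hx (congrArg _ h)) h0
  obtain ⟨r, hr⟩ := eq_smul_of_re hτ (by rw [hk' s hs, hsx, mul_zero])
  obtain ⟨r', hr'⟩ := eq_smul_of_re hτ (by rw [hl' s hs, hsy, mul_zero])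
  have hr0 : r ≠ 0 := by rintro rfl; exact hne x hx hxw (by rw [hr, zero_smul])
  have hr0' : r' ≠ 0 := by rintro rfl; exact hne y hy hyw (by rw [hr', zero_smul])
  have n1 : ‖(s 2 * w - s 0 : ℂ)‖ = 1 := by
    rw [Complex.normSq_eq_norm_sq] at hτ
    exact (pow_eq_one_iff_of_nonneg (norm_nonneg _) two_ne_zero).mp hτ
  rw [angleAt, InnerProductGeometry.cos_angle, hr, hr', inner_smul_left, inner_smul_right,
    real_inner_self_eq_norm_sq, norm_smul, norm_smul, n1]
  simp only [one_pow, mul_one, Real.norm_eq_abs]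
  rw [div_pow, mul_pow |r|, sq_abs, sq_abs]
  have : r ^ 2 * r' ^ 2 ≠ 0 := by positivity
  rw [div_eq_one_iff_eq this]
  simp
  ring

/-- The sides at an ideal vertex. -/
theorem form_eq_neg_one {x p p' : OnePoint ℂ} (hx : x ∈ SphereCircle.realLine.points)
    {s t : V3} (hs1 : form s s = 1) (ht1 : form t t = 1) (hs : height s x = 0)
    (ht : height t x = 0) (htp : height t p = 0) (hsp : 0 < height s p)
    (hsp' : height s p' = 0) (htp' : 0 < height t p') : form s t = -1 := by
  rw [form_apply] at hs1 ht1
  cases x with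
  | infty =>
    simp only [height_infty] at hs ht
    rw [hs] at hs1
    rw [ht] at ht1
    -- Norm one leaves s₀² = t₀² = 1. If s₀ = t₀, both normals point the same way; then `p` gives t₁
    -- < s₁ and `p'` the reverse. So s₀ = −t₀.
    have key : ∀ s t : V3, s 2 = 0 → t 2 = 0 → s 0 = t 0 → ∀ p, height t p = 0 →
        0 < height s p → t 1 < s 1 := by
      intro s t hs ht hst p h1 h2
      cases p with
      | infty => simp [hs] at h2
      | coe p => simp [hs, ht, hst] at h1 h2; linarith
    have hne : s 0 ≠ t 0 := fun h0 =>
      absurd (key s t hs ht h0 p htp hsp) (key t s ht hs h0.symm p' hsp' htp').not_gt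
    have h5 : (s 0 - t 0) * (s 0 + t 0) = 0 := by linear_combination hs1 - ht1
    have h6 := (mul_eq_zero.mp h5).resolve_left (sub_ne_zero.mpr hne)
    rw [form_apply, hs, ht]
    linear_combination s 0 * h6 - hs1
  | coe x =>
    rw [coe_mem_realLine] at hx
    rw [height_coe, Complex.normSq_apply, hx] at hs ht
    -- The same argument at a finite ideal vertex, with s₂x − s₀ and t₂x − t₀, whose squares are 1,
    -- in place of s₀ and t₀.
    have key : ∀ s t : V3, s 2 * (x.re * x.re + 0 * 0) - 2 * s 0 * x.re + s 1 = 0 →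
        t 2 * (x.re * x.re + 0 * 0) - 2 * t 0 * x.re + t 1 = 0 →
        s 2 * x.re - s 0 = t 2 * x.re - t 0 → ∀ p, height t p = 0 →
        0 < height s p → t 2 < s 2 := by
      intro s t hs ht hst p h1 h2
      cases p with
      | infty => simp at h1 h2; linarith
      | coe p =>
        rw [height_coe, Complex.normSq_apply] at h1 h2
        have h3 : 0 < (s 2 - t 2) * ((p.re - x.re) ^ 2 + p.im ^ 2) := by
          have : (s 2 - t 2) * ((p.re - x.re) ^ 2 + p.im ^ 2) =
            (s 2 * (p.re * p.re + p.im * p.im) - 2 * s 0 * p.re + s 1) := by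
            linear_combination -h1 - hs + ht - 2 * (p.re - x.re) * hst
          rw [this]; exact h2
        by_contra! hle
        have : (s 2 - t 2) * ((p.re - x.re) ^ 2 + p.im ^ 2) ≤ 0 :=
          mul_nonpos_of_nonpos_of_nonneg (by linarith) (by positivity)
        linarith
    have hne : s 2 * x.re - s 0 ≠ t 2 * x.re - t 0 := fun h0 =>
      absurd (key s t hs ht h0 p htp hsp) (key t s ht hs h0.symm p' hsp' htp').not_gt
    have h5 : ((s 2 * x.re - s 0) - (t 2 * x.re - t 0)) *
        ((s 2 * x.re - s 0) + (t 2 * x.re - t 0)) = 0 := by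
      linear_combination hs1 - ht1 + s 2 * hs - t 2 * ht
    have h6 := (mul_eq_zero.mp h5).resolve_left (sub_ne_zero.mpr hne)
    rw [form_apply]
    linear_combination (s 2 * x.re - s 0) * h6 - hs1 - (s 2 + t 2 / 2) * hs - s 2 / 2 * ht

/-! ### The mirrors of a hyperbolic triangle -/

theorem isUpper_of_mem_realLine {x : OnePoint ℂ} (hx : x ∈ SphereCircle.realLine.points) :
    IsUpper x := by
  cases x with
  | infty => exact .inl rfl
  | coe z => exact .inr ⟨z, rfl, ((coe_mem_realLine z).mp hx).ge⟩

theorem IsTriangle.isUpper {v : Fin 3 → OnePoint ℂ} {ν : Fin 3 → ℕ∞} (hT : IsTriangle v ν)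
    (i : Fin 3) : IsUpper (v i) := by
  by_cases h : ν i = ⊤
  · exact isUpper_of_mem_realLine (hT.ideal i h)
  · obtain ⟨w, hw, hpos, -⟩ := hT.finite i h
    exact .inr ⟨w, hw, hpos.le⟩

theorem forall_fin_three_cyclic {p : Fin 3 → Prop} (i : Fin 3) (h0 : p i) (h1 : p (i + 1))
    (h2 : p (i + 2)) (j : Fin 3) : p j := by
  fin_cases i <;> fin_cases j <;> assumption

/-- Three vertices on one geodesic would give a finite vertex an angle of squared cosine 1, while
sin(π/n) > 0. If all vertices are ideal, a circle orthogonal to the real line has at most two points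
on it. -/
theorem IsTriangle.height_ne_zero {v : Fin 3 → OnePoint ℂ} {ν : Fin 3 → ℕ∞}
    {S : Fin 3 → SphereCircle} (hν : ∀ i, 2 ≤ ν i) (hT : IsTriangle v ν) (hS : AreSides S v)
    (i : Fin 3) : height (circleVec (S i)) (v i) ≠ 0 := by
  intro h0
  have hβ := (orthogonal_realLine_iff _).mp (hS i).1
  have h1 := (mem_points_iff hβ _).mp (hS i).2.1
  have h2 := (mem_points_iff hβ _).mp (hS i).2.2
  have hall : ∀ j, height (circleVec (S i)) (v j) = 0 := forall_fin_three_cyclic i h0 h1 h2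
  have hpos := form_circleVec_pos hβ
  by_cases hfin : ∃ j, ν j ≠ ⊤
  · obtain ⟨j, hj⟩ := hfin
    obtain ⟨w, hw, hw0, hang⟩ := hT.finite j hj
    set c := (√(form (circleVec (S i)) (circleVec (S i))))⁻¹ with hc
    have hs1 : form (c • circleVec (S i)) (c • circleVec (S i)) = 1 := by
      simp only [map_smul, LinearMap.smul_apply, smul_eq_mul]
      rw [← mul_assoc, hc, ← mul_inv, Real.mul_self_sqrt hpos.le, inv_mul_cancel₀ hpos.ne']
    have hh : ∀ j, height (c • circleVec (S i)) (v j) = 0 := fun j => by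
      rw [height_smul, hall, mul_zero]
    have key := sq_cos_angleAt hw0 (hT.isUpper (j + 1)) (hT.isUpper (j + 2))
      (by rw [← hw]; exact hT.injective.ne (by fin_cases j <;> decide))
      (by rw [← hw]; exact hT.injective.ne (by fin_cases j <;> decide))
      hs1 (by rw [← hw]; exact hh j) (hh _) (hh _)
    rw [hang] at key
    have h3 := sinPi_pos (hν j) hj
    have h4 := sinPi_sq (ν j)
    have h5 : cosPi (ν j) ^ 2 = 1 := key
    rw [h5] at h4
    have := pow_pos h3 2
    linarith
  · push Not at hfin
    have h01 := hT.injective.ne (show (0 : Fin 3) ≠ 1 by decide)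
    have h02 := hT.injective.ne (show (0 : Fin 3) ≠ 2 by decide)
    have h12 := hT.injective.ne (show (1 : Fin 3) ≠ 2 by decide)
    have := eq_zero_of_height (hT.ideal 0 (hfin 0)) (hT.ideal 1 (hfin 1)) (hT.ideal 2 (hfin 2))
      h01 h02 h12 (hall 0) (hall 1) (hall 2)
    rw [this] at hpos
    simp at hpos

/-- The sides of a hyperbolic triangle have unit normal vectors that form a triple of mirrors. -/
theorem IsTriangle.exists_isMirrorTriple {v : Fin 3 → OnePoint ℂ} {ν : Fin 3 → ℕ∞}
    {S : Fin 3 → SphereCircle} (hν : ∀ i, 2 ≤ ν i) (hT : IsTriangle v ν) (hS : AreSides S v) :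
    ∃ R : Fin 3 → V3, IsMirrorTriple R ν ∧
      ∀ i, ∃ c : ℝ, c ≠ 0 ∧ circleVec (S i) = c • R i := by
  have hβ : ∀ i, (S i).β.im = 0 := fun i => (orthogonal_realLine_iff _).mp (hS i).1
  have h1 : ∀ i, height (circleVec (S i)) (v (i + 1)) = 0 :=
    fun i => (mem_points_iff (hβ i) _).mp (hS i).2.1
  have h2 : ∀ i, height (circleVec (S i)) (v (i + 2)) = 0 :=
    fun i => (mem_points_iff (hβ i) _).mp (hS i).2.2
  -- The normal is scaled to norm one, with the sign for which the opposite vertex is on the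
  -- positive side.
  have hex : ∀ i, ∃ r : V3, form r r = 1 ∧ 0 < height r (v i) ∧
      ∃ c : ℝ, c ≠ 0 ∧ circleVec (S i) = c • r := by
    intro i
    have h0 := hT.height_ne_zero hν hS i
    have hpos := form_circleVec_pos (hβ i)
    set u := circleVec (S i)
    have hc0 : 0 < √(form u u) := Real.sqrt_pos.mpr hpos
    set c := √(form u u) with hc
    have hcc : c * c = form u u := Real.mul_self_sqrt hpos.le
    have h1 : ∀ d : ℝ, d * d = 1 → form ((d * c⁻¹) • u) ((d * c⁻¹) • u) = 1 := by
      intro d hd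
      simp only [map_smul, LinearMap.smul_apply, smul_eq_mul]
      rw [← hcc]
      field_simp
      rw [sq, hd]
    rcases lt_or_gt_of_ne h0 with hneg | hpos'
    · refine ⟨((-1) * c⁻¹) • u, h1 (-1) (by norm_num), ?_, -c, by simpa using hc0.ne', ?_⟩
      · rw [height_smul]
        have := mul_pos (inv_pos.mpr hc0) (neg_pos.mpr hneg)
        linarith
      · rw [smul_smul]
        have : -c * (-1 * c⁻¹) = 1 := by field_simp
        rw [this, one_smul]
    · refine ⟨(1 * c⁻¹) • u, h1 1 (by norm_num), ?_, c, hc0.ne', ?_⟩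
      · rw [height_smul]
        have := mul_pos (inv_pos.mpr hc0) hpos'
        linarith
      · rw [smul_smul, one_mul, mul_inv_cancel₀ hc0.ne', one_smul]
  choose R hR1 hRpos c hc hRc using hex
  have k1 : ∀ i, height (R i) (v (i + 1)) = 0 := fun i => by
    have := h1 i
    rw [hRc, height_smul] at this
    exact (mul_eq_zero.mp this).resolve_left (hc i)
  have k2 : ∀ i, height (R i) (v (i + 2)) = 0 := fun i => by
    have := h2 i
    rw [hRc, height_smul] at this
    exact (mul_eq_zero.mp this).resolve_left (hc i)
  refine ⟨R, ⟨hR1, fun i => ?_⟩, fun i => ⟨c i, hc i, hRc i⟩⟩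
  have a1 : height (R (i + 1)) (v i) = 0 := by
    have := k2 (i + 1); rwa [show i + 1 + 2 = i by grind] at this
  have a2 : height (R (i + 2)) (v i) = 0 := by
    have := k1 (i + 2); rwa [show i + 2 + 1 = i by grind] at this
  have a3 : height (R (i + 2)) (v (i + 1)) = 0 := by
    have := k2 (i + 2); rwa [show i + 2 + 2 = i + 1 by grind] at this
  have a4 : height (R (i + 1)) (v (i + 2)) = 0 := by
    have := k1 (i + 1); rwa [show i + 1 + 1 = i + 2 by grind] at this
  by_cases hi : ν i = ⊤
  · rw [hi, cosPi_top]
    exact form_eq_neg_one (hT.ideal i hi) (hR1 _) (hR1 _) a1 a2 a3 (hRpos _) a4 (hRpos _)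
  · obtain ⟨w, hw, hw0, hang⟩ := hT.finite i hi
    rw [hw] at a1 a2
    have := cos_angleAt hw0 (hT.isUpper (i + 1)) (hT.isUpper (i + 2)) (hR1 _) (hR1 _) a1 a2 a3
      (hRpos _) a4 (hRpos _)
    rw [hang] at this
    rw [cosPi, this, neg_neg]

/-! ### Groups generated by the reflections in circles -/

/-- Complex conjugation on the sphere. -/
def conjPerm : Equiv.Perm (OnePoint ℂ) := Complex.conjCLE.toHomeomorph.onePointCongr.toEquiv

@[simp] theorem conjPerm_coe (z : ℂ) : conjPerm (z : OnePoint ℂ) = ((conj z : ℂ) : OnePoint ℂ) :=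
  rfl

@[simp] theorem conjPerm_infty : conjPerm ∞ = ∞ := rfl

theorem conjPerm_sq : conjPerm * conjPerm = 1 := by
  ext x
  cases x with
  | infty => simp
  | coe z => simp

theorem conjPerm_comm {M : RMat} (hM : M.det ≠ 0) :
    conjPerm * mobius (realPSL M) = mobius (realPSL M) * conjPerm := by
  ext x
  rw [Equiv.Perm.mul_apply, Equiv.Perm.mul_apply]
  cases x with
  | infty =>
    rw [conjPerm_infty, realPSL, mobius_infty (det_map_ne_zero hM)]
    split_ifs with h
    · rfl
    · rw [conjPerm_coe]
      simp
  | coe z =>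
    have h1 : ∀ i j, conj ((M.map Complex.ofReal) i j) = (M.map Complex.ofReal) i j := by
      simp
    rw [conjPerm_coe, realPSL, mobius_coe (det_map_ne_zero hM), mobius_coe (det_map_ne_zero hM)]
    have h2 : (M.map Complex.ofReal) 1 0 * conj z + (M.map Complex.ofReal) 1 1 =
        conj ((M.map Complex.ofReal) 1 0 * z + (M.map Complex.ofReal) 1 1) := by
      rw [map_add, map_mul, h1, h1]
    have h3 : (M.map Complex.ofReal) 0 0 * conj z + (M.map Complex.ofReal) 0 1 =
        conj ((M.map Complex.ofReal) 0 0 * z + (M.map Complex.ofReal) 0 1) := by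
      rw [map_add, map_mul, h1, h1]
    rw [h2, h3]
    by_cases h : (M.map Complex.ofReal) 1 0 * z + (M.map Complex.ofReal) 1 1 = 0
    · rw [if_pos h, if_pos (by rw [h, map_zero]), conjPerm_infty]
    · rw [if_neg h, if_neg ((map_ne_zero _).mpr h), conjPerm_coe, map_div₀]

/-- For a circle orthogonal to the real line β is real, and the reflection matrix is the traceless
matrix of the normal vector. -/
theorem reflection_eq {C : SphereCircle} (hC : C.β.im = 0) :
    C.reflection = mobius (realPSL (toMat (circleVec C))) * conjPerm := by
  have hβ : C.β = (C.β.re : ℂ) := Complex.ext rfl (by simpa using hC)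
  have hM : (toMat (circleVec C)).det ≠ 0 := by
    rw [det_toMat]; simpa using (form_circleVec_pos hC).ne'
  ext x
  rw [Equiv.Perm.mul_apply, realPSL, mobius_toPSL (det_map_ne_zero hM)]
  change C.reflectionMatrix • conjPerm x = _
  congr 1
  apply Units.ext
  change !![-C.β, -(C.γ : ℂ); (C.α : ℂ), conj C.β] = _
  rw [hβ, Complex.conj_ofReal]
  ext i j
  fin_cases i <;> fin_cases j <;> simp [toMat, circleVec, Matrix.GeneralLinearGroup.mkOfDetNeZero]

namespace IsMirrorTriple
variable {R : Fin 3 → V3} {ν : Fin 3 → ℕ∞}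

/-- Complex conjugation commutes with real transformations, so all conjugations can be collected on
the right, where only their parity counts. -/
theorem wordProd_reflection (h : IsMirrorTriple R ν) (L : List (Fin 3)) :
    wordProd (fun i => mobius (mirrorPSL R i) * conjPerm) L =
      mobius (wordProd (mirrorPSL R) L) * conjPerm ^ L.length := by
  induction L with
  | nil => simp
  | cons i L ih =>
    rw [wordProd_cons, wordProd_cons, ih, List.length_cons, pow_succ', map_mul,
      ← h.realPSL_wordMat L]
    have := conjPerm_comm (h.det_wordMat_ne_zero L)
    calc _ = mobius (mirrorPSL R i) * (conjPerm * mobius (realPSL (wordMat R L))) *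
          conjPerm ^ L.length := by simp only [mul_assoc]
      _ = _ := by rw [this]; simp only [mul_assoc]

/-- The orientation preserving elements of the group generated by the reflections in the mirrors
are the products of even numbers of mirrors. -/
theorem orientationPreserving_eq (h : IsMirrorTriple R ν) {S : Fin 3 → SphereCircle}
    (hβ : ∀ i, (S i).β.im = 0) (hS : ∀ i, ∃ c : ℝ, c ≠ 0 ∧ circleVec (S i) = c • R i) :
    orientationPreserving S = evenGroup R := by
  have href : (fun i => (S i).reflection) = fun i => mobius (mirrorPSL R i) * conjPerm := by
    funext i
    obtain ⟨c, hc, hRc⟩ := hS i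
    have : toMat (c • R i) = c • toMat (R i) := by
      ext i j; fin_cases i <;> fin_cases j <;> simp [toMat]
    rw [reflection_eq (hβ i), hRc, mirrorPSL, this,
      realPSL_smul (by simp [h.det_toMat_mirror]) hc]
  have hsq : ∀ i, mobius (mirrorPSL R i) * conjPerm * (mobius (mirrorPSL R i) * conjPerm) = 1 := by
    intro i
    have := conjPerm_comm (M := toMat (R i)) (by simp [h.det_toMat_mirror])
    change conjPerm * mobius (mirrorPSL R i) = mobius (mirrorPSL R i) * _ at this
    rw [mul_assoc, ← mul_assoc conjPerm, this, mul_assoc, conjPerm_sq, mul_one, ← map_mul,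
      h.mirrorPSL_sq, map_one]
  have hmem : ∀ f : Equiv.Perm (OnePoint ℂ),
      f ∈ Subgroup.closure (Set.range fun i => mobius (mirrorPSL R i) * conjPerm) ↔
      ∃ L, f = wordProd (fun i => mobius (mirrorPSL R i) * conjPerm) L := by
    intro f
    constructor
    · intro hf
      induction hf using Subgroup.closure_induction with
      | mem x hx => obtain ⟨i, rfl⟩ := hx; exact ⟨[i], by simp⟩
      | one => exact ⟨[], by simp⟩
      | mul x y _ _ hx hy =>
        obtain ⟨L, rfl⟩ := hx
        obtain ⟨L', rfl⟩ := hy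
        exact ⟨L ++ L', by rw [wordProd_append]⟩
      | inv x _ hx =>
        obtain ⟨L, rfl⟩ := hx
        exact ⟨L.reverse, (wordProd_reverse hsq L).symm⟩
    · rintro ⟨L, rfl⟩
      refine list_prod_mem fun x hx => ?_
      obtain ⟨i, -, rfl⟩ := List.mem_map.mp hx
      exact Subgroup.subset_closure ⟨i, rfl⟩
  ext g
  rw [orientationPreserving, Subgroup.mem_comap, href, hmem, h.mem_evenGroup_iff]
  constructor
  · rintro ⟨L, hL⟩
    rw [h.wordProd_reflection] at hL
    rcases Nat.even_or_odd L.length with he | ⟨n, hn⟩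
    · refine ⟨L, he, mobius_injective ?_⟩
      obtain ⟨n, hn⟩ := he
      rw [hL, hn, ← two_mul, pow_mul, sq, conjPerm_sq, one_pow, mul_one]
    -- An odd word would make complex conjugation a Moebius transformation; fixing ∞, 0 and 1 it
    -- would be the identity, but it moves i.
    · exfalso
      rw [hn, pow_succ, pow_mul, sq, conjPerm_sq, one_pow, one_mul] at hL
      have h1 : mobius ((wordProd (mirrorPSL R) L)⁻¹ * g) = conjPerm := by
        rw [map_mul, map_inv, hL, inv_mul_cancel_left]
      have h2 : mobius ((wordProd (mirrorPSL R) L)⁻¹ * g) = 1 := by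
        obtain ⟨M, hM, hMe⟩ := exists_toPSL ((wordProd (mirrorPSL R) L)⁻¹ * g)
        rw [hMe] at h1 ⊢
        have hd : M.det ≠ 0 := by simp [hM]
        have h0 := (mobius_infty_eq_infty hd).mp (by rw [h1]; rfl)
        have h3 := (mobius_coe_fixed hd 0).mp (by rw [h1]; simp)
        have h4 := (mobius_coe_fixed hd 1).mp (by rw [h1]; simp)
        have h3' : M 0 1 = 0 := by simpa using h3
        rw [eq_one_of_fixes hd h0 h3' (by rw [h0, h3'] at h4; linear_combination -h4), map_one]
      rw [h2] at h1
      have h3 := congrArg (fun f => f ((Complex.I : ℂ) : OnePoint ℂ)) h1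
      simp only [Equiv.Perm.one_apply, conjPerm_coe] at h3
      have h4 := congrArg Complex.im (OnePoint.coe_injective h3)
      simp at h4
      norm_num at h4
  · rintro ⟨L, ⟨n, hn⟩, rfl⟩
    refine ⟨L, ?_⟩
    rw [h.wordProd_reflection, hn, ← two_mul, pow_mul, sq, conjPerm_sq, one_pow, mul_one]

end IsMirrorTriple

/-! ### Moebius transformations in homogeneous coordinates -/

theorem homog_infty : homog ∞ = (1, 0) := rfl

theorem homog_coe (z : ℂ) : homog (z : OnePoint ℂ) = (z, 1) := rfl

theorem exists_homog_mobius {M : CMat} (hM : M.det ≠ 0) (x : OnePoint ℂ) :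
    ∃ r : ℂ, r ≠ 0 ∧
      (homog (mobius (toPSL M) x)).1 = r * (M 0 0 * (homog x).1 + M 0 1 * (homog x).2) ∧
      (homog (mobius (toPSL M) x)).2 = r * (M 1 0 * (homog x).1 + M 1 1 * (homog x).2) := by
  have hd : M 0 0 * M 1 1 - M 0 1 * M 1 0 ≠ 0 := by rwa [Matrix.det_fin_two] at hM
  cases x with
  | infty =>
    rw [mobius_infty hM]
    split_ifs with h
    · have h0 : M 0 0 ≠ 0 := by rintro h0; simp [h0, h] at hd
      exact ⟨(M 0 0)⁻¹, inv_ne_zero h0, by simp [homog_infty, h0], by simp [homog_infty, h]⟩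
    · refine ⟨(M 1 0)⁻¹, inv_ne_zero h, ?_, ?_⟩
      · simp [homog_infty, homog_coe]; ring
      · simp [homog_infty, homog_coe, h]
  | coe z =>
    rw [mobius_coe hM]
    split_ifs with h
    · have h0 : M 0 0 * z + M 0 1 ≠ 0 := by
        intro h0
        apply hd
        have e : (M 0 0 * M 1 1 - M 0 1 * M 1 0) * (M 1 0) = 0 := by
          linear_combination (M 0 0 * M 1 0) * h - (M 1 0) ^ 2 * h0
        have e' : (M 0 0 * M 1 1 - M 0 1 * M 1 0) * (M 0 0) = 0 := by
          linear_combination (M 0 0 ^ 2) * h - (M 0 0 * M 1 0) * h0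
        by_contra hne
        have h1 := (mul_eq_zero.mp e).resolve_left hne
        have h2 := (mul_eq_zero.mp e').resolve_left hne
        simp [h1, h2] at hd
      exact ⟨(M 0 0 * z + M 0 1)⁻¹, inv_ne_zero h0, by simp [homog_infty, homog_coe, h0],
        by simp [homog_infty, homog_coe, h]⟩
    · refine ⟨(M 1 0 * z + M 1 1)⁻¹, inv_ne_zero h, ?_, ?_⟩
      · simp [homog_coe]; ring
      · simp [homog_coe, h]

theorem bracket_eq_zero {x y : OnePoint ℂ} : bracket x y = 0 ↔ x = y := by
  cases x with
  | infty => cases y with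
    | infty => simp [bracket]
    | coe y => simp [bracket, homog_infty, homog_coe]
  | coe x => cases y with
    | infty => simp [bracket, homog_infty, homog_coe]
    | coe y => simp [bracket, homog_coe, sub_eq_zero]

/-- Moebius transformations multiply the brackets by a factor for each point. -/
theorem exists_bracket_mobius (U : PSL(2, ℂ)) : ∃ r : OnePoint ℂ → ℂ, (∀ x, r x ≠ 0) ∧
    ∀ x y, bracket (mobius U x) (mobius U y) = r x * r y * bracket x y := by
  obtain ⟨M, hM, rfl⟩ := exists_toPSL U
  have hd : M.det ≠ 0 := by simp [hM]
  choose r hr h1 h2 using exists_homog_mobius hd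
  refine ⟨r, hr, fun x y => ?_⟩
  rw [Matrix.det_fin_two] at hM
  simp only [bracket, h1, h2]
  linear_combination r x * r y * ((homog x).1 * (homog y).2 - (homog y).1 * (homog x).2) * hM

/-- Each of the four points occurs once in the numerator and once in the denominator, so the factors
of `exists_bracket_mobius` cancel; being nonzero, they also respect the case of the value ∞. -/
theorem crossRatio_mobius (U : PSL(2, ℂ)) (x y z w : OnePoint ℂ) :
    crossRatio (mobius U x) (mobius U y) (mobius U z) (mobius U w) = crossRatio x y z w := by
  obtain ⟨r, hr, h⟩ := exists_bracket_mobius U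
  rw [crossRatio, crossRatio]
  simp only [h]
  by_cases h0 : bracket w x * bracket z y = 0
  · rw [if_pos h0, if_pos (by linear_combination r w * r x * r z * r y * h0)]
  · have := hr x
    have := hr y
    have := hr z
    have := hr w
    rw [if_neg h0, if_neg]
    · congr 1
      have h1 := left_ne_zero_of_mul h0
      have h2 := right_ne_zero_of_mul h0
      field_simp
    · have : r w * r x * bracket w x * (r z * r y * bracket z y) =
        (r w * r x * r z * r y) * (bracket w x * bracket z y) := by ring
      rw [this]
      positivity

/-! ### Three points determine a Moebius transformation -/

theorem eq_one_of_fixes_three {A : PSL(2, ℂ)} (h0 : mobius A ∞ = ∞)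
    (h1 : mobius A ((0 : ℂ) : OnePoint ℂ) = ((0 : ℂ) : OnePoint ℂ))
    (h2 : mobius A ((1 : ℂ) : OnePoint ℂ) = ((1 : ℂ) : OnePoint ℂ)) : A = 1 := by
  obtain ⟨M, hM, rfl⟩ := exists_toPSL A
  have hd : M.det ≠ 0 := by simp [hM]
  have h0 := (mobius_infty_eq_infty hd).mp h0
  have h1 := (mobius_coe_fixed hd 0).mp h1
  have h2 := (mobius_coe_fixed hd 1).mp h2
  have h1' : M 0 1 = 0 := by simpa using h1
  refine eq_one_of_fixes hd h0 h1' ?_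
  rw [h0, h1'] at h2; linear_combination -h2

/-- The matrix of the transformation that maps three points to `∞`, `0`, `1`. -/
def standardMatrix (a b c : OnePoint ℂ) : CMat :=
  !![(homog b).2 * bracket c a, -(homog b).1 * bracket c a;
    (homog a).2 * bracket c b, -(homog a).1 * bracket c b]

theorem det_standardMatrix {a b c : OnePoint ℂ} (hab : a ≠ b) (hac : a ≠ c) (hbc : b ≠ c) :
    (standardMatrix a b c).det ≠ 0 := by
  have hk0 : bracket c a ≠ 0 := fun h => hac (bracket_eq_zero.mp h).symm
  have hm0 : bracket c b ≠ 0 := fun h => hbc (bracket_eq_zero.mp h).symm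
  have hn0 : bracket a b ≠ 0 := fun h => hab (bracket_eq_zero.mp h)
  have : (standardMatrix a b c).det = -(bracket c a * bracket c b * bracket a b) := by
    rw [standardMatrix, Matrix.det_fin_two_of, bracket, bracket, bracket]; ring
  rw [this]
  exact neg_ne_zero.mpr (mul_ne_zero (mul_ne_zero hk0 hm0) hn0)

theorem mobius_standardMatrix {a b c : OnePoint ℂ} (hab : a ≠ b) (hac : a ≠ c) (hbc : b ≠ c) :
    mobius (toPSL (standardMatrix a b c)) a = ∞ ∧
      mobius (toPSL (standardMatrix a b c)) b = ((0 : ℂ) : OnePoint ℂ) ∧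
      mobius (toPSL (standardMatrix a b c)) c = ((1 : ℂ) : OnePoint ℂ) := by
  have hM := det_standardMatrix hab hac hbc
  refine ⟨?_, ?_, ?_⟩
  · obtain ⟨r, hr, h1, h2⟩ := exists_homog_mobius hM a
    apply bracket_eq_zero.mp
    rw [bracket, homog_infty, h1, h2]
    simp [standardMatrix]; right; ring
  · obtain ⟨r, hr, h1, h2⟩ := exists_homog_mobius hM b
    apply bracket_eq_zero.mp
    rw [bracket, homog_coe, h1, h2]
    simp [standardMatrix]; right; ring
  · obtain ⟨r, hr, h1, h2⟩ := exists_homog_mobius hM c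
    apply bracket_eq_zero.mp
    rw [bracket, homog_coe, h1, h2]
    simp [standardMatrix]
    rw [bracket, bracket]; ring

theorem exists_mobius_standard {a b c : OnePoint ℂ} (hab : a ≠ b) (hac : a ≠ c) (hbc : b ≠ c) :
    ∃ T : PSL(2, ℂ), mobius T a = ∞ ∧ mobius T b = ((0 : ℂ) : OnePoint ℂ) ∧
      mobius T c = ((1 : ℂ) : OnePoint ℂ) :=
  ⟨_, mobius_standardMatrix hab hac hbc⟩

/-! ### Continuity -/

theorem continuous_mobius_affine {M : CMat} (hM : M.det ≠ 0) (h : M 1 0 = 0) :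
    Continuous (mobius (toPSL M)) := by
  have hd : M 0 0 * M 1 1 - M 0 1 * M 1 0 ≠ 0 := by rwa [Matrix.det_fin_two] at hM
  rw [h, mul_zero, sub_zero] at hd
  have h0 := left_ne_zero_of_mul hd
  have h1 := right_ne_zero_of_mul hd
  let e : ℂ ≃ₜ ℂ := (Homeomorph.mulLeft₀ (M 0 0 / M 1 1) (div_ne_zero h0 h1)).trans
    (Homeomorph.addRight (M 0 1 / M 1 1))
  have : (mobius (toPSL M) : OnePoint ℂ → OnePoint ℂ) = e.onePointCongr := by
    funext x
    cases x with
    | infty => rw [(mobius_infty_eq_infty hM).mpr h]; rfl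
    | coe z =>
      change _ = ((e z : ℂ) : OnePoint ℂ)
      rw [mobius_coe_eq_coe hM, h]
      refine ⟨by simpa using h1, ?_⟩
      change _ = (M 0 0 / M 1 1 * z + M 0 1 / M 1 1) * _
      field_simp; ring
  rw [this]
  exact e.onePointCongr.continuous

theorem tendsto_coe_cobounded :
    Filter.Tendsto ((↑) : ℂ → OnePoint ℂ) (Bornology.cobounded ℂ) (nhds ∞) := by
  rw [Metric.cobounded_eq_cocompact, ← Filter.coclosedCompact_eq_cocompact]
  exact OnePoint.tendsto_coe_infty

theorem det_inversion : (!![0, 1; 1, 0] : CMat).det ≠ 0 := by simp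

theorem continuous_mobius_inversion : Continuous (mobius (toPSL !![0, 1; 1, 0])) := by
  have hinf : mobius (toPSL !![0, 1; 1, 0]) ∞ = ((0 : ℂ) : OnePoint ℂ) :=
    (mobius_infty_eq_coe det_inversion 0).mpr (by simp)
  have hzero : mobius (toPSL !![0, 1; 1, 0]) ((0 : ℂ) : OnePoint ℂ) = ∞ :=
    (mobius_coe_eq_infty det_inversion 0).mpr (by simp)
  have hcoe : ∀ z : ℂ, z ≠ 0 →
      mobius (toPSL !![0, 1; 1, 0]) (z : OnePoint ℂ) = ((z⁻¹ : ℂ) : OnePoint ℂ) := fun z hz =>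
    (mobius_coe_eq_coe det_inversion z _).mpr (by simp [hz])
  rw [continuous_iff_continuousAt]
  intro x
  cases x with
  | infty =>
    rw [OnePoint.continuousAt_infty', hinf, Filter.coclosedCompact_eq_cocompact,
      ← Metric.cobounded_eq_cocompact]
    refine Filter.Tendsto.congr' ?_
      ((OnePoint.continuous_coe.tendsto 0).comp Filter.tendsto_inv₀_cobounded)
    filter_upwards [Bornology.eventually_ne_cobounded (0 : ℂ)] with z hz
    exact (hcoe z hz).symm
  | coe z =>
    rw [OnePoint.continuousAt_coe]
    by_cases hz : z = 0
    · subst hz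
      rw [continuousAt_iff_punctured_nhds]
      simp only [Function.comp_apply, hzero]
      refine Filter.Tendsto.congr' ?_
        (tendsto_coe_cobounded.comp Filter.tendsto_inv₀_nhdsNE_zero)
      filter_upwards [self_mem_nhdsWithin] with z hz
      exact (hcoe z hz).symm
    · have : ContinuousAt (fun z : ℂ => ((z⁻¹ : ℂ) : OnePoint ℂ)) z :=
        OnePoint.continuous_coe.continuousAt.comp (continuousAt_inv₀ hz)
      refine this.congr ?_
      filter_upwards [isOpen_ne.mem_nhds hz] with w hw
      exact (hcoe w hw).symm

/-- A transformation that moves ∞ is an affine map, followed by the inversion, followed by an affine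
map. -/
theorem continuous_mobius (U : PSL(2, ℂ)) : Continuous (mobius U) := by
  obtain ⟨M, hM, rfl⟩ := exists_toPSL U
  have hd : M.det ≠ 0 := by simp [hM]
  by_cases h : M 1 0 = 0
  · exact continuous_mobius_affine hd h
  rw [Matrix.det_fin_two] at hM
  have h1 : (!![-1, M 0 0; 0, M 1 0] : CMat).det ≠ 0 := by simpa
  have h2 : (!![M 1 0, M 1 1; 0, 1] : CMat).det ≠ 0 := by simpa
  have e : M 0 1 = (M 1 0)⁻¹ * (-1 + M 0 0 * M 1 1) := by
    field_simp
    linear_combination -hM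
  have h3 : (!![0, 1; 1, 0] * !![M 1 0, M 1 1; 0, 1] : CMat).det ≠ 0 := by
    rw [Matrix.det_mul]; exact mul_ne_zero det_inversion h2
  have : M = (M 1 0)⁻¹ • (!![-1, M 0 0; 0, M 1 0] * (!![0, 1; 1, 0] * !![M 1 0, M 1 1; 0, 1])) := by
    ext i j
    fin_cases i <;> fin_cases j <;> simp [h, e]
    field_simp
  rw [this, toPSL_smul (by rw [Matrix.det_mul]; exact mul_ne_zero h1 h3) (inv_ne_zero h),
    toPSL_mul h1 h3,
    toPSL_mul det_inversion h2, map_mul, map_mul]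
  exact (continuous_mobius_affine h1 (by simp)).comp
    (continuous_mobius_inversion.comp (continuous_mobius_affine h2 (by simp)))

/-- A Moebius transformation as a homeomorphism of the sphere. -/
def mobiusHomeo (U : PSL(2, ℂ)) : OnePoint ℂ ≃ₜ OnePoint ℂ where
  toEquiv := mobius U
  continuous_toFun := continuous_mobius U
  continuous_invFun := by
    change Continuous ((mobius U)⁻¹ : Equiv.Perm (OnePoint ℂ))
    rw [← map_inv]
    exact continuous_mobius U⁻¹

/-! ### Images of circles -/

namespace SphereCircle

/-- The Hermitian form of a circle. -/
def quad (C : SphereCircle) (x y : ℂ) : ℝ :=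
  C.α * Complex.normSq x + 2 * (conj C.β * x * conj y).re + C.γ * Complex.normSq y

theorem mem_points_iff_quad (C : SphereCircle) (x : OnePoint ℂ) :
    x ∈ C.points ↔ C.quad (homog x).1 (homog x).2 = 0 := by
  cases x with
  | infty => simp [points, quad, homog_infty]
  | coe z =>
    simp only [points, quad, homog_coe, Set.mem_ofPred_eq, OnePoint.coe_ne_infty, false_and,
      false_or, map_one, mul_one]
    constructor
    · rintro ⟨w, hw, h⟩
      rwa [OnePoint.coe_injective hw]
    · intro h; exact ⟨z, rfl, h⟩

theorem two_mul_re (z : ℂ) : ((2 * z.re : ℝ) : ℂ) = z + conj z := (Complex.add_conj z).symm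

theorem ofReal_quad (C : SphereCircle) (x y : ℂ) :
    (C.quad x y : ℂ) = C.α * (conj x * x) + (conj C.β * x * conj y + C.β * conj x * y) +
      C.γ * (conj y * y) := by
  rw [quad, Complex.ofReal_add, Complex.ofReal_add, two_mul_re, Complex.ofReal_mul,
    Complex.ofReal_mul, Complex.normSq_eq_conj_mul_self, Complex.normSq_eq_conj_mul_self]
  simp

theorem quad_smul (C : SphereCircle) (r x y : ℂ) :
    C.quad (r * x) (r * y) = Complex.normSq r * C.quad x y := by
  apply Complex.ofReal_injective
  rw [Complex.ofReal_mul, ofReal_quad, ofReal_quad, Complex.normSq_eq_conj_mul_self]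
  simp only [map_mul]
  ring

theorem orthogonal_iff (C D : SphereCircle) : C.Orthogonal D ↔
    C.β * conj D.β + conj C.β * D.β = (C.α * D.γ + D.α * C.γ : ℂ) := by
  have h := two_mul_re (C.β * conj D.β)
  rw [map_mul, Complex.conj_conj] at h
  rw [Orthogonal, ← h]
  exact_mod_cast Iff.rfl

/-- The discriminant |β|² − αγ of the Hermitian form of a circle is invariant under unimodular
substitutions. -/
theorem nondeg_transform {a b c d β β' : ℂ} {α γ α' γ' : ℝ} (h : α * γ < Complex.normSq β)
    (hdet : a * d - b * c = 1)
    (hα : (α' : ℂ) = α * (conj d * d) - conj β * d * conj c - β * conj d * c + γ * (conj c * c))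
    (hβ : β' = -α * conj d * b + β * conj d * a + conj β * b * conj c - γ * conj c * a)
    (hγ : (γ' : ℂ) = α * (conj b * b) - conj β * b * conj a - β * conj b * a + γ * (conj a * a)) :
    α' * γ' < Complex.normSq β' := by
  have hdet' : conj a * conj d - conj b * conj c = 1 := by
    rw [← map_mul, ← map_mul, ← map_sub, hdet, map_one]
  have : Complex.normSq β' - α' * γ' = Complex.normSq β - α * γ := by
    apply Complex.ofReal_injective
    rw [Complex.ofReal_sub, Complex.ofReal_sub, Complex.ofReal_mul, Complex.ofReal_mul, hα, hγ,
      Complex.normSq_eq_conj_mul_self, Complex.normSq_eq_conj_mul_self, hβ]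
    simp only [map_add, map_sub, map_mul, map_neg, Complex.conj_conj, Complex.conj_ofReal]
    linear_combination (conj β * β - α * γ) * (conj a * conj d - conj b * conj c) * hdet +
      (conj β * β - α * γ) * hdet'
  linarith

/-- The Hermitian form is pulled back by the inverse matrix. The new α and γ are values of the old
form, hence real. -/
theorem exists_move (M : CMat) (hM : M.det = 1) (C : SphereCircle) : ∃ C' : SphereCircle,
    (C'.α : ℂ) = C.α * (conj (M 1 1) * M 1 1) - conj C.β * M 1 1 * conj (M 1 0) -
      C.β * conj (M 1 1) * M 1 0 + C.γ * (conj (M 1 0) * M 1 0) ∧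
    C'.β = -C.α * conj (M 1 1) * M 0 1 + C.β * conj (M 1 1) * M 0 0 +
      conj C.β * M 0 1 * conj (M 1 0) - C.γ * conj (M 1 0) * M 0 0 ∧
    (C'.γ : ℂ) = C.α * (conj (M 0 1) * M 0 1) - conj C.β * M 0 1 * conj (M 0 0) -
      C.β * conj (M 0 1) * M 0 0 + C.γ * (conj (M 0 0) * M 0 0) := by
  rw [Matrix.det_fin_two] at hM
  have key : ∀ x y : ℂ, ((C.quad x (-y) : ℝ) : ℂ) = C.α * (conj x * x) - conj C.β * x * conj y -
      C.β * conj x * y + C.γ * (conj y * y) := by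
    intro x y
    rw [ofReal_quad]
    simp only [map_neg]; ring
  exact ⟨⟨C.quad (M 1 1) (-M 1 0), _, C.quad (M 0 1) (-M 0 0),
    nondeg_transform C.nondeg hM (key _ _) rfl (key _ _)⟩, key _ _, rfl, key _ _⟩

/-- The image of a circle under a matrix of determinant one. -/
def move (M : CMat) (hM : M.det = 1) (C : SphereCircle) : SphereCircle :=
  (exists_move M hM C).choose

theorem quad_move (M : CMat) (hM : M.det = 1) (C : SphereCircle) (x y : ℂ) :
    (C.move M hM).quad (M 0 0 * x + M 0 1 * y) (M 1 0 * x + M 1 1 * y) = C.quad x y := by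
  obtain ⟨h1, h2, h3⟩ := (exists_move M hM C).choose_spec
  change ((C.move M hM).α : ℂ) = _ at h1
  change (C.move M hM).β = _ at h2
  change ((C.move M hM).γ : ℂ) = _ at h3
  rw [Matrix.det_fin_two] at hM
  have hM' := congrArg conj hM
  simp only [map_sub, map_mul, map_one] at hM'
  apply Complex.ofReal_injective
  rw [ofReal_quad, ofReal_quad, h1, h2, h3]
  simp only [map_add, map_sub, map_mul, map_neg, Complex.conj_conj, Complex.conj_ofReal]
  linear_combination (C.α * (conj x * x) + (conj C.β * x * conj y + C.β * conj x * y) +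
      C.γ * (conj y * y)) * ((conj (M 0 0) * conj (M 1 1) - conj (M 0 1) * conj (M 1 0)) * hM + hM')

/-- Orthogonality is the vanishing of the polarized discriminant, which a substitution multiplies by
|det|². -/
theorem orthogonal_move {M : CMat} {hM : M.det = 1} {C D : SphereCircle} (h : C.Orthogonal D) :
    (C.move M hM).Orthogonal (D.move M hM) := by
  obtain ⟨h1, h2, h3⟩ := (exists_move M hM C).choose_spec
  change ((C.move M hM).α : ℂ) = _ at h1
  change (C.move M hM).β = _ at h2
  change ((C.move M hM).γ : ℂ) = _ at h3
  obtain ⟨k1, k2, k3⟩ := (exists_move M hM D).choose_spec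
  change ((D.move M hM).α : ℂ) = _ at k1
  change (D.move M hM).β = _ at k2
  change ((D.move M hM).γ : ℂ) = _ at k3
  rw [orthogonal_iff] at h ⊢
  rw [h1, h2, h3, k1, k2, k3]
  simp only [map_add, map_sub, map_mul, map_neg, Complex.conj_conj, Complex.conj_ofReal]
  linear_combination (M 0 0 * M 1 1 - M 0 1 * M 1 0) * (conj (M 0 0) * conj (M 1 1) -
    conj (M 0 1) * conj (M 1 0)) * h

/-- Images of circles under Moebius transformations. -/
theorem exists_image (U : PSL(2, ℂ)) : ∃ f : SphereCircle → SphereCircle,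
    (∀ C x, mobius U x ∈ (f C).points ↔ x ∈ C.points) ∧
    ∀ C D : SphereCircle, C.Orthogonal D → (f C).Orthogonal (f D) := by
  obtain ⟨M, hM, rfl⟩ := exists_toPSL U
  refine ⟨fun C => C.move M hM, fun C x => ?_, fun C D h => orthogonal_move h⟩
  obtain ⟨r, hr, h1, h2⟩ := exists_homog_mobius (M := M) (by simp [hM]) x
  rw [mem_points_iff_quad, mem_points_iff_quad, h1, h2, quad_smul, quad_move, mul_eq_zero]
  simp [hr]

end SphereCircle

/-! ### Conjugation -/

theorem mobius_conj (U A : PSL(2, ℂ)) (x : OnePoint ℂ) :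
    mobius (U * A * U⁻¹) (mobius U x) = mobius U (mobius A x) := by
  simp [map_mul]

theorem mobius_conj_fixed (U A : PSL(2, ℂ)) (x : OnePoint ℂ) :
    mobius (U * A * U⁻¹) (mobius U x) = mobius U x ↔ mobius A x = x := by
  rw [mobius_conj, (mobius U).injective.eq_iff]

theorem forall_mobius (U : PSL(2, ℂ)) {p : OnePoint ℂ → Prop} :
    (∀ x, p x) ↔ ∀ x, p (mobius U x) :=
  (mobius U).surjective.forall

theorem isParabolic_conj (U : PSL(2, ℂ)) {A : PSL(2, ℂ)} (h : IsParabolic A) :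
    IsParabolic (U * A * U⁻¹) := by
  obtain ⟨z, hz, huniq⟩ := h
  refine ⟨mobius U z, (mobius_conj_fixed U A z).mpr hz, (forall_mobius U).mpr fun x hx => ?_⟩
  rw [huniq x ((mobius_conj_fixed U A x).mp hx)]

theorem orderOf_conj' (U A : PSL(2, ℂ)) : orderOf (U * A * U⁻¹) = orderOf A :=
  (MulAut.conj U).orderOf_eq A

theorem isOfFinOrder_conj (U : PSL(2, ℂ)) {A : PSL(2, ℂ)} :
    IsOfFinOrder (U * A * U⁻¹) ↔ IsOfFinOrder A := by
  rw [← orderOf_ne_zero_iff, ← orderOf_ne_zero_iff, orderOf_conj']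

theorem hasOrder_conj (U : PSL(2, ℂ)) {A : PSL(2, ℂ)} {n : ℕ∞} (h : HasOrder A n) :
    HasOrder (U * A * U⁻¹) n := by
  rcases h with ⟨h1, h2⟩ | ⟨h1, h2, h3⟩
  · exact .inl ⟨h1, isParabolic_conj U h2⟩
  · exact .inr ⟨h1, (isOfFinOrder_conj U).mpr h2, by rwa [orderOf_conj']⟩

theorem isConjToScaling_conj (U : PSL(2, ℂ)) {A : PSL(2, ℂ)} {c : ℂ} :
    IsConjToScaling (U * A * U⁻¹) c ↔ IsConjToScaling A c := by
  constructor
  · rintro ⟨S, hS⟩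
    refine ⟨S * U, ?_⟩
    rwa [show S * U * A * (S * U)⁻¹ = S * (U * A * U⁻¹) * S⁻¹ by group]
  · rintro ⟨S, hS⟩
    refine ⟨S * U⁻¹, ?_⟩
    rwa [show S * U⁻¹ * (U * A * U⁻¹) * (S * U⁻¹)⁻¹ = S * A * S⁻¹ by group]

theorem isElliptic_conj (U : PSL(2, ℂ)) {A : PSL(2, ℂ)} :
    IsElliptic (U * A * U⁻¹) ↔ IsElliptic A := by
  simp only [IsElliptic, isConjToScaling_conj]

theorem isGeometric_conj (U : PSL(2, ℂ)) {A : PSL(2, ℂ)} :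
    IsGeometric (U * A * U⁻¹) ↔ IsGeometric A := by
  simp only [IsGeometric, isConjToScaling_conj, isOfFinOrder_conj, orderOf_conj']

theorem mem_map_conj (U : PSL(2, ℂ)) {Γ : Subgroup PSL(2, ℂ)} {A : PSL(2, ℂ)} :
    U * A * U⁻¹ ∈ Γ.map (MulAut.conj U).toMonoidHom ↔ A ∈ Γ :=
  Subgroup.mem_map_iff_mem (f := (MulAut.conj U).toMonoidHom) (MulAut.conj U).injective

theorem isPrimitive_conj (U : PSL(2, ℂ)) {Γ : Subgroup PSL(2, ℂ)} {A : PSL(2, ℂ)}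
    (h : IsPrimitive Γ A) :
    IsPrimitive (Γ.map (MulAut.conj U).toMonoidHom) (U * A * U⁻¹) := by
  refine ⟨(mem_map_conj U).mpr h.1, ?_⟩
  rintro _ ⟨B, hB, rfl⟩ n hn
  change (U * B * U⁻¹) ^ n = _ at hn
  change Subgroup.zpowers (U * B * U⁻¹) = _
  have hn' : B ^ n = A := by
    rw [conj_zpow] at hn
    exact mul_left_cancel (mul_right_cancel hn)
  have key := h.2 B hB n hn'
  have hz : ∀ C : PSL(2, ℂ), Subgroup.zpowers (U * C * U⁻¹) =
      (Subgroup.zpowers C).map (MulAut.conj U).toMonoidHom := fun C => by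
    rw [MonoidHom.map_zpowers]; rfl
  rw [hz, hz, key]

theorem mem_discontinuitySet_conj (U : PSL(2, ℂ)) {Γ : Subgroup PSL(2, ℂ)} {x : OnePoint ℂ}
    (h : x ∈ discontinuitySet Γ) :
    mobius U x ∈ discontinuitySet (Γ.map (MulAut.conj U).toMonoidHom) := by
  obtain ⟨V, hV, hx, hfin⟩ := h
  refine ⟨mobius U '' V, (mobiusHomeo U).isOpenMap V hV, ⟨x, hx, rfl⟩, ?_⟩
  refine (hfin.image (MulAut.conj U)).subset ?_
  rintro _ ⟨⟨g, hg, rfl⟩, y, ⟨_, ⟨z, hz, rfl⟩, rfl⟩, ⟨w, hw, hzw⟩⟩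
  refine ⟨g, ⟨hg, w, ⟨z, hz, ?_⟩, hw⟩, rfl⟩
  change mobius U w = mobius (U * g * U⁻¹) (mobius U z) at hzw
  rw [mobius_conj] at hzw
  exact ((mobius U).injective hzw).symm

theorem map_conj_inv (U : PSL(2, ℂ)) (Γ : Subgroup PSL(2, ℂ)) :
    (Γ.map (MulAut.conj U).toMonoidHom).map (MulAut.conj U⁻¹).toMonoidHom = Γ := by
  rw [Subgroup.map_map]
  convert Subgroup.map_id Γ using 1
  congr 1
  ext x; simp

theorem mem_discontinuitySet_conj_iff (U : PSL(2, ℂ)) {Γ : Subgroup PSL(2, ℂ)} {x : OnePoint ℂ} :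
    mobius U x ∈ discontinuitySet (Γ.map (MulAut.conj U).toMonoidHom) ↔
      x ∈ discontinuitySet Γ := by
  refine ⟨fun h => ?_, mem_discontinuitySet_conj U⟩
  have := mem_discontinuitySet_conj U⁻¹ h
  rw [map_conj_inv] at this
  simpa [map_inv] using this

theorem isTriangleGroup_conj (U : PSL(2, ℂ)) {Γ : Subgroup PSL(2, ℂ)} {ν : Fin 3 → ℕ∞}
    (h : IsTriangleGroup Γ ν) : IsTriangleGroup (Γ.map (MulAut.conj U).toMonoidHom) ν := by
  obtain ⟨⟨x, hx⟩, ⟨X, Y, hΓ, h1, h2, h3⟩, v, S, T, hv, hS, hT⟩ := h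
  refine ⟨⟨_, mem_discontinuitySet_conj U hx⟩, ⟨U * X * U⁻¹, U * Y * U⁻¹, ?_, hasOrder_conj U h1,
    hasOrder_conj U h2, ?_⟩, v, S, U * T, hv, hS, ?_⟩
  · rw [hΓ, MonoidHom.map_closure, Set.image_pair]; rfl
  · rw [show U * X * U⁻¹ * (U * Y * U⁻¹) = U * (X * Y) * U⁻¹ by group]
    exact hasOrder_conj U h3
  · rw [hT, Subgroup.map_map]
    congr 1
    ext x; simp [mul_assoc]

theorem mem_disc_mobius (U : PSL(2, ℂ)) {a b c z : OnePoint ℂ} :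
    mobius U z ∈ disc (mobius U a) (mobius U b) (mobius U c) ↔ z ∈ disc a b c := by
  simp only [disc, Set.mem_ofPred_eq, crossRatio_mobius]

theorem mem_closure_disc_mobius (U : PSL(2, ℂ)) {a b c z : OnePoint ℂ} :
    mobius U z ∈ closure (disc (mobius U a) (mobius U b) (mobius U c)) ↔
      z ∈ closure (disc a b c) := by
  have : disc (mobius U a) (mobius U b) (mobius U c) = mobiusHomeo U '' disc a b c := by
    ext x
    obtain ⟨z, rfl⟩ := (mobius U).surjective x
    rw [mem_disc_mobius]
    exact ((mobiusHomeo U).injective.mem_set_image).symm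
  rw [this, ← Homeomorph.image_closure]
  exact (mobiusHomeo U).injective.mem_set_image

theorem wellOrdered_mobius (U : PSL(2, ℂ)) {a b z w : OnePoint ℂ} :
    WellOrdered (mobius U a) (mobius U b) (mobius U z) (mobius U w) ↔ WellOrdered a b z w := by
  simp only [WellOrdered, crossRatio_mobius, ne_eq, (mobius U).injective.eq_iff]

/-- Conjugates of canonical generators are canonical generators for the image parameters. -/
theorem IsCanonicalPair.conj (U : PSL(2, ℂ)) {a b c : OnePoint ℂ} {ν : Fin 3 → ℕ∞}
    {A B : PSL(2, ℂ)} (h : IsCanonicalPair a b c ν A B) :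
    IsCanonicalPair (mobius U a) (mobius U b) (mobius U c) ν (U * A * U⁻¹) (U * B * U⁻¹) := by
  obtain ⟨Γ, hΓ, Λ, L, L', ⟨h1, h2, h3⟩, ⟨h4, h5, h6⟩, ⟨h7, h8, h9⟩, hlim, hgen, ⟨o1, o2, o3⟩,
    ⟨f1, f2, f3⟩, ⟨z₁, ⟨hz₁, hz₁'⟩, z₂, ⟨hz₂, hz₂'⟩, k1, k2, hwo⟩, ⟨p1, p2⟩, g1, g2⟩ := h
  obtain ⟨f, hf, hort⟩ := SphereCircle.exists_image U
  have hAB : U * A * U⁻¹ * (U * B * U⁻¹) = U * (A * B) * U⁻¹ := by group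
  refine ⟨_, isTriangleGroup_conj U hΓ, f Λ, f L, f L', ⟨(hf _ _).mpr h1, (hf _ _).mpr h2,
    (hf _ _).mpr h3⟩, ⟨hort _ _ h4, (hf _ _).mpr h5, (hf _ _).mpr h6⟩, ⟨hort _ _ h7,
    (hf _ _).mpr h8, (hf _ _).mpr h9⟩, ?_, ?_, ⟨hasOrder_conj U o1, hasOrder_conj U o2, ?_⟩,
    ⟨(forall_mobius U).mpr fun x hx => ?_, (forall_mobius U).mpr fun x hx => ?_,
      (forall_mobius U).mpr fun x hx => ?_⟩,
    ⟨mobius U z₁, ⟨(hf _ _).mpr hz₁, (mem_closure_disc_mobius U).mpr hz₁'⟩, mobius U z₂,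
      ⟨(hf _ _).mpr hz₂, (mem_closure_disc_mobius U).mpr hz₂'⟩, (mobius_conj_fixed U A _).mpr k1,
      (mobius_conj_fixed U B _).mpr k2, (wellOrdered_mobius U).mpr hwo⟩,
    ⟨isPrimitive_conj U p1, isPrimitive_conj U p2⟩, ?_, ?_⟩
  · ext x
    obtain ⟨y, rfl⟩ := (mobius U).surjective x
    rw [hf, ← hlim, limitSet, limitSet, Set.mem_compl_iff, Set.mem_compl_iff,
      mem_discontinuitySet_conj_iff]
  · rw [hgen, MonoidHom.map_closure, Set.image_pair]; rfl
  · rw [hAB]; exact hasOrder_conj U o3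
  · exact (hf _ _).mpr (f1 x ((mobius_conj_fixed U A x).mp hx))
  · exact (hf _ _).mpr (f2 x ((mobius_conj_fixed U B x).mp hx))
  · rw [hAB] at hx
    exact (hf _ _).mpr (f3 x ((mobius_conj_fixed U _ x).mp hx))
  · rw [isElliptic_conj, isGeometric_conj]; exact g1
  · rw [isElliptic_conj, isGeometric_conj]; exact g2

/-! ### Traces and types of elements -/

/-- The quadratic equation for the fixed points has discriminant tr² − 4. -/
theorem exists_fixed_pair {M : CMat} (hM : M.det = 1) (ht : M.trace ^ 2 ≠ 4) :
    ∃ z w : OnePoint ℂ, z ≠ w ∧ mobius (toPSL M) z = z ∧ mobius (toPSL M) w = w := by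
  have hd : M.det ≠ 0 := by simp [hM]
  rw [Matrix.det_fin_two] at hM
  rw [Matrix.trace_fin_two] at ht
  by_cases h : M 1 0 = 0
  · have hne : M 1 1 - M 0 0 ≠ 0 := by
      intro h0
      apply ht
      rw [h] at hM
      linear_combination (M 1 1 - M 0 0) * h0 + 4 * hM
    refine ⟨∞, ((M 0 1 / (M 1 1 - M 0 0) : ℂ) : OnePoint ℂ), OnePoint.infty_ne_coe _,
      (mobius_infty_eq_infty hd).mpr h, (mobius_coe_fixed hd _).mpr ?_⟩
    rw [h]
    field_simp
    ring
  · obtain ⟨s, hs⟩ := IsAlgClosed.exists_pow_nat_eq ((M 0 0 + M 1 1) ^ 2 - 4) two_pos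
    have hs0 : s ≠ 0 := by
      rintro rfl
      apply ht
      linear_combination -hs
    have key : ∀ r : ℂ, r ^ 2 = s ^ 2 → mobius (toPSL M)
        (((M 0 0 - M 1 1 + r) / (2 * M 1 0) : ℂ) : OnePoint ℂ) =
        (((M 0 0 - M 1 1 + r) / (2 * M 1 0) : ℂ) : OnePoint ℂ) := by
      intro r hr
      rw [mobius_coe_fixed hd]
      field_simp
      linear_combination hr + hs + 4 * hM
    refine ⟨_, _, ?_, key s rfl, key (-s) (by ring)⟩
    intro h1
    have h2 := OnePoint.coe_injective h1
    field_simp at h2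
    apply hs0
    linear_combination h2 / 2

theorem exists_conj_matrix {M : CMat} (hM : M.det = 1) (S : PSL(2, ℂ)) :
    ∃ P : CMat, P.det = 1 ∧ P.trace = M.trace ∧ S * toPSL M * S⁻¹ = toPSL P := by
  obtain ⟨N, hN, rfl⟩ := exists_toPSL S
  have hd : M.det ≠ 0 := by simp [hM]
  have hN' : N.det ≠ 0 := by simp [hN]
  have hA : N.adjugate.det = 1 := by simp [Matrix.det_adjugate, hN]
  refine ⟨N * M * N.adjugate, by simp [hN, hM, hA], ?_, ?_⟩
  · rw [Matrix.mul_assoc, Matrix.trace_mul_comm, Matrix.mul_assoc, Matrix.adjugate_mul, hN,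
      one_smul, mul_one]
  · rw [toPSL_inv hN', toPSL_mul (by simp [hN, hM]) (by simp [hA]), toPSL_mul hN' hd]

/-- The scaling factor is the quotient of the eigenvalues, whose product is 1. -/
theorem IsConjToScaling.ne_zero_and_trace {M : CMat} (hM : M.det = 1) {c : ℂ}
    (h : IsConjToScaling (toPSL M) c) : c ≠ 0 ∧ M.trace ^ 2 = 2 + c + c⁻¹ := by
  obtain ⟨S, hS⟩ := h
  obtain ⟨P, hP, htr, hPe⟩ := exists_conj_matrix hM S
  rw [hPe] at hS
  have hd : P.det ≠ 0 := by simp [hP]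
  have h0 := fun z => (mobius_coe_eq_coe hd z _).mp (hS z)
  have h01 : P 0 1 = 0 := by simpa using (h0 0).2
  have h10 : P 1 0 = 0 := by
    by_contra h10
    apply (h0 (-P 1 1 / P 1 0)).1
    field_simp
    ring
  have h00 : P 0 0 = c * P 1 1 := by simpa [h01, h10] using (h0 1).2
  rw [Matrix.det_fin_two, h01, h00] at hP
  have hc : c ≠ 0 := by rintro rfl; simp at hP
  refine ⟨hc, ?_⟩
  rw [← htr, Matrix.trace_fin_two, h00]
  field_simp
  linear_combination (c + 1) ^ 2 * hP

theorem IsConjToScaling.pow {A : PSL(2, ℂ)} {c : ℂ} (h : IsConjToScaling A c) (k : ℕ) :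
    IsConjToScaling (A ^ k) (c ^ k) := by
  obtain ⟨S, hS⟩ := h
  refine ⟨S, fun z => ?_⟩
  rw [← conj_pow]
  induction k generalizing z with
  | zero => simp
  | succ k ih => rw [pow_succ, map_mul, Equiv.Perm.mul_apply, hS, ih, pow_succ, mul_assoc]

theorem IsConjToScaling.eq_one_iff {A : PSL(2, ℂ)} {c : ℂ} (h : IsConjToScaling A c) :
    A = 1 ↔ c = 1 := by
  obtain ⟨S, hS⟩ := h
  constructor
  · rintro rfl
    have := hS 1
    simp only [mul_one, mul_inv_cancel, map_one, Equiv.Perm.one_apply] at this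
    exact (OnePoint.coe_injective this).symm
  · rintro rfl
    have h1 : S * A * S⁻¹ = 1 := by
      apply mobius_injective
      rw [map_one]
      ext z
      cases z with
      | infty =>
        by_contra hne
        obtain ⟨w, hw⟩ := OnePoint.ne_infty_iff_exists.mp
          (show mobius (S * A * S⁻¹) ∞ ≠ ∞ from fun h => hne (by rw [h]; rfl))
        have := (hS w).symm
        rw [one_mul, hw] at this
        exact OnePoint.coe_ne_infty w (hw.trans ((mobius (S * A * S⁻¹)).injective this.symm))
      | coe z => rw [hS, one_mul]; rfl
    have : A = S⁻¹ * (S * A * S⁻¹) * S := by group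
    rw [this, h1]; group

theorem IsConjToScaling.orderOf_eq {A : PSL(2, ℂ)} {c : ℂ} (h : IsConjToScaling A c) :
    orderOf A = orderOf c :=
  orderOf_eq_orderOf_iff.mpr fun k => (h.pow k).eq_one_iff

/-- Two fixed points are moved to ∞ and 0. -/
theorem exists_isConjToScaling {M : CMat} (hM : M.det = 1) (ht : M.trace ^ 2 ≠ 4) :
    ∃ c, IsConjToScaling (toPSL M) c := by
  obtain ⟨z, w, hzw, hz, hw⟩ := exists_fixed_pair hM ht
  obtain ⟨y, hy⟩ : ∃ y : OnePoint ℂ, y ≠ z ∧ y ≠ w := by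
    by_contra! hcon
    have : (Set.univ : Set (OnePoint ℂ)) ⊆ {z, w} := fun y _ => by
      by_cases hy : y = z
      · exact .inl hy
      · exact .inr (hcon y hy)
    exact Set.infinite_univ (Set.Finite.subset (by simp) this)
  obtain ⟨T, hT1, hT2, -⟩ := exists_mobius_standard hzw hy.1.symm hy.2.symm
  obtain ⟨P, hP, htr, hPe⟩ := exists_conj_matrix hM T
  have hd : P.det ≠ 0 := by simp [hP]
  have h1 : mobius (toPSL P) ∞ = ∞ := by
    rw [← hPe, ← hT1, mobius_conj_fixed]; exact hz
  have h2 : mobius (toPSL P) ((0 : ℂ) : OnePoint ℂ) = ((0 : ℂ) : OnePoint ℂ) := by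
    rw [← hPe, ← hT2, mobius_conj_fixed]; exact hw
  have h10 := (mobius_infty_eq_infty hd).mp h1
  have h01 : P 0 1 = 0 := by simpa using (mobius_coe_fixed hd 0).mp h2
  have h11 : P 1 1 ≠ 0 := by
    rintro h; rw [Matrix.det_fin_two, h01, h] at hP; simp at hP
  refine ⟨P 0 0 / P 1 1, T, fun x => ?_⟩
  rw [hPe, mobius_coe_eq_coe hd, h10, h01]
  refine ⟨by simpa using h11, ?_⟩
  field_simp
  ring

theorem isConjToScaling_of_trace {M : CMat} (hM : M.det = 1) {c : ℂ} (hc : c ≠ 0) (hc1 : c ≠ 1)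
    (ht : M.trace ^ 2 = 2 + c + c⁻¹) :
    IsConjToScaling (toPSL M) c ∨ IsConjToScaling (toPSL M) c⁻¹ := by
  have h4 : M.trace ^ 2 ≠ 4 := by
    intro h4
    rw [h4] at ht
    field_simp at ht
    have : (c - 1) ^ 2 = 0 := by linear_combination -ht
    exact hc1 (by linear_combination pow_eq_zero_iff two_ne_zero |>.mp this)
  obtain ⟨d, hd⟩ := exists_isConjToScaling hM h4
  obtain ⟨hd0, hdt⟩ := hd.ne_zero_and_trace hM
  rw [ht] at hdt
  have : (d - c) * (d - c⁻¹) = 0 := by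
    field_simp at hdt ⊢
    linear_combination -hdt
  rcases mul_eq_zero.mp this with h | h
  · left; rwa [← sub_eq_zero.mp h]
  · right; rwa [← sub_eq_zero.mp h]

theorem IsParabolic.trace_sq {M : CMat} (hM : M.det = 1) (h : IsParabolic (toPSL M)) :
    M.trace ^ 2 = 4 := by
  by_contra ht
  obtain ⟨z, w, hzw, hz, hw⟩ := exists_fixed_pair hM ht
  exact hzw (h.unique hz hw)

theorem isParabolic_of_trace_sq {M : CMat} (hM : M.det = 1) (ht : M.trace ^ 2 = 4)
    (h1 : toPSL M ≠ 1) : IsParabolic (toPSL M) := by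
  have hd : M.det ≠ 0 := by simp [hM]
  rw [Matrix.det_fin_two] at hM
  rw [Matrix.trace_fin_two] at ht
  have hdisc : (M 0 0 - M 1 1) ^ 2 + 4 * M 0 1 * M 1 0 = 0 := by linear_combination ht - 4 * hM
  by_cases h : M 1 0 = 0
  · have heq : M 0 0 = M 1 1 := by
      rw [h, mul_zero, add_zero] at hdisc
      exact sub_eq_zero.mp (pow_eq_zero_iff two_ne_zero |>.mp hdisc)
    refine ⟨∞, (mobius_infty_eq_infty hd).mpr h, fun z hz => ?_⟩
    cases z with
    | infty => rfl
    | coe z =>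
      exfalso
      have := (mobius_coe_fixed hd z).mp hz
      rw [h, heq] at this
      exact h1 (eq_one_of_fixes hd h (by linear_combination -this) heq)
  · refine ⟨((M 0 0 - M 1 1) / (2 * M 1 0) : ℂ), (mobius_coe_fixed hd _).mpr ?_, fun z hz => ?_⟩
    · field_simp
      linear_combination -hdisc
    · cases z with
      | infty => exact absurd ((mobius_infty_eq_infty hd).mp hz) h
      | coe z =>
        have h2 := (mobius_coe_fixed hd z).mp hz
        congr 1
        have h3 : (2 * M 1 0 * z - (M 0 0 - M 1 1)) ^ 2 = 0 := by
          linear_combination 4 * M 1 0 * h2 + hdisc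
        have h4 := pow_eq_zero_iff two_ne_zero |>.mp h3
        field_simp
        linear_combination h4

theorem two_add_two_cos (x : ℝ) : 2 + 2 * Real.cos (2 * x) = 4 * Real.cos x ^ 2 := by
  rw [Real.cos_two_mul]; ring

theorem two_add_exp (x : ℝ) : 2 + Complex.exp (2 * x * Complex.I) +
    (Complex.exp (2 * x * Complex.I))⁻¹ = ((4 * Real.cos x ^ 2 : ℝ) : ℂ) := by
  rw [← two_add_two_cos, ← Complex.exp_neg]
  push_cast
  rw [Complex.two_cos]
  ring_nf

theorem trace_map_ofReal (M : RMat) : (M.map Complex.ofReal).trace = (M.trace : ℂ) := by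
  simp [Matrix.trace_fin_two]

theorem exists_angle {c : ℂ} {n : ℕ} (hn : 2 ≤ n) (h : orderOf c = n) :
    ∃ k : ℕ, 1 ≤ k ∧ k < n ∧ c = Complex.exp (2 * (Real.pi * (k / n) : ℝ) * Complex.I) := by
  have hp : IsPrimitiveRoot c n := h ▸ IsPrimitiveRoot.orderOf c
  obtain ⟨k, hk, hco, rfl⟩ := (Complex.isPrimitiveRoot_iff c n (by omega)).mp hp
  refine ⟨k, ?_, hk, ?_⟩
  · rcases Nat.eq_zero_or_pos k with rfl | h
    · simp at hco; omega
    · exact h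
  · congr 1; push_cast; ring

theorem recip_eq {n : ℕ∞} (h : n ≠ ⊤) : recip n = 1 / (n.toNat : ℝ) := if_neg h

theorem orderOf_eq_toNat {A : PSL(2, ℂ)} {n : ℕ∞} (h : (orderOf A : ℕ∞) = n) :
    orderOf A = n.toNat := by rw [← h]; simp

theorem toPSL_pow {M : CMat} (hM : M.det = 1) (k : ℕ) : toPSL M ^ k = toPSL (M ^ k) := by
  induction k with
  | zero => simp [toPSL_one]
  | succ k ih => rw [pow_succ, pow_succ, ih, toPSL_mul (by simp [hM]) (by simp [hM])]

/-- If tr² = 4, then eM = 1 + N with e = ±1 and N² = 0; the powers 1 + kN with k > 0 are scalar only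
for N = 0. -/
theorem trace_sq_ne_four {M : CMat} (hM : M.det = 1) (hfin : IsOfFinOrder (toPSL M))
    (h1 : toPSL M ≠ 1) : M.trace ^ 2 ≠ 4 := by
  intro ht
  apply h1
  obtain ⟨k, hk, hpow⟩ := isOfFinOrder_iff_pow_eq_one.mp hfin
  have hd : M.det ≠ 0 := by simp [hM]
  set e := M.trace / 2 with he
  have hee : e * e = 1 := by rw [he]; linear_combination ht / 4
  have he0 : e ≠ 0 := by rintro h; simp [h] at hee
  set N : CMat := e • M - 1 with hN
  have hNN : N * N = 0 := by
    have hM' := hM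
    rw [Matrix.det_fin_two] at hM'
    have hch : M * M = (2 * e) • M - 1 := by
      have : 2 * e = M.trace := by rw [he]; ring
      rw [this, Matrix.trace_fin_two]
      ext i j
      fin_cases i <;> fin_cases j <;> simp [Matrix.mul_apply] <;>
        first
        | linear_combination -hM'
        | ring
    rw [hN, sub_mul, mul_sub, mul_one, one_mul, Matrix.smul_mul, Matrix.mul_smul, smul_smul, hee,
      one_smul, hch]
    module
  have hp : ∀ k : ℕ, (e • M) ^ k = 1 + (k : ℂ) • N := by
    intro k
    induction k with
    | zero => simp
    | succ k ih =>
      rw [pow_succ, ih, show e • M = 1 + N by rw [hN]; abel, add_mul, one_mul, Matrix.smul_mul,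
        mul_add, mul_one, hNN, add_zero]
      push_cast
      module
  have hdet : (e • M).det = 1 := by
    rw [Matrix.det_smul, hM, Fintype.card_fin, sq, hee, mul_one]
  rw [← toPSL_smul hd he0, toPSL_pow hdet, hp, ← toPSL_one] at hpow
  obtain ⟨c, -, hc⟩ := eq_smul_of_toPSL_eq (by simp) (by rw [← hp, Matrix.det_pow, hdet]; simp)
    hpow.symm
  have hk0 : (k : ℂ) ≠ 0 := by exact_mod_cast hk.ne'
  have e01 := congrFun (congrFun hc 0) 1
  have e10 := congrFun (congrFun hc 1) 0
  have e00 := congrFun (congrFun hc 0) 0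
  have e11 := congrFun (congrFun hc 1) 1
  simp [hN, hk0, he0] at e01 e10 e00 e11
  refine eq_one_of_fixes hd e10 e01 ?_
  have : (k * e) * (M 0 0 - M 1 1) = 0 := by linear_combination e00 - e11
  exact sub_eq_zero.mp ((mul_eq_zero.mp this).resolve_left (mul_ne_zero hk0 he0))

theorem orderOf_ne_one {A : PSL(2, ℂ)} {n : ℕ∞} (hn : 2 ≤ n) (h : (orderOf A : ℕ∞) = n) :
    A ≠ 1 := by
  rintro rfl
  rw [orderOf_one] at h
  rw [← h] at hn
  exact absurd hn (by decide)

theorem det_map_eq_one {M : RMat} (hM : M.det = 1) : (M.map Complex.ofReal).det = 1 := by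
  rw [det_map_ofReal, hM, Complex.ofReal_one]

theorem HasOrder.exists_scaling {M : RMat} (hM : M.det = 1) {n : ℕ∞} (hn : 2 ≤ n) (hnt : n ≠ ⊤)
    (h : HasOrder (realPSL M) n) : ∃ k : ℕ, 1 ≤ k ∧ k < n.toNat ∧
      IsConjToScaling (realPSL M)
        (Complex.exp (2 * (Real.pi * (k / n.toNat) : ℝ) * Complex.I)) ∧
      M.trace ^ 2 = 4 * Real.cos (Real.pi * (k / n.toNat)) ^ 2 := by
  rcases h with ⟨h, -⟩ | ⟨-, hfin, hord⟩
  · exact absurd h hnt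
  have hM' := det_map_eq_one hM
  obtain ⟨c, hc⟩ := exists_isConjToScaling hM' (trace_sq_ne_four hM' hfin (orderOf_ne_one hn hord))
  have ho := orderOf_eq_toNat hord
  rw [realPSL, hc.orderOf_eq] at ho
  obtain ⟨k, hk1, hk2, rfl⟩ := exists_angle (two_le_toNat hn hnt) ho
  refine ⟨k, hk1, hk2, hc, ?_⟩
  have := (hc.ne_zero_and_trace hM').2
  rw [two_add_exp, trace_map_ofReal] at this
  exact_mod_cast this

/-- The trace of an element of order `n` of `PSL(2, ℝ)`. -/
theorem HasOrder.trace_sq_le {M : RMat} (hM : M.det = 1) {n : ℕ∞} (hn : 2 ≤ n)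
    (h : HasOrder (realPSL M) n) : M.trace ^ 2 ≤ 4 * cosPi n ^ 2 := by
  by_cases hnt : n = ⊤
  · rcases h with ⟨-, hp⟩ | ⟨h, -⟩
    · have := hp.trace_sq (det_map_eq_one hM)
      rw [trace_map_ofReal] at this
      have h4 : M.trace ^ 2 = 4 := by exact_mod_cast this
      rw [hnt, cosPi_top, h4]; norm_num
    · exact absurd hnt h
  · obtain ⟨k, hk1, hk2, -, ht⟩ := h.exists_scaling hM hn hnt
    have h2 := two_le_toNat hn hnt
    rw [ht, cosPi, recip_eq hnt]
    have hn0 : (0 : ℝ) < n.toNat := by exact_mod_cast (by omega : 0 < n.toNat)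
    have hk1' : (1 : ℝ) ≤ k := by exact_mod_cast hk1
    have hk2' : (k : ℝ) + 1 ≤ n.toNat := by exact_mod_cast hk2
    have hpi := Real.pi_pos
    -- kπ/n lies between π/n and π − π/n, where |cos| is at most cos(π/n).
    have ha : Real.pi * (1 / n.toNat) ≤ Real.pi * (k / n.toNat) := by gcongr
    have hb : Real.pi * (k / n.toNat) ≤ Real.pi - Real.pi * (1 / n.toNat) := by
      have : Real.pi - Real.pi * (1 / n.toNat) = Real.pi * ((n.toNat - 1) / n.toNat) := by
        field_simp
      rw [this]
      gcongr
      linarith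
    have h0 : 0 ≤ Real.pi * (1 / n.toNat) := by positivity
    have c1 := Real.cos_le_cos_of_nonneg_of_le_pi h0 (by linarith) ha
    have c2 := Real.cos_le_cos_of_nonneg_of_le_pi (h0.trans ha) (by linarith) hb
    rw [Real.cos_pi_sub] at c2
    have := sq_le_sq' c2 c1
    linarith

/-- Being geometric selects the minimal rotations among those of order n; the hypothesis applies
because a scaling factor of finite order has norm one. -/
theorem HasOrder.trace_sq_eq {M : RMat} (hM : M.det = 1) {n : ℕ∞} (hn : 2 ≤ n)
    (h : HasOrder (realPSL M) n) (hg : IsElliptic (realPSL M) → IsGeometric (realPSL M)) :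
    M.trace ^ 2 = 4 * cosPi n ^ 2 := by
  have hM' := det_map_eq_one hM
  by_cases hnt : n = ⊤
  · rcases h with ⟨-, hp⟩ | ⟨h, -⟩
    · have := hp.trace_sq hM'
      rw [trace_map_ofReal] at this
      have h4 : M.trace ^ 2 = 4 := by exact_mod_cast this
      rw [hnt, cosPi_top, h4]; norm_num
    · exact absurd hnt h
  · obtain ⟨k, hk1, hk2, hc, -⟩ := h.exists_scaling hM hn hnt
    rcases h with ⟨h, -⟩ | ⟨-, -, hord⟩
    · exact absurd h hnt
    have hne : realPSL M ≠ 1 := orderOf_ne_one hn hord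
    obtain ⟨-, hg⟩ := hg ⟨_, by
      rw [show (2 * ((Real.pi * (k / n.toNat) : ℝ) : ℂ)) = ((2 * (Real.pi * (k / n.toNat)) : ℝ) : ℂ)
        by push_cast; ring]
      exact Complex.norm_exp_ofReal_mul_I _, fun h => hne (hc.eq_one_iff.mpr h), hc⟩
    rw [orderOf_eq_toNat hord] at hg
    have e : (2 * Real.pi * Complex.I / (n.toNat : ℂ)) =
        2 * ((Real.pi * recip n : ℝ) : ℂ) * Complex.I := by
      rw [recip_eq hnt]; push_cast; ring
    have key : ((M.map Complex.ofReal).trace) ^ 2 = ((4 * cosPi n ^ 2 : ℝ) : ℂ) := by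
      rw [cosPi, ← two_add_exp, ← e]
      rcases hg with hg | hg
      · exact (hg.ne_zero_and_trace hM').2
      · rw [(hg.ne_zero_and_trace hM').2, ← Complex.exp_neg, neg_neg, ← Complex.exp_neg]
        ring
    rw [trace_map_ofReal] at key
    exact_mod_cast key

/-- The converse: the squared trace determines the scaling factor up to inversion, and e^{±2πi/n}
are primitive roots of unity. -/
theorem hasOrder_of_trace {M : RMat} (hM : M.det = 1) {n : ℕ∞} (hn : 2 ≤ n)
    (ht : M.trace ^ 2 = 4 * cosPi n ^ 2) (h1 : realPSL M ≠ 1) :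
    HasOrder (realPSL M) n ∧ (IsElliptic (realPSL M) → IsGeometric (realPSL M)) := by
  have hM' := det_map_eq_one hM
  have ht' : (M.map Complex.ofReal).trace ^ 2 = ((4 * cosPi n ^ 2 : ℝ) : ℂ) := by
    rw [trace_map_ofReal, ← ht]; push_cast; rfl
  by_cases hnt : n = ⊤
  · rw [hnt, cosPi_top] at ht'
    have ht4 : (M.map Complex.ofReal).trace ^ 2 = 4 := by rw [ht']; norm_num
    refine ⟨.inl ⟨hnt, isParabolic_of_trace_sq hM' ht4 h1⟩, ?_⟩
    rintro ⟨c, -, hc1, hc⟩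
    obtain ⟨hc0, hct⟩ := IsConjToScaling.ne_zero_and_trace hM' hc
    rw [ht4] at hct
    field_simp at hct
    have : (c - 1) ^ 2 = 0 := by linear_combination -hct
    exact absurd (sub_eq_zero.mp (pow_eq_zero_iff two_ne_zero |>.mp this)) hc1
  · have h2 := two_le_toNat hn hnt
    have hprim := Complex.isPrimitiveRoot_exp n.toNat (by omega)
    set c := Complex.exp (2 * Real.pi * Complex.I / n.toNat) with hc
    have hc0 : c ≠ 0 := Complex.exp_ne_zero _
    have hc1 : c ≠ 1 := hprim.ne_one (by omega)
    have e : (2 * Real.pi * Complex.I / (n.toNat : ℂ)) =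
        2 * ((Real.pi * recip n : ℝ) : ℂ) * Complex.I := by
      rw [recip_eq hnt]; push_cast; ring
    have hsc := isConjToScaling_of_trace hM' hc0 hc1 (by
      rw [ht', cosPi, ← two_add_exp, hc, e])
    have hord : orderOf (realPSL M) = n.toNat := by
      rcases hsc with h | h
      · rw [realPSL, h.orderOf_eq, hprim.eq_orderOf]
      · rw [realPSL, h.orderOf_eq, hprim.inv.eq_orderOf]
    have hfin : IsOfFinOrder (realPSL M) := by
      rw [← orderOf_ne_zero_iff, hord]; omega
    refine ⟨.inr ⟨hnt, hfin, by rw [hord, ENat.natCast_toNat hnt]⟩, fun _ => ⟨hfin, ?_⟩⟩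
    rw [hord, Complex.exp_neg]
    exact hsc

/-! ### Rotations about the vertices -/

theorem tracelessPart_eq_zero_of_realPSL {X : RMat} (hX : X.det ≠ 0) (h : realPSL X = 1) :
    tracelessPart X = 0 := by
  rw [← realPSL_one] at h
  obtain ⟨c, -, rfl⟩ := eq_smul_of_realPSL_eq (by simp) hX h.symm
  ext i; fin_cases i <;> simp [tracelessPart]

theorem tracelessPart_adjugate (X : RMat) : tracelessPart X.adjugate = -tracelessPart X := by
  rw [Matrix.adjugate_fin_two]
  ext i; fin_cases i <;> simp [tracelessPart]; ring

theorem exists_tracelessPart_pow (M : RMat) (k : ℕ) :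
    ∃ a b : ℝ, M ^ k = a • (1 : RMat) + b • M := by
  induction k with
  | zero => exact ⟨1, 0, by simp⟩
  | succ k ih =>
    obtain ⟨a, b, h⟩ := ih
    refine ⟨-b * M.det, a + b * M.trace, ?_⟩
    rw [pow_succ, h, Matrix.trace_fin_two, Matrix.det_fin_two]
    ext i j
    fin_cases i <;> fin_cases j <;> simp [Matrix.mul_apply] <;> ring

/-- A power is a combination of 1 and M, so it has the same fixed vector up to a factor. -/
theorem exists_tracelessPart_of_pow {M X : RMat} (hM : M.det = 1) (hX : X.det ≠ 0) {k : ℕ}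
    (h : realPSL M ^ k = realPSL X) : ∃ b : ℝ, tracelessPart X = b • tracelessPart M := by
  rw [realPSL_pow (by simp [hM])] at h
  obtain ⟨c, -, rfl⟩ := eq_smul_of_realPSL_eq (by simp [hM]) hX h
  obtain ⟨a, b, hab⟩ := exists_tracelessPart_pow M k
  refine ⟨c * b, ?_⟩
  rw [hab, tracelessPart_smul, mul_smul]
  congr 1
  ext i; fin_cases i <;> simp [tracelessPart]; ring

theorem exists_tracelessPart_of_zpow {M X : RMat} (hM : M.det = 1) (hX : X.det ≠ 0) {n : ℤ}
    (h : realPSL M ^ n = realPSL X) : ∃ b : ℝ, tracelessPart X = b • tracelessPart M := by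
  obtain ⟨k, rfl | rfl⟩ := n.eq_nat_or_neg
  · rw [zpow_natCast] at h
    exact exists_tracelessPart_of_pow hM hX h
  · rw [zpow_neg, zpow_natCast, inv_eq_iff_eq_inv, realPSL_inv hX] at h
    obtain ⟨b, hb⟩ := exists_tracelessPart_of_pow hM
      (by rw [Matrix.det_adjugate]; simpa using hX) h
    refine ⟨-b, ?_⟩
    rw [neg_smul, ← hb, tracelessPart_adjugate, neg_neg]

/-- The traceless part of a product is half the commutator plus nothing symmetric, that is, a cross
product; its pairing with c is a triple product, whose square is minus the Gram determinant. -/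
theorem form_tracelessPart_mul_sq (a b c : V3) :
    form (tracelessPart (toMat a * toMat b)) c ^ 2 =
      form a b ^ 2 * form c c + form a c ^ 2 * form b b + form b c ^ 2 * form a a
        - form a a * form b b * form c c - 2 * form a b * form a c * form b c := by
  simp [form_apply, tracelessPart, toMat, Matrix.mul_apply]
  ring

theorem form_tracelessPart_mul_left (a b : V3) :
    form (tracelessPart (toMat a * toMat b)) a = 0 := by
  simp [form_apply, tracelessPart, toMat, Matrix.mul_apply]
  ring

theorem form_tracelessPart_mul_right (a b : V3) :
    form (tracelessPart (toMat a * toMat b)) b = 0 := by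
  simp [form_apply, tracelessPart, toMat, Matrix.mul_apply]
  ring

namespace IsMirrorTriple
variable {R : Fin 3 → V3} {ν : Fin 3 → ℕ∞}

theorem rotation_eq (h : IsMirrorTriple R ν) (i : Fin 3) :
    rotation R i = realPSL (toMat (R (i + 1)) * toMat (R (i + 2))) := by
  rw [realPSL_mul (by simp [h.det_toMat_mirror]) (by simp [h.det_toMat_mirror])]; rfl

theorem det_rotation (h : IsMirrorTriple R ν) (i : Fin 3) :
    (toMat (R (i + 1)) * toMat (R (i + 2))).det = 1 := by
  rw [Matrix.det_mul, h.det_toMat_mirror, h.det_toMat_mirror]; norm_num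

/-- The traceless part of the rotation about a vertex. -/
theorem tracelessPart_rotation (h : IsMirrorTriple R ν) (hν : IsHyperbolicSignature ν)
    (i : Fin 3) : ∃ e : ℝ, e ^ 2 = lSq ν ∧
      tracelessPart (toMat (R (i + 1)) * toMat (R (i + 2))) = e • dual R ν i := by
  refine ⟨form (tracelessPart (toMat (R (i + 1)) * toMat (R (i + 2)))) (R i), ?_, ?_⟩
  · obtain ⟨h1, h2, h3, h4, h5, h6⟩ := h.gram_cyclic i
    rw [form_tracelessPart_mul_sq, h2, h4, h5, h.norm, h.norm, h.norm, lSq_cyclic ν i]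
    ring
  · have hz : ∀ j, j ≠ i →
        form (tracelessPart (toMat (R (i + 1)) * toMat (R (i + 2)))) (R j) = 0 := by
      intro j hj
      rcases (by grind : j = i + 1 ∨ j = i + 2) with rfl | rfl
      · exact form_tracelessPart_mul_left _ _
      · exact form_tracelessPart_mul_right _ _
    conv_lhs => rw [h.sum_form_dual hν (tracelessPart _)]
    rw [Finset.sum_eq_single i (fun j _ hj => by rw [hz j hj, zero_smul]) (by simp)]

theorem dual_ne_zero (h : IsMirrorTriple R ν) (hν : IsHyperbolicSignature ν) (i : Fin 3) :
    dual R ν i ≠ 0 := by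
  intro h0
  have := h.form_dual_eq hν.lSq_pos i i
  rw [h0] at this
  simp at this

theorem eq_of_dual_eq_smul (h : IsMirrorTriple R ν) (hν : IsHyperbolicSignature ν) {i j : Fin 3}
    {c : ℝ} (he : dual R ν i = c • dual R ν j) : i = j := by
  by_contra hij
  have h1 := h.form_dual_eq hν.lSq_pos i i
  rw [he, map_smul, LinearMap.smul_apply, h.form_dual_eq hν.lSq_pos, if_neg (Ne.symm hij)] at h1
  simp at h1

theorem rotation_ne_one (h : IsMirrorTriple R ν) (hν : IsHyperbolicSignature ν) (i : Fin 3) :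
    rotation R i ≠ 1 := by
  intro h1
  rw [h.rotation_eq] at h1
  have h2 := tracelessPart_eq_zero_of_realPSL (by rw [h.det_rotation]; exact one_ne_zero) h1
  obtain ⟨e, he, h3⟩ := h.tracelessPart_rotation hν i
  rw [h3, smul_eq_zero] at h2
  rcases h2 with rfl | h2
  · have := hν.lSq_pos
    rw [← he] at this; simp at this
  · exact h.dual_ne_zero hν i h2

/-- The rotations about the vertices are primitive elements. -/
theorem isPrimitive_rotation (h : IsMirrorTriple R ν) (hν : IsHyperbolicSignature ν) (i : Fin 3) :
    IsPrimitive (evenGroup R) (rotation R i) := by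
  refine ⟨Subgroup.subset_closure ⟨i, rfl⟩, fun B hB n hn => ?_⟩
  refine le_antisymm ?_ ?_
  swap
  · rw [Subgroup.zpowers_le, ← hn]
    exact Subgroup.zpow_mem_zpowers B n
  rw [Subgroup.zpowers_le]
  obtain ⟨L, hL, rfl⟩ := (h.mem_evenGroup_iff B).mp hB
  have hd := h.det_wordMat L
  rw [hL.neg_one_pow] at hd
  rw [← h.realPSL_wordMat, h.rotation_eq] at hn
  -- A root of the rotation has the same fixed vector, the vertex, so it lies in the stabilizer and
  -- is a power of the rotation.
  obtain ⟨b, hb⟩ := exists_tracelessPart_of_zpow hd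
    (by rw [h.det_rotation]; exact one_ne_zero) hn
  obtain ⟨e, he, h3⟩ := h.tracelessPart_rotation hν i
  have he0 : e ≠ 0 := by
    rintro rfl
    have := hν.lSq_pos
    rw [← he] at this; simp at this
  have hdual : dual R ν i = (e⁻¹ * b) • tracelessPart (wordMat R L) := by
    rw [mul_smul, ← hb, h3, smul_smul, inv_mul_cancel₀ he0, one_smul]
  have hfix : wordAct R L (dual R ν i) = dual R ν i := by
    rw [hdual, h.wordAct_smul, h.wordAct_tracelessPart hL]
  have hne : wordProd (mirrorPSL R) L ≠ 1 := by
    intro h1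
    rw [h.realPSL_wordMat, h1, one_zpow, ← h.rotation_eq] at hn
    exact h.rotation_ne_one hν i hn.symm
  obtain ⟨j, c, -, hc, hz⟩ := h.stabilizer hν (h.dual_mem_chamber hν i) (h.dual_ne_zero hν i) hL
    hfix hne
  rwa [h.eq_of_dual_eq_smul hν hc]

end IsMirrorTriple

/-! ### The standard disc -/

theorem crossRatio_standard (z : ℂ) :
    crossRatio ∞ ((0 : ℂ) : OnePoint ℂ) ((1 : ℂ) : OnePoint ℂ) z = z := by
  simp [crossRatio, bracket, homog_infty, homog_coe]

theorem crossRatio_infty_zero {z w : ℂ} (h : z ≠ w) :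
    crossRatio ∞ z w ((0 : ℂ) : OnePoint ℂ) = ((z / (z - w) : ℂ) : OnePoint ℂ) := by
  have h1 : w - z ≠ 0 := sub_ne_zero.mpr h.symm
  have h2 : z - w ≠ 0 := sub_ne_zero.mpr h
  have : (0 - z) * (w * 0 - 1 * 1) / ((0 * 0 - 1 * 1) * (w - z)) = z / (z - w) := by
    rw [div_eq_div_iff (by simpa using h2) h2]; ring
  rw [crossRatio, if_neg (by simp [bracket, homog_infty, homog_coe, h2]), ← this]
  simp [bracket, homog_infty, homog_coe]

theorem disc_standard : disc ∞ ((0 : ℂ) : OnePoint ℂ) ((1 : ℂ) : OnePoint ℂ) =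
    (↑) '' {z : ℂ | 0 < z.im} := by
  ext x
  cases x with
  | infty =>
    simp [disc, crossRatio, bracket, homog_infty, homog_coe]
  | coe z =>
    simp only [disc, crossRatio_standard, Set.mem_ofPred_eq]
    constructor
    · rintro ⟨w, hw, h⟩
      exact ⟨w, h, hw.symm⟩
    · rintro ⟨w, h, hw⟩
      exact ⟨w, hw.symm, h⟩

theorem mem_closure_disc_standard (x : OnePoint ℂ) :
    x ∈ closure (disc ∞ ((0 : ℂ) : OnePoint ℂ) ((1 : ℂ) : OnePoint ℂ)) ↔ IsUpper x := by
  rw [disc_standard]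
  constructor
  · intro hx
    by_contra hneg
    have hopen : IsOpen ((↑) '' {z : ℂ | z.im < 0} : Set (OnePoint ℂ)) :=
      OnePoint.isOpenEmbedding_coe.isOpenMap _ (isOpen_lt Complex.continuous_im continuous_const)
    have hmem : x ∈ ((↑) '' {z : ℂ | z.im < 0} : Set (OnePoint ℂ)) := by
      cases x with
      | infty => exact absurd (.inl rfl) hneg
      | coe z =>
        refine ⟨z, ?_, rfl⟩
        by_contra! h
        exact hneg (.inr ⟨z, rfl, by simpa using h⟩)
    obtain ⟨_, ⟨z, hz, rfl⟩, ⟨w, hw, hwz⟩⟩ := mem_closure_iff.mp hx _ hopen hmem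
    rw [OnePoint.coe_injective hwz] at hw
    exact lt_asymm (show z.im < 0 from hz) hw
  · rintro (rfl | ⟨z, rfl, hz⟩)
    · have ht : Filter.Tendsto (fun n : ℕ => (((n + 1 : ℝ) * Complex.I : ℂ) : OnePoint ℂ))
          Filter.atTop (nhds ∞) := by
        refine tendsto_coe_cobounded.comp ?_
        rw [← tendsto_norm_atTop_iff_cobounded]
        refine Filter.tendsto_atTop_mono (fun n => ?_) (tendsto_natCast_atTop_atTop (R := ℝ))
        rw [norm_mul, Complex.norm_I, mul_one]
        rw [Complex.norm_real, Real.norm_eq_abs]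
        exact (le_abs_self _).trans' (by linarith)
      refine mem_closure_of_tendsto ht (Filter.Eventually.of_forall fun n => ⟨_, ?_, rfl⟩)
      simp; positivity
    · have ht : Filter.Tendsto
          (fun n : ℕ => ((z + (1 / ((n : ℝ) + 1) : ℝ) * Complex.I : ℂ) : OnePoint ℂ))
          Filter.atTop (nhds z) := by
        refine (OnePoint.continuous_coe.tendsto z).comp ?_
        have h1 := tendsto_one_div_add_atTop_nhds_zero_nat (𝕜 := ℝ)
        have h2 := (Complex.continuous_ofReal.tendsto 0).comp h1
        have := (h2.mul_const Complex.I).const_add z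
        simpa using this
      refine mem_closure_of_tendsto ht (Filter.Eventually.of_forall fun n => ⟨_, ?_, rfl⟩)
      have : (0 : ℝ) < 1 / ((n : ℝ) + 1) := by positivity
      simp only [Set.mem_ofPred_eq, Complex.add_im, Complex.im_ofReal_mul,
        Complex.I_im]
      linarith

/-! ### The canonical matrices -/

/-- The number `l`. -/
def lParam (ν : Fin 3 → ℕ∞) : ℝ := √(lSq ν)

/-- The number `q₂ + q₁ q₃ + q₁ l`. -/
def nParam (ν : Fin 3 → ℕ∞) : ℝ :=
  cosPi (ν 1) + cosPi (ν 0) * cosPi (ν 2) + cosPi (ν 0) * lParam ν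

/-- The number `q₁ q₂ + q₃ + l`. -/
def dParam (ν : Fin 3 → ℕ∞) : ℝ := cosPi (ν 0) * cosPi (ν 1) + cosPi (ν 2) + lParam ν

/-- The first canonical matrix, for all signatures. -/
def matA (ν : Fin 3 → ℕ∞) : RMat :=
  !![-cosPi (ν 0), -(nParam ν / lParam ν);
    sinPi (ν 0) ^ 2 * lParam ν / nParam ν, -cosPi (ν 0)]

/-- The second canonical matrix, for all signatures. -/
def matB (ν : Fin 3 → ℕ∞) : RMat :=
  !![-cosPi (ν 1), -(nParam ν * sinPi (ν 1) ^ 2 / (lParam ν * dParam ν));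
    dParam ν * lParam ν / nParam ν, -cosPi (ν 1)]

/-- The mirrors of the canonical triangle. -/
def canonicalMirrors (ν : Fin 3 → ℕ∞) : Fin 3 → V3 :=
  ![![cosPi (ν 1), -(nParam ν * sinPi (ν 1) ^ 2 / (lParam ν * dParam ν)),
      dParam ν * lParam ν / nParam ν],
    ![cosPi (ν 0), nParam ν / lParam ν, -(sinPi (ν 0) ^ 2 * lParam ν / nParam ν)],
    ![-1, 0, 0]]

section
variable {ν : Fin 3 → ℕ∞}

namespace IsHyperbolicSignature

theorem lParam_pos (hν : IsHyperbolicSignature ν) : 0 < lParam ν := Real.sqrt_pos.mpr hν.lSq_pos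

theorem lParam_sq (hν : IsHyperbolicSignature ν) : lParam ν ^ 2 =
    cosPi (ν 0) ^ 2 + cosPi (ν 1) ^ 2 + cosPi (ν 2) ^ 2 +
      2 * cosPi (ν 0) * cosPi (ν 1) * cosPi (ν 2) - 1 :=
  Real.sq_sqrt hν.lSq_pos.le

theorem nParam_pos (hν : IsHyperbolicSignature ν) : 0 < nParam ν := by
  have h1 : 0 < cosPi (ν 2) * cosPi (ν 0) + cosPi (ν 1) := hν.cos_cross_pos 1
  have h2 := mul_nonneg (cosPi_nonneg (hν.1 0)) hν.lParam_pos.le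
  rw [nParam]; linarith

theorem dParam_pos (hν : IsHyperbolicSignature ν) : 0 < dParam ν := by
  have h1 : 0 < cosPi (ν 0) * cosPi (ν 1) + cosPi (ν 2) := hν.cos_cross_pos 2
  have h2 := hν.lParam_pos
  rw [dParam]; linarith

theorem sin_mul_sin_lt_dParam (hν : IsHyperbolicSignature ν) :
    sinPi (ν 0) * sinPi (ν 1) < dParam ν := by
  have h1 : sinPi (ν 0) * sinPi (ν 1) < cosPi (ν 0) * cosPi (ν 1) + cosPi (ν 2) :=
    hν.sin_mul_sin_lt 2
  have h2 := hν.lParam_pos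
  rw [dParam]; linarith

/-- The factorization of (q₁q₂ + q₃)² − l² = p₁²p₂². The next three identities are likewise
consequences of the equation for l² and of p² + q² = 1. -/
theorem dParam_mul (hν : IsHyperbolicSignature ν) :
    dParam ν * (cosPi (ν 0) * cosPi (ν 1) + cosPi (ν 2) - lParam ν) =
      sinPi (ν 0) ^ 2 * sinPi (ν 1) ^ 2 := by
  rw [dParam, sinPi_sq, sinPi_sq]
  linear_combination -hν.lParam_sq

theorem nParam_mul (hν : IsHyperbolicSignature ν) :
    nParam ν * (cosPi (ν 0) + cosPi (ν 1) * cosPi (ν 2) + cosPi (ν 1) * lParam ν) =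
      dParam ν * (sinPi (ν 2) ^ 2 + lParam ν ^ 2) := by
  rw [dParam, nParam, sinPi_sq]
  linear_combination (-lParam ν - cosPi (ν 2)) * hν.lParam_sq

theorem dParam_mul' (hν : IsHyperbolicSignature ν) :
    dParam ν * (cosPi (ν 0) + cosPi (ν 1) * cosPi (ν 2) - cosPi (ν 1) * lParam ν) =
      nParam ν * sinPi (ν 1) ^ 2 := by
  rw [dParam, nParam, sinPi_sq]
  linear_combination -cosPi (ν 1) * hν.lParam_sq

theorem nParam_sq (hν : IsHyperbolicSignature ν) :
    nParam ν ^ 2 - 2 * cosPi (ν 0) * lParam ν * nParam ν =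
      sinPi (ν 0) ^ 2 * (lParam ν ^ 2 + sinPi (ν 2) ^ 2) := by
  rw [nParam, sinPi_sq, sinPi_sq]
  linear_combination -hν.lParam_sq

theorem det_matA (hν : IsHyperbolicSignature ν) : (matA ν).det = 1 := by
  have h1 := hν.lParam_pos.ne'
  have h2 := hν.nParam_pos.ne'
  rw [matA, Matrix.det_fin_two_of]
  field_simp
  rw [sinPi_sq]; ring

theorem det_matB (hν : IsHyperbolicSignature ν) : (matB ν).det = 1 := by
  have h1 := hν.lParam_pos.ne'
  have h2 := hν.nParam_pos.ne'
  have h3 := hν.dParam_pos.ne'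
  rw [matB, Matrix.det_fin_two_of]
  field_simp
  rw [sinPi_sq]; ring

/-- The product of the canonical matrices. -/
theorem matA_mul_matB (hν : IsHyperbolicSignature ν) : matA ν * matB ν =
    !![-cosPi (ν 2) - lParam ν, (sinPi (ν 2) ^ 2 + lParam ν ^ 2) / lParam ν;
      -lParam ν, -cosPi (ν 2) + lParam ν] := by
  have h1 := hν.lParam_pos.ne'
  have h2 := hν.nParam_pos.ne'
  have h3 := hν.dParam_pos.ne'
  have e1 := hν.dParam_mul
  have e2 := hν.nParam_mul
  have e3 := sinPi_sq (ν 0)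
  have e4 := sinPi_sq (ν 1)
  have e5 : dParam ν = cosPi (ν 0) * cosPi (ν 1) + cosPi (ν 2) + lParam ν := rfl
  have e6 : nParam ν = cosPi (ν 1) + cosPi (ν 0) * cosPi (ν 2) + cosPi (ν 0) * lParam ν := rfl
  ext i j
  fin_cases i <;> fin_cases j <;> simp [matA, matB, Matrix.mul_apply] <;> field_simp
  · linear_combination -e5
  · linear_combination e2 + nParam ν * cosPi (ν 0) * e4 + nParam ν * cosPi (ν 1) * e5
  · linear_combination e6 + (-cosPi (ν 1)) * e3 - cosPi (ν 0) * e5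
  · linear_combination e1

/-- The mirror 2 is the imaginary axis, the side between the fixed points of A and B; the other two
are chosen so that A is the product of mirrors 1 and 2, and B the product of mirrors 2 and 0. -/
theorem isMirrorTriple (hν : IsHyperbolicSignature ν) : IsMirrorTriple (canonicalMirrors ν) ν := by
  have h1 := hν.lParam_pos.ne'
  have h2 := hν.nParam_pos.ne'
  have h3 := hν.dParam_pos.ne'
  have e1 := hν.dParam_mul
  have e3 := sinPi_sq (ν 0)
  have e4 := sinPi_sq (ν 1)
  have e5 : dParam ν = cosPi (ν 0) * cosPi (ν 1) + cosPi (ν 2) + lParam ν := rfl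
  constructor
  · intro i
    fin_cases i <;> simp [form_apply, canonicalMirrors]
    · field_simp
      linear_combination 2 * e4
    · field_simp
      linear_combination 2 * e3
  · intro i
    fin_cases i <;> simp [form_apply, canonicalMirrors]
    field_simp
    linear_combination e1 - dParam ν * e5

theorem rotation_zero (hν : IsHyperbolicSignature ν) :
    rotation (canonicalMirrors ν) 0 = realPSL (matA ν) := by
  rw [hν.isMirrorTriple.rotation_eq]
  congr 1
  ext i j
  fin_cases i <;> fin_cases j <;> simp [toMat, canonicalMirrors, matA, Matrix.mul_apply]

theorem rotation_one (hν : IsHyperbolicSignature ν) :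
    rotation (canonicalMirrors ν) 1 = realPSL (matB ν) := by
  rw [hν.isMirrorTriple.rotation_eq]
  congr 1
  ext i j
  fin_cases i <;> fin_cases j <;> simp [toMat, canonicalMirrors, matB, Matrix.mul_apply]

theorem evenGroup_canonical (hν : IsHyperbolicSignature ν) :
    evenGroup (canonicalMirrors ν) = Subgroup.closure {realPSL (matA ν), realPSL (matB ν)} := by
  rw [hν.isMirrorTriple.evenGroup_eq_closure 0, hν.rotation_zero, zero_add, hν.rotation_one]

theorem realPSL_ne_one {M : RMat} (hM : M.det ≠ 0) (h : M 1 0 ≠ 0 ∨ M 0 1 ≠ 0) :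
    realPSL M ≠ 1 := by
  intro h1
  have h2 := tracelessPart_eq_zero_of_realPSL hM h1
  rcases h with h | h
  · exact h (congrFun h2 2)
  · exact h (neg_eq_zero.mp (congrFun h2 1))

theorem hasOrder_matA (hν : IsHyperbolicSignature ν) : HasOrder (realPSL (matA ν)) (ν 0) ∧
    (IsElliptic (realPSL (matA ν)) → IsGeometric (realPSL (matA ν))) := by
  refine hasOrder_of_trace hν.det_matA (hν.1 0) ?_
    (realPSL_ne_one (by simp [hν.det_matA]) (.inr ?_))
  · simp [matA, Matrix.trace_fin_two]; ring
  · simpa [matA] using ⟨hν.nParam_pos.ne', hν.lParam_pos.ne'⟩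

theorem hasOrder_matB (hν : IsHyperbolicSignature ν) : HasOrder (realPSL (matB ν)) (ν 1) ∧
    (IsElliptic (realPSL (matB ν)) → IsGeometric (realPSL (matB ν))) := by
  refine hasOrder_of_trace hν.det_matB (hν.1 1) ?_
    (realPSL_ne_one (by simp [hν.det_matB]) (.inl ?_))
  · simp [matB, Matrix.trace_fin_two]; ring
  · simpa [matB] using ⟨⟨hν.dParam_pos.ne', hν.lParam_pos.ne'⟩, hν.nParam_pos.ne'⟩

theorem realPSL_mul_matB (hν : IsHyperbolicSignature ν) :
    realPSL (matA ν) * realPSL (matB ν) = realPSL (matA ν * matB ν) :=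
  (realPSL_mul (by simp [hν.det_matA]) (by simp [hν.det_matB])).symm

theorem hasOrder_mul (hν : IsHyperbolicSignature ν) :
    HasOrder (realPSL (matA ν) * realPSL (matB ν)) (ν 2) := by
  rw [hν.realPSL_mul_matB]
  refine (hasOrder_of_trace (by simp [hν.det_matA, hν.det_matB]) (hν.1 2) ?_
    (realPSL_ne_one (by simp [hν.det_matA, hν.det_matB]) (.inl ?_))).1
  · rw [hν.matA_mul_matB]; simp [Matrix.trace_fin_two]; ring
  · rw [hν.matA_mul_matB]; simpa using hν.lParam_pos.ne'

end IsHyperbolicSignature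

end

/-! ### The canonical triangle -/

/-- The circle with a given normal vector. -/
def circleOf (s : V3) (hs : 0 < form s s) : SphereCircle where
  α := s 2
  β := ((-s 0 : ℝ) : ℂ)
  γ := s 1
  nondeg := by
    rw [form_apply] at hs
    rw [Complex.normSq_ofReal]
    linarith

theorem circleOf_im (s : V3) (hs : 0 < form s s) : (circleOf s hs).β.im = 0 := by
  simp [circleOf]

theorem circleVec_circleOf (s : V3) (hs : 0 < form s s) : circleVec (circleOf s hs) = s := by
  ext i; fin_cases i <;> simp [circleVec, circleOf]

/-- The converse of `IsTriangle.exists_isMirrorTriple`: `cos_angleAt` gives the cosine of the angle,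
and the cosine is injective on [0, π]. -/
theorem IsMirrorTriple.isTriangle {R : Fin 3 → V3} {ν : Fin 3 → ℕ∞} (h : IsMirrorTriple R ν)
    (hν : ∀ i, 2 ≤ ν i) {v : Fin 3 → OnePoint ℂ}
    (hideal : ∀ j, ν j = ⊤ → v j ∈ SphereCircle.realLine.points)
    (hfin : ∀ j, ν j ≠ ⊤ → ∃ w : ℂ, v j = w ∧ 0 < w.im)
    (h1 : ∀ i, height (R i) (v (i + 1)) = 0) (h2 : ∀ i, height (R i) (v (i + 2)) = 0)
    (h0 : ∀ i, 0 < height (R i) (v i)) : IsTriangle v ν := by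
  have hup : ∀ i, IsUpper (v i) := fun i => by
    by_cases hi : ν i = ⊤
    · exact isUpper_of_mem_realLine (hideal i hi)
    · obtain ⟨w, hw, hpos⟩ := hfin i hi
      exact .inr ⟨w, hw, hpos.le⟩
  refine ⟨fun i j hij => ?_, hideal, fun j hj => ?_⟩
  · by_contra hne
    have := h0 i
    rcases (by grind : j = i + 1 ∨ j = i + 2) with rfl | rfl
    · rw [hij, h1] at this; exact lt_irrefl _ this
    · rw [hij, h2] at this; exact lt_irrefl _ this
  · obtain ⟨w, hw, hpos⟩ := hfin j hj
    refine ⟨w, hw, hpos, ?_⟩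
    have a1 : height (R (j + 1)) (v j) = 0 := by
      have := h2 (j + 1); rwa [show j + 1 + 2 = j by grind] at this
    have a2 : height (R (j + 2)) (v j) = 0 := by
      have := h1 (j + 2); rwa [show j + 2 + 1 = j by grind] at this
    have a3 : height (R (j + 2)) (v (j + 1)) = 0 := by
      have := h2 (j + 2); rwa [show j + 2 + 2 = j + 1 by grind] at this
    have a4 : height (R (j + 1)) (v (j + 2)) = 0 := by
      have := h1 (j + 1); rwa [show j + 1 + 1 = j + 2 by grind] at this
    rw [hw] at a1 a2
    have := cos_angleAt hpos (hup (j + 1)) (hup (j + 2)) (h.norm _) (h.norm _) a1 a2 a3 (h0 _) a4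
      (h0 _)
    rw [h.gram, neg_neg, cosPi] at this
    have hpi := Real.pi_pos
    have h3 := recip_nonneg (ν j)
    have h4 := recip_le_half (hν j)
    refine Real.injOn_cos ⟨InnerProductGeometry.angle_nonneg _ _,
      InnerProductGeometry.angle_le_pi _ _⟩
      ⟨by positivity, ?_⟩ this
    nlinarith

/-- The vertices of the canonical triangle. -/
def canonicalVertices (ν : Fin 3 → ℕ∞) : Fin 3 → OnePoint ℂ :=
  ![if ν 0 = ⊤ then ∞ else (((nParam ν / (lParam ν * sinPi (ν 0)) : ℝ) * Complex.I : ℂ) :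
      OnePoint ℂ),
    (((nParam ν * sinPi (ν 1) / (lParam ν * dParam ν) : ℝ) * Complex.I : ℂ) : OnePoint ℂ),
    ((1 + (sinPi (ν 2) / lParam ν : ℝ) * Complex.I : ℂ) : OnePoint ℂ)]

theorem height_ofReal_mul_I (s : V3) (y : ℝ) :
    height s ((y * Complex.I : ℂ) : OnePoint ℂ) = s 2 * y ^ 2 + s 1 := by
  rw [height_coe, Complex.normSq_apply, Complex.re_ofReal_mul, Complex.im_ofReal_mul, Complex.I_re,
    Complex.I_im]
  ring

namespace IsHyperbolicSignature
variable {ν : Fin 3 → ℕ∞}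

/-- The vertices are the fixed points of A, B and AB in the closed upper half-plane. For this vertex
and the next one, being on the positive side of the opposite mirror amounts to p₁p₂ < d, with d =
`dParam ν`. -/
theorem height_zero (hν : IsHyperbolicSignature ν) :
    0 < height (canonicalMirrors ν 0) (canonicalVertices ν 0) ∧
    height (canonicalMirrors ν 1) (canonicalVertices ν 0) = 0 ∧
    height (canonicalMirrors ν 2) (canonicalVertices ν 0) = 0 := by
  have hl := hν.lParam_pos
  have hn := hν.nParam_pos
  have hd := hν.dParam_pos
  by_cases ht : ν 0 = ⊤
  · have hv : canonicalVertices ν 0 = ∞ := by simp [canonicalVertices, ht]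
    rw [hv]
    refine ⟨?_, ?_, ?_⟩ <;> simp [canonicalMirrors]
    · positivity
    · simp [ht]
  · have hv : canonicalVertices ν 0 =
      (((nParam ν / (lParam ν * sinPi (ν 0)) : ℝ) * Complex.I : ℂ) : OnePoint ℂ) := by
      simp [canonicalVertices, ht]
    have hp := sinPi_pos (hν.1 0) ht
    have hq := sinPi_nonneg (hν.1 1)
    rw [hv]
    simp only [height_ofReal_mul_I]
    refine ⟨?_, ?_, ?_⟩
    · have hlt := hν.sin_mul_sin_lt_dParam
      have e : canonicalMirrors ν 0 2 * (nParam ν / (lParam ν * sinPi (ν 0))) ^ 2 +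
          canonicalMirrors ν 0 1 = nParam ν / (lParam ν * sinPi (ν 0) ^ 2 * dParam ν) *
          (dParam ν ^ 2 - (sinPi (ν 0) * sinPi (ν 1)) ^ 2) := by
        simp [canonicalMirrors]
        field_simp
        ring
      rw [e]
      have : 0 < dParam ν ^ 2 - (sinPi (ν 0) * sinPi (ν 1)) ^ 2 := by
        have : (sinPi (ν 0) * sinPi (ν 1)) ^ 2 < dParam ν ^ 2 := by gcongr
        linarith
      positivity
    · simp [canonicalMirrors]
      field_simp
      ring
    · simp [canonicalMirrors]

theorem height_one (hν : IsHyperbolicSignature ν) :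
    0 < height (canonicalMirrors ν 1) (canonicalVertices ν 1) ∧
    height (canonicalMirrors ν 2) (canonicalVertices ν 1) = 0 ∧
    height (canonicalMirrors ν 0) (canonicalVertices ν 1) = 0 := by
  have hl := hν.lParam_pos
  have hn := hν.nParam_pos
  have hd := hν.dParam_pos
  have hv : canonicalVertices ν 1 =
    (((nParam ν * sinPi (ν 1) / (lParam ν * dParam ν) : ℝ) * Complex.I : ℂ) : OnePoint ℂ) := rfl
  have hp := sinPi_nonneg (hν.1 0)
  have hq := sinPi_nonneg (hν.1 1)
  rw [hv]
  simp only [height_ofReal_mul_I]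
  refine ⟨?_, ?_, ?_⟩
  · have hlt := hν.sin_mul_sin_lt_dParam
    have e : canonicalMirrors ν 1 2 * (nParam ν * sinPi (ν 1) / (lParam ν * dParam ν)) ^ 2 +
        canonicalMirrors ν 1 1 = nParam ν / (lParam ν * dParam ν ^ 2) *
        (dParam ν ^ 2 - (sinPi (ν 0) * sinPi (ν 1)) ^ 2) := by
      simp [canonicalMirrors]
      field_simp
      ring
    rw [e]
    have : 0 < dParam ν ^ 2 - (sinPi (ν 0) * sinPi (ν 1)) ^ 2 := by
      have : (sinPi (ν 0) * sinPi (ν 1)) ^ 2 < dParam ν ^ 2 := by gcongr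
      linarith
    positivity
  · simp [canonicalMirrors]
  · simp [canonicalMirrors]
    field_simp
    ring

theorem height_two (hν : IsHyperbolicSignature ν) :
    0 < height (canonicalMirrors ν 2) (canonicalVertices ν 2) ∧
    height (canonicalMirrors ν 0) (canonicalVertices ν 2) = 0 ∧
    height (canonicalMirrors ν 1) (canonicalVertices ν 2) = 0 := by
  have hl := hν.lParam_pos
  have hn := hν.nParam_pos
  have hd := hν.dParam_pos
  have hv : canonicalVertices ν 2 =
    ((1 + (sinPi (ν 2) / lParam ν : ℝ) * Complex.I : ℂ) : OnePoint ℂ) := rfl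
  have hh : ∀ s : V3, height s (canonicalVertices ν 2) =
      s 2 * (1 + (sinPi (ν 2) / lParam ν) ^ 2) - 2 * s 0 + s 1 := by
    intro s
    rw [hv, height_coe, Complex.normSq_apply]
    have h1 : (1 + ((sinPi (ν 2) / lParam ν : ℝ) : ℂ) * Complex.I).re = 1 := by
      rw [Complex.add_re, Complex.re_ofReal_mul]; simp
    have h2 : (1 + ((sinPi (ν 2) / lParam ν : ℝ) : ℂ) * Complex.I).im = sinPi (ν 2) / lParam ν := by
      rw [Complex.add_im, Complex.im_ofReal_mul]; simp
    rw [h1, h2]; ring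
  simp only [hh]
  refine ⟨?_, ?_, ?_⟩ <;> simp [canonicalMirrors]
  · field_simp
    linear_combination (-dParam ν) * hν.nParam_mul + nParam ν * hν.dParam_mul'
  · field_simp
    linear_combination hν.nParam_sq

theorem isTriangle_canonical (hν : IsHyperbolicSignature ν) :
    IsTriangle (canonicalVertices ν) ν := by
  have hl := hν.lParam_pos
  have hn := hν.nParam_pos
  have hd := hν.dParam_pos
  obtain ⟨a1, a2, a3⟩ := hν.height_zero
  obtain ⟨b1, b2, b3⟩ := hν.height_one
  obtain ⟨c1, c2, c3⟩ := hν.height_two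
  refine hν.isMirrorTriple.isTriangle hν.1 ?_ ?_ ?_ ?_ ?_
  · intro j hj
    fin_cases j
    · have : canonicalVertices ν 0 = ∞ := by simpa [canonicalVertices] using hj
      change canonicalVertices ν 0 ∈ _
      rw [this]; exact infty_mem_realLine
    · replace hj : ν 1 = ⊤ := hj
      refine (coe_mem_realLine _).mpr ?_
      rw [Complex.im_ofReal_mul, hj, sinPi_top]; simp
    · replace hj : ν 2 = ⊤ := hj
      refine (coe_mem_realLine _).mpr ?_
      rw [Complex.add_im, Complex.im_ofReal_mul, hj, sinPi_top]; simp
  · intro j hj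
    have hp := sinPi_pos (hν.1 j) hj
    fin_cases j
    · refine ⟨_, if_neg hj, ?_⟩
      replace hp : 0 < sinPi (ν 0) := hp
      rw [Complex.im_ofReal_mul, Complex.I_im, mul_one]
      positivity
    · refine ⟨_, rfl, ?_⟩
      replace hp : 0 < sinPi (ν 1) := hp
      rw [Complex.im_ofReal_mul, Complex.I_im, mul_one]
      positivity
    · refine ⟨_, rfl, ?_⟩
      replace hp : 0 < sinPi (ν 2) := hp
      rw [Complex.add_im, Complex.im_ofReal_mul, Complex.I_im, mul_one, Complex.one_im, zero_add]
      positivity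
  · intro i; fin_cases i <;> assumption
  · intro i; fin_cases i <;> assumption
  · intro i; fin_cases i <;> assumption

/-- The sides of the canonical triangle. -/
theorem isTriangleGroup_canonical (hν : IsHyperbolicSignature ν) :
    IsTriangleGroup (evenGroup (canonicalMirrors ν)) ν := by
  have h := hν.isMirrorTriple
  obtain ⟨a1, a2, a3⟩ := hν.height_zero
  obtain ⟨b1, b2, b3⟩ := hν.height_one
  obtain ⟨c1, c2, c3⟩ := hν.height_two
  have hpos : ∀ i, 0 < form (canonicalMirrors ν i) (canonicalMirrors ν i) := fun i => by
    rw [h.norm]; exact one_pos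
  refine ⟨h.isKleinian_evenGroup hν, ⟨_, _, hν.evenGroup_canonical, hν.hasOrder_matA.1,
    hν.hasOrder_matB.1, hν.hasOrder_mul⟩, canonicalVertices ν,
    fun i => circleOf (canonicalMirrors ν i) (hpos i), 1, hν.isTriangle_canonical, fun i => ?_, ?_⟩
  · refine ⟨(orthogonal_realLine_iff _).mpr (circleOf_im _ _), ?_, ?_⟩
    · rw [mem_points_iff (circleOf_im _ _), circleVec_circleOf]
      fin_cases i <;> assumption
    · rw [mem_points_iff (circleOf_im _ _), circleVec_circleOf]
      fin_cases i <;> assumption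
  · rw [h.orientationPreserving_eq (fun i => circleOf_im _ (hpos i))
      (fun i => ⟨1, one_ne_zero, by rw [circleVec_circleOf, one_smul]⟩), map_one]
    exact (Subgroup.map_id _).symm

end IsHyperbolicSignature

/-! ### The circles `L` and `L'` -/

/-- The imaginary axis. -/
def imaginaryAxis : SphereCircle where
  α := 0
  β := 1
  γ := 0
  nondeg := by simp

/-- The vertical line through `1`. -/
def lineThroughOne : SphereCircle where
  α := 0
  β := 1
  γ := -2
  nondeg := by simp

theorem infty_mem_imaginaryAxis : ∞ ∈ imaginaryAxis.points := .inl ⟨rfl, rfl⟩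

theorem infty_mem_lineThroughOne : ∞ ∈ lineThroughOne.points := .inl ⟨rfl, rfl⟩

theorem coe_mem_imaginaryAxis {z : ℂ} : (z : OnePoint ℂ) ∈ imaginaryAxis.points ↔ z.re = 0 := by
  rw [SphereCircle.mem_points_iff_quad]
  simp [homog_coe, SphereCircle.quad, imaginaryAxis]

theorem coe_mem_lineThroughOne {z : ℂ} : (z : OnePoint ℂ) ∈ lineThroughOne.points ↔ z.re = 1 := by
  rw [SphereCircle.mem_points_iff_quad]
  simp [homog_coe, SphereCircle.quad, lineThroughOne]
  constructor <;> intro h <;> linarith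

theorem re_eq_zero_of_sq {s t : ℝ} (hs : 0 ≤ s) (ht : 0 ≤ t) (hst : s ≠ 0 ∨ t ≠ 0) {z : ℂ}
    (h : s * z ^ 2 + t = 0) : z.re = 0 := by
  have h1 := congrArg Complex.re h
  have h2 := congrArg Complex.im h
  rw [Complex.add_re, Complex.re_ofReal_mul, sq] at h1
  rw [Complex.add_im, Complex.im_ofReal_mul, sq] at h2
  simp only [Complex.mul_re, Complex.mul_im, Complex.ofReal_re, Complex.ofReal_im,
    Complex.zero_re, Complex.zero_im, add_zero] at h1 h2
  by_contra hne
  have h3 : s * z.im = 0 := by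
    have : z.re * (s * z.im) = 0 := by linarith
    exact (mul_eq_zero.mp this).resolve_left hne
  have h4 : s * (z.re * z.re) + t = 0 := by linear_combination h1 + z.im * h3
  have h5 : 0 < z.re * z.re := mul_self_pos.mpr hne
  have h6 := mul_nonneg hs h5.le
  have h7 : s * (z.re * z.re) = 0 := by linarith
  have h8 : t = 0 := by linarith
  have h9 := (mul_eq_zero.mp h7).resolve_right h5.ne'
  rcases hst with h | h
  · exact h h9
  · exact h h8

theorem realPSL_coe_fixed {M : RMat} (hM : M.det ≠ 0) (z : ℂ) :
    mobius (realPSL M) z = z ↔ (M 1 0 * z ^ 2 + (M 1 1 - M 0 0) * z - M 0 1 : ℂ) = 0 := by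
  rw [realPSL, mobius_coe_fixed (det_map_ne_zero hM)]; rfl

theorem realPSL_infty_fixed {M : RMat} (hM : M.det ≠ 0) :
    mobius (realPSL M) ∞ = ∞ ↔ M 1 0 = 0 := by
  rw [realPSL, mobius_infty_eq_infty (det_map_ne_zero hM)]
  simp

/-! ### The canonical generators -/

theorem isClassOf_realPSL {M : RMat} (hM : M.det = 1) : IsClassOf (realPSL M) M :=
  ⟨⟨M.map Complex.ofReal, det_map_eq_one hM⟩, rfl,
    toPSL_coe ⟨M.map Complex.ofReal, det_map_eq_one hM⟩⟩

namespace IsHyperbolicSignature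
variable {ν : Fin 3 → ℕ∞}

theorem fixed_matA (hν : IsHyperbolicSignature ν) (z : OnePoint ℂ)
    (hz : mobius (realPSL (matA ν)) z = z) : z ∈ imaginaryAxis.points := by
  cases z with
  | infty => exact infty_mem_imaginaryAxis
  | coe z =>
    rw [realPSL_coe_fixed (by simp [hν.det_matA])] at hz
    have hl := hν.lParam_pos
    have hn := hν.nParam_pos
    rw [coe_mem_imaginaryAxis]
    refine re_eq_zero_of_sq (s := sinPi (ν 0) ^ 2 * lParam ν / nParam ν)
      (t := nParam ν / lParam ν) (by positivity) (by positivity) (.inr (by positivity)) ?_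
    rw [← hz]
    simp [matA]

theorem fixed_matB (hν : IsHyperbolicSignature ν) (z : OnePoint ℂ)
    (hz : mobius (realPSL (matB ν)) z = z) : z ∈ imaginaryAxis.points := by
  cases z with
  | infty => exact infty_mem_imaginaryAxis
  | coe z =>
    rw [realPSL_coe_fixed (by simp [hν.det_matB])] at hz
    have hl := hν.lParam_pos
    have hn := hν.nParam_pos
    have hd := hν.dParam_pos
    rw [coe_mem_imaginaryAxis]
    refine re_eq_zero_of_sq (s := dParam ν * lParam ν / nParam ν)
      (t := nParam ν * sinPi (ν 1) ^ 2 / (lParam ν * dParam ν)) (by positivity) (by positivity)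
      (.inl (by positivity)) ?_
    rw [← hz]
    simp [matB]

theorem fixed_mul (hν : IsHyperbolicSignature ν) (z : OnePoint ℂ)
    (hz : mobius (realPSL (matA ν) * realPSL (matB ν)) z = z) : z ∈ lineThroughOne.points := by
  cases z with
  | infty => exact infty_mem_lineThroughOne
  | coe z =>
    rw [hν.realPSL_mul_matB, realPSL_coe_fixed (by simp [hν.det_matA, hν.det_matB]),
      hν.matA_mul_matB] at hz
    have hl := hν.lParam_pos
    have hl' : (lParam ν : ℂ) ≠ 0 := by exact_mod_cast hl.ne'
    rw [coe_mem_lineThroughOne]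
    -- In terms of z − 1 the equation is l(z − 1)² + p₃²/l = 0, whose roots are purely imaginary.
    have : (z - 1).re = 0 := by
      refine re_eq_zero_of_sq (s := lParam ν) (t := sinPi (ν 2) ^ 2 / lParam ν) (by positivity)
        (by positivity) (.inl (by positivity)) ?_
      simp at hz
      push_cast
      field_simp at hz ⊢
      linear_combination -hz
    rw [Complex.sub_re, Complex.one_re] at this
    linarith

theorem fixed_vertex_zero (hν : IsHyperbolicSignature ν) :
    mobius (realPSL (matA ν)) (canonicalVertices ν 0) = canonicalVertices ν 0 := by
  have hl := hν.lParam_pos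
  have hn := hν.nParam_pos
  by_cases ht : ν 0 = ⊤
  · have hv : canonicalVertices ν 0 = ∞ := by simp [canonicalVertices, ht]
    rw [hv, realPSL_infty_fixed (by simp [hν.det_matA])]
    simp [matA, ht]
  · have hp := sinPi_pos (hν.1 0) ht
    have hv : canonicalVertices ν 0 =
      (((nParam ν / (lParam ν * sinPi (ν 0)) : ℝ) * Complex.I : ℂ) : OnePoint ℂ) := by
      simp [canonicalVertices, ht]
    rw [hv, realPSL_coe_fixed (by simp [hν.det_matA])]
    have e : matA ν 1 0 * (nParam ν / (lParam ν * sinPi (ν 0))) ^ 2 + matA ν 0 1 = 0 := by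
      simp [matA]
      field_simp
      ring
    have e' : matA ν 1 1 = matA ν 0 0 := rfl
    rw [e', mul_pow, Complex.I_sq]
    have e2 : (matA ν 1 0 * ((nParam ν / (lParam ν * sinPi (ν 0)) : ℝ) : ℂ) ^ 2 + matA ν 0 1 : ℂ)
      = 0 := by exact_mod_cast e
    linear_combination -e2

theorem fixed_vertex_one (hν : IsHyperbolicSignature ν) :
    mobius (realPSL (matB ν)) (canonicalVertices ν 1) = canonicalVertices ν 1 := by
  have hl := hν.lParam_pos
  have hn := hν.nParam_pos
  have hd := hν.dParam_pos
  have hv : canonicalVertices ν 1 =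
    (((nParam ν * sinPi (ν 1) / (lParam ν * dParam ν) : ℝ) * Complex.I : ℂ) : OnePoint ℂ) := rfl
  rw [hv, realPSL_coe_fixed (by simp [hν.det_matB])]
  have e : matB ν 1 0 * (nParam ν * sinPi (ν 1) / (lParam ν * dParam ν)) ^ 2 + matB ν 0 1 = 0 := by
    simp [matB]
    field_simp
    ring
  have e' : matB ν 1 1 = matB ν 0 0 := rfl
  rw [e', mul_pow, Complex.I_sq]
  have e2 : (matB ν 1 0 * ((nParam ν * sinPi (ν 1) / (lParam ν * dParam ν) : ℝ) : ℂ) ^ 2 +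
    matB ν 0 1 : ℂ) = 0 := by exact_mod_cast e
  linear_combination -e2

theorem vertex_mem (hν : IsHyperbolicSignature ν) :
    canonicalVertices ν 0 ∈ imaginaryAxis.points ∧
      canonicalVertices ν 1 ∈ imaginaryAxis.points :=
  ⟨hν.fixed_matA _ hν.fixed_vertex_zero, hν.fixed_matB _ hν.fixed_vertex_one⟩

/-- For finite ν₁ and ν₂ the fixed points are yi and xi with cross ratio y/(y − x), which is greater
than 1 because p₁p₂ < d makes 0 < x < y. An ideal vertex is the parameter ∞ or 0 itself. -/
theorem wellOrdered_canonical (hν : IsHyperbolicSignature ν) :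
    WellOrdered ∞ ((0 : ℂ) : OnePoint ℂ) (canonicalVertices ν 0) (canonicalVertices ν 1) := by
  have hl := hν.lParam_pos
  have hn := hν.nParam_pos
  have hd := hν.dParam_pos
  have hne := hν.isTriangle_canonical.injective.ne (show (0 : Fin 3) ≠ 1 by decide)
  refine ⟨hne, ?_⟩
  by_cases h0 : ν 0 = ⊤
  · left; simp [canonicalVertices, h0]
  by_cases h1 : ν 1 = ⊤
  · right; left; simp [canonicalVertices, h1]
  have hp := sinPi_pos (hν.1 0) h0
  have hq := sinPi_pos (hν.1 1) h1
  have hlt := hν.sin_mul_sin_lt_dParam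
  set y := nParam ν / (lParam ν * sinPi (ν 0)) with hy
  set x := nParam ν * sinPi (ν 1) / (lParam ν * dParam ν) with hx
  have hv : canonicalVertices ν 0 = ((y * Complex.I : ℂ) : OnePoint ℂ) := by
    simp [canonicalVertices, h0, hy]
  have hv1 : canonicalVertices ν 1 = ((x * Complex.I : ℂ) : OnePoint ℂ) := rfl
  have hy0 : 0 < y := by positivity
  have hx0 : 0 < x := by positivity
  have hxy : x < y := by
    have : y - x = nParam ν / (lParam ν * sinPi (ν 0) * dParam ν) *
        (dParam ν - sinPi (ν 0) * sinPi (ν 1)) := by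
      rw [hx, hy]; field_simp
    have h2 : 0 < dParam ν - sinPi (ν 0) * sinPi (ν 1) := sub_pos.mpr hlt
    have h3 : 0 < y - x := by rw [this]; positivity
    linarith
  right; right
  rw [hv, hv1] at hne ⊢
  refine ⟨OnePoint.coe_ne_infty _, ?_, y / (y - x), ?_, ?_⟩
  · intro h
    have := OnePoint.coe_injective h
    simp at this
    exact hx0.ne' this
  · rw [one_lt_div (by linarith)]; linarith
  · rw [crossRatio_infty_zero (fun h => hne (by rw [h]))]
    congr 1
    have h3 : ((y : ℂ) - x) ≠ 0 := by exact_mod_cast (by linarith : y - x ≠ 0)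
    rw [← sub_mul, mul_div_mul_right _ _ Complex.I_ne_zero]
    push_cast
    rfl

/-- Existence of canonical generators for the parameters `(∞, 0, 1)`. -/
theorem isCanonicalPair (hν : IsHyperbolicSignature ν) :
    IsCanonicalPair ∞ ((0 : ℂ) : OnePoint ℂ) ((1 : ℂ) : OnePoint ℂ) ν
      (realPSL (matA ν)) (realPSL (matB ν)) := by
  have h := hν.isMirrorTriple
  have hT := hν.isTriangle_canonical
  refine ⟨evenGroup (canonicalMirrors ν), hν.isTriangleGroup_canonical, SphereCircle.realLine,
    imaginaryAxis, lineThroughOne, ⟨infty_mem_realLine, (coe_mem_realLine _).mpr rfl,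
    (coe_mem_realLine _).mpr rfl⟩, ⟨(orthogonal_realLine_iff _).mpr rfl, infty_mem_imaginaryAxis,
    coe_mem_imaginaryAxis.mpr rfl⟩, ⟨(orthogonal_realLine_iff _).mpr rfl,
    infty_mem_lineThroughOne, coe_mem_lineThroughOne.mpr rfl⟩, h.limitSet_evenGroup hν,
    hν.evenGroup_canonical, ⟨hν.hasOrder_matA.1, hν.hasOrder_matB.1, hν.hasOrder_mul⟩,
    ⟨hν.fixed_matA, hν.fixed_matB, hν.fixed_mul⟩,
    ⟨canonicalVertices ν 0, ⟨hν.vertex_mem.1, (mem_closure_disc_standard _).mpr (hT.isUpper 0)⟩,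
      canonicalVertices ν 1, ⟨hν.vertex_mem.2, (mem_closure_disc_standard _).mpr (hT.isUpper 1)⟩,
      hν.fixed_vertex_zero, hν.fixed_vertex_one, hν.wellOrdered_canonical⟩,
    ⟨?_, ?_⟩, hν.hasOrder_matA.2, hν.hasOrder_matB.2⟩
  · rw [← hν.rotation_zero]; exact h.isPrimitive_rotation hν 0
  · rw [← hν.rotation_one]; exact h.isPrimitive_rotation hν 1

end IsHyperbolicSignature

/-! ### The explicit forms of the canonical matrices -/

theorem matA_parabolic {ν₁ ν₂ : ℕ∞} (hν : IsHyperbolicSignature ![⊤, ν₁, ν₂]) :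
    matA ![⊤, ν₁, ν₂] = !![-1, -2; 0, -1] ∧
    matB ![⊤, ν₁, ν₂] = !![-cosPi ν₁, (cosPi ν₁ ^ 2 - 1) / (cosPi ν₁ + cosPi ν₂);
      cosPi ν₁ + cosPi ν₂, -cosPi ν₁] := by
  have h1 : 0 ≤ cosPi ν₁ := cosPi_nonneg (hν.1 1)
  have h2 : 0 ≤ cosPi ν₂ := cosPi_nonneg (hν.1 2)
  -- With cos(π/∞) = 1 the number l² is a perfect square, and `nParam` and `dParam` both become 2l.
  have hl : lParam ![⊤, ν₁, ν₂] = cosPi ν₁ + cosPi ν₂ := by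
    rw [lParam, ← Real.sqrt_sq (add_nonneg h1 h2)]
    congr 1
    simp [lSq]; ring
  have hpos := hν.lParam_pos
  rw [hl] at hpos
  have hn : nParam ![⊤, ν₁, ν₂] = 2 * (cosPi ν₁ + cosPi ν₂) := by
    rw [nParam, hl]; simp; ring
  have hd : dParam ![⊤, ν₁, ν₂] = 2 * (cosPi ν₁ + cosPi ν₂) := by
    rw [dParam, hl]; simp; ring
  have hs := sinPi_sq ν₁
  refine ⟨?_, ?_⟩
  · rw [matA, hn, hl]
    ext i j
    fin_cases i <;> fin_cases j <;> simp
    field_simp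
  · rw [matB, hn, hd, hl]
    ext i j
    fin_cases i <;> fin_cases j <;> simp
    · field_simp
      linear_combination -hs
    · field_simp

/-- Here kp₁ = `nParam ν / lParam ν`. The entries of `matA` and `matB` are written without division
by p₁ or p₂, so that ideal vertices are included there; k and h need p₁, p₂ ≠ 0. -/
theorem mat_finite {ν : Fin 3 → ℕ∞} (hν : IsHyperbolicSignature ν) (hfin : ∀ j, ν j ≠ ⊤) :
    matA ν = !![-cosPi (ν 0), -(kParam ν * sinPi (ν 0)); (kParam ν)⁻¹ * sinPi (ν 0),
      -cosPi (ν 0)] ∧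
    matB ν = !![-cosPi (ν 1), -(hParam ν * sinPi (ν 1)); (hParam ν)⁻¹ * sinPi (ν 1),
      -cosPi (ν 1)] := by
  have hp := sinPi_pos (hν.1 0) (hfin 0)
  have hq := sinPi_pos (hν.1 1) (hfin 1)
  have hl := hν.lParam_pos
  have hn := hν.nParam_pos
  have hd := hν.dParam_pos
  have hk : kParam ν = nParam ν / (sinPi (ν 0) * lParam ν) := rfl
  have hh : hParam ν = nParam ν * sinPi (ν 1) / (lParam ν * dParam ν) := by
    have : hParam ν = kParam ν * sinPi (ν 0) * sinPi (ν 1) / dParam ν := rfl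
    rw [this, hk]
    field_simp
  refine ⟨?_, ?_⟩
  · rw [matA, hk]
    ext i j
    fin_cases i <;> fin_cases j <;> simp <;> field_simp
  · rw [matB, hh]
    ext i j
    fin_cases i <;> fin_cases j <;> simp <;> field_simp

/-! ### Primitive elements with a fixed point in the closed hyperbolic plane -/

theorem HasOrder.ne_one {A : PSL(2, ℂ)} {n : ℕ∞} (hn : 2 ≤ n) (h : HasOrder A n) : A ≠ 1 := by
  rcases h with ⟨-, h⟩ | ⟨-, -, h⟩
  · rintro rfl
    exact OnePoint.infty_ne_coe (0 : ℂ) (h.unique (by simp) (by simp))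
  · exact orderOf_ne_one hn h

/-- The default value of `orderOf` for infinite order; finite order is excluded by tr² = 4. -/
theorem IsParabolic.orderOf_eq_zero {A : PSL(2, ℂ)} (h : IsParabolic A) : orderOf A = 0 := by
  by_contra h0
  obtain ⟨M, hM, rfl⟩ := exists_toPSL A
  exact trace_sq_ne_four hM (orderOf_ne_zero_iff.mp h0)
    (HasOrder.ne_one le_top (.inl ⟨rfl, h⟩)) (h.trace_sq hM)

/-- The value 0 of `orderOf` corresponds to ∞, so equality of orders identifies the entries of the
signature in all cases. -/
theorem HasOrder.eq_of_orderOf_eq {A B : PSL(2, ℂ)} {m n : ℕ∞} (hA : HasOrder A m)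
    (hB : HasOrder B n) (h : orderOf A = orderOf B) : m = n := by
  rcases hA with ⟨rfl, hA⟩ | ⟨-, hA, rfl⟩ <;> rcases hB with ⟨rfl, hB⟩ | ⟨-, hB, rfl⟩
  · rfl
  · exact absurd (h.symm.trans hA.orderOf_eq_zero) (orderOf_ne_zero_iff.mpr hB)
  · exact absurd (h.trans hB.orderOf_eq_zero) (orderOf_ne_zero_iff.mpr hA)
  · rw [h]

namespace IsMirrorTriple
variable {R : Fin 3 → V3} {ν : Fin 3 → ℕ∞}

theorem wordAct_reverse (h : IsMirrorTriple R ν) (L : List (Fin 3)) (v : V3) :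
    wordAct R L.reverse (wordAct R L v) = v := by
  rw [← h.rep_wordProd, ← h.rep_wordProd, wordProd_reverse h.gen_sq, ← Module.End.mul_apply,
    ← map_mul]
  simp

theorem hasOrder_rotation (h : IsMirrorTriple R ν) (hν : IsHyperbolicSignature ν) (i : Fin 3) :
    HasOrder (rotation R i) (ν i) := by
  have hne := h.rotation_ne_one hν i
  rw [h.rotation_eq] at hne ⊢
  refine (hasOrder_of_trace (h.det_rotation i) (hν.1 i) ?_ hne).1
  rw [trace_toMat_mul, h.gram]; ring

theorem tracelessPart_conj (h : IsMirrorTriple R ν) (L : List (Fin 3)) (M : RMat) :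
    tracelessPart (wordMat R L * M * (wordMat R L).adjugate) =
      wordAct R L (tracelessPart M) := by
  have h1 := h.toMat_wordAct L (tracelessPart M)
  have h2 : wordMat R L * M * (wordMat R L).adjugate =
      (M.trace / 2 * (wordMat R L).det) • (1 : RMat) + toMat (wordAct R L (tracelessPart M)) := by
    rw [h1]
    conv_lhs => rw [eq_add_toMat M]
    rw [mul_add, add_mul, Matrix.mul_smul, mul_one, Matrix.smul_mul, Matrix.mul_adjugate, smul_smul]
  rw [h2]
  ext i; fin_cases i <;> simp [tracelessPart, toMat]

theorem realPSL_conj (h : IsMirrorTriple R ν) (L : List (Fin 3)) {M : RMat} (hM : M.det = 1) :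
    realPSL (wordMat R L * M * (wordMat R L).adjugate) =
      wordProd (mirrorPSL R) L * realPSL M * (wordProd (mirrorPSL R) L)⁻¹ := by
  have hd := h.det_wordMat_ne_zero L
  have hd' : (wordMat R L).adjugate.det ≠ 0 := by rw [Matrix.det_adjugate]; simpa using hd
  rw [← h.realPSL_wordMat, realPSL_inv hd, realPSL_mul (by simp [hd, hM]) hd',
    realPSL_mul hd (by simp [hM])]

theorem conj_rotation_mem (h : IsMirrorTriple R ν) (L : List (Fin 3)) (i : Fin 3) :
    (wordProd (mirrorPSL R) L)⁻¹ * rotation R i * wordProd (mirrorPSL R) L ∈ evenGroup R := by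
  rw [h.mem_evenGroup_iff]
  refine ⟨L.reverse ++ [i + 1, i + 2] ++ L, ?_, ?_⟩
  · refine ⟨L.length + 1, ?_⟩
    simp; ring
  · rw [wordProd_append, wordProd_append, wordProd_reverse h.mirrorPSL_sq]
    simp [rotation]

theorem eq_or_eq_neg_of_realPSL_eq {M M' : RMat} (hM : M.det = 1) (hM' : M'.det = 1)
    (h : realPSL M = realPSL M') : M' = M ∨ M' = -M := by
  obtain ⟨c, -, rfl⟩ := eq_smul_of_realPSL_eq (by simp [hM]) (by simp [hM']) h
  rw [Matrix.det_smul, hM, Fintype.card_fin, mul_one, sq] at hM'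
  rcases mul_self_eq_one_iff.mp hM' with rfl | rfl
  · left; simp
  · right; simp

/-- A primitive elliptic or parabolic element is, up to conjugation, a rotation about a vertex;
its traceless part is determined by the vertex, up to the sign. -/
theorem exists_vertex (h : IsMirrorTriple R ν) (hν : IsHyperbolicSignature ν) {M : RMat}
    (hM : M.det = 1) {n : ℕ∞} (hn : 2 ≤ n) (htr : M.trace ^ 2 = 4 * cosPi n ^ 2)
    (hord : HasOrder (realPSL M) n) (hprim : IsPrimitive (evenGroup R) (realPSL M)) :
    ∃ (L : List (Fin 3)) (i : Fin 3) (c : ℝ), c ^ 2 = lSq ν ∧ ν i = n ∧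
      wordAct R L (tracelessPart M) = c • dual R ν i := by
  obtain ⟨L₀, hL₀, hML₀⟩ := (h.mem_evenGroup_iff _).mp hprim.1
  have hd := h.det_wordMat L₀
  rw [hL₀.neg_one_pow] at hd
  have hne := hord.ne_one hn
  have hcos := cosPi_le_one n
  have hcos0 := cosPi_nonneg hn
  rw [← h.realPSL_wordMat] at hML₀
  have hsgn := eq_or_eq_neg_of_realPSL_eq hM hd hML₀
  have htr₀ : (wordMat R L₀).trace ^ 2 ≤ 4 := by
    have : (wordMat R L₀).trace ^ 2 = M.trace ^ 2 := by
      rcases hsgn with h | h <;> rw [h]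
      rw [Matrix.trace_neg, neg_sq]
    rw [this, htr]
    nlinarith
  obtain ⟨L, i, c, hc, hLc, hz⟩ := h.exists_conj_rotation hν hL₀
    (by rw [← h.realPSL_wordMat, ← hML₀]; exact hne) htr₀
  obtain ⟨c, hLc⟩ : ∃ c : ℝ, wordAct R L (tracelessPart M) = c • dual R ν i := by
    rcases hsgn with h' | h'
    · exact ⟨c, by rw [← h', hLc]⟩
    · refine ⟨-c, ?_⟩
      have : M = (-1 : ℝ) • wordMat R L₀ := by rw [h']; simp
      rw [this, tracelessPart_smul, h.wordAct_smul, hLc, smul_smul, neg_one_mul]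
  rw [← h.realPSL_wordMat L₀, ← hML₀] at hz
  set g := wordProd (mirrorPSL R) L with hg
  obtain ⟨k, hk⟩ := hz
  replace hk : rotation R i ^ k = g * realPSL M * g⁻¹ := hk
  set C := g⁻¹ * rotation R i * g with hC
  have hCk : C ^ k = realPSL M := by
    have e : C = g⁻¹ * rotation R i * g⁻¹⁻¹ := by rw [hC, inv_inv]
    rw [e, conj_zpow, hk]; group
  -- The element is a power of the conjugate `C` of a rotation; primitivity makes the two cyclic
  -- groups, and so the orders, equal.
  have hzp := hprim.2 C (h.conj_rotation_mem L i) k hCk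
  have horder : orderOf (realPSL M) = orderOf (rotation R i) := by
    have e : C = g⁻¹ * rotation R i * g⁻¹⁻¹ := by rw [hC, inv_inv]
    rw [← Nat.card_zpowers, ← hzp, Nat.card_zpowers, e, orderOf_conj']
  have hni : n = ν i := hord.eq_of_orderOf_eq (h.hasOrder_rotation hν i) horder
  refine ⟨L, i, c, ?_, hni.symm, hLc⟩
  -- All vectors here are isotropic in the parabolic case, so norms say nothing. Instead, both
  -- elements generate the same infinite cyclic group; the exponent is ±1 and the traceless parts
  -- agree up to sign.
  by_cases hnt : n = ⊤
  · have hp : IsParabolic (realPSL M) := by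
      rcases hord with ⟨-, h⟩ | ⟨h, -⟩
      · exact h
      · exact absurd hnt h
    have h0 := hp.orderOf_eq_zero
    obtain ⟨m, hm⟩ : C ∈ Subgroup.zpowers (realPSL M) := by
      rw [← hzp]; exact Subgroup.mem_zpowers C
    replace hm : realPSL M ^ m = C := hm
    have hkm : m * k = 1 := by
      rw [← hm, ← zpow_mul] at hCk
      have hinj : Function.Injective fun n : ℤ => realPSL M ^ n :=
        injective_zpow_iff_not_isOfFinOrder.mpr (orderOf_eq_zero_iff.mp h0)
      exact hinj (by simpa using hCk)
    obtain ⟨e, he, hrot⟩ := h.tracelessPart_rotation hν i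
    have hdet : (wordMat R L * M * (wordMat R L).adjugate).det = 1 := by
      rw [Matrix.det_mul, Matrix.det_mul, Matrix.det_adjugate, hM, h.det_wordMat]
      simp [← pow_add, ← two_mul]
    rw [← h.realPSL_conj L hM] at hk
    have hfin : wordAct R L (tracelessPart M) = e • dual R ν i ∨
        wordAct R L (tracelessPart M) = (-e) • dual R ν i := by
      have key : ∀ X : RMat, X.det = 1 → realPSL X =
          realPSL (wordMat R L * M * (wordMat R L).adjugate) →
          wordAct R L (tracelessPart M) = tracelessPart X ∨
          wordAct R L (tracelessPart M) = -tracelessPart X := by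
        intro X hX hXe
        rw [← h.tracelessPart_conj]
        rcases eq_or_eq_neg_of_realPSL_eq hX hdet hXe with h' | h'
        · left; rw [h']
        · right
          rw [h', show -X = (-1 : ℝ) • X by simp, tracelessPart_smul]; simp
      rcases Int.eq_one_or_neg_one_of_mul_eq_one' hkm with ⟨-, rfl⟩ | ⟨-, rfl⟩
      · rw [zpow_one, h.rotation_eq] at hk
        have := key _ (h.det_rotation i) hk
        rwa [hrot, ← neg_smul] at this
      · rw [zpow_neg, zpow_one, h.rotation_eq, realPSL_inv (by rw [h.det_rotation]; simp)] at hk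
        have := key _ (by rw [Matrix.det_adjugate, h.det_rotation]; simp) hk
        rw [tracelessPart_adjugate, hrot, neg_neg, ← neg_smul] at this
        exact this.symm
    have hinj : ∀ d : ℝ, wordAct R L (tracelessPart M) = d • dual R ν i → c = d := by
      intro d hd
      rw [hLc] at hd
      exact smul_left_injective ℝ (h.dual_ne_zero hν i) hd
    rcases hfin with hf | hf
    · rw [hinj _ hf, he]
    · rw [hinj _ hf, neg_sq, he]
  -- For finite n the norm decides: it is −sin²(π/n) for the traceless part and −sin²(π/n)/l² for
  -- the dual vector.
  · have h1 := h.form_wordAct hν L (tracelessPart M) (tracelessPart M)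
    rw [hLc, form_tracelessPart, hM] at h1
    simp only [map_smul, LinearMap.smul_apply, smul_eq_mul] at h1
    rw [(h.form_dual_dual hν.lSq_pos i).1, ← hni] at h1
    have hp := sinPi_pos hn hnt
    have hs := sinPi_sq n
    have hl := hν.lSq_pos
    have h2 : c ^ 2 * sinPi n ^ 2 = lSq ν * sinPi n ^ 2 := by
      field_simp at h1
      nlinarith
    exact mul_right_cancel₀ (pow_ne_zero 2 hp.ne') h2

/-- The distance of two vertices. -/
theorem le_sq_form (h : IsMirrorTriple R ν) (hν : IsHyperbolicSignature ν) {u w : V3}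
    {L L' : List (Fin 3)} {i j : Fin 3} {c d : ℝ} (hc : c ^ 2 = lSq ν) (hd : d ^ 2 = lSq ν)
    (hi : ν i = ν 0) (hj : ν j = ν 1) (hu : wordAct R L u = c • dual R ν i)
    (hw : wordAct R L' w = d • dual R ν j) (hne : ∀ r : ℝ, u ≠ r • w) :
    cosPi (ν 0) * cosPi (ν 1) + cosPi (ν 2) ≤ |form u w| := by
  have hl := hν.lSq_pos
  have hd0 : d ≠ 0 := by rintro rfl; rw [← hd] at hl; simp at hl
  have hq := fun i => cosPi_nonneg (hν.1 i)
  have hu' : u = c • wordAct R L.reverse (dual R ν i) := by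
    rw [← h.wordAct_smul, ← hu, h.wordAct_reverse]
  set x := form (wordAct R (L' ++ L.reverse) (dual R ν i)) (dual R ν j) with hx
  have hform : form u w = c * d * x := by
    rw [← h.form_wordAct hν L', hw]
    conv_lhs => rw [hu', h.wordAct_smul]
    simp only [map_smul, LinearMap.smul_apply, smul_eq_mul, hx, wordAct_append]
    ring
  have habs : |form u w| = lSq ν * |x| := by
    have : |c * d| = lSq ν := by
      rw [← Real.sqrt_sq_eq_abs, mul_pow, hc, hd, ← sq, Real.sqrt_sq hl.le]
    rw [hform, abs_mul, this]
  rw [habs]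
  have hbound : ∀ y : ℝ, x ≤ -(y / lSq ν) → 0 ≤ y → y ≤ lSq ν * |x| := by
    intro y hy hy0
    have h1 : y / lSq ν ≤ |x| := by
      have := neg_le_abs x
      linarith
    rwa [div_le_iff₀ hl, mul_comm] at h1
  -- The vertices i and j need not be 0 and 1, only their entries in the signature agree. When i ≠
  -- j, the invariant sum shows that the third cosine is q₃.
  have hsum : ∀ k : Fin 3, cosPi (ν k) + cosPi (ν (k + 1)) + cosPi (ν (k + 2)) =
      cosPi (ν 0) + cosPi (ν 1) + cosPi (ν 2) := by
    intro k
    fin_cases k <;> simp only [Fin.zero_eta, Fin.mk_one, Fin.reduceFinMk, Fin.reduceAdd, zero_add,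
      Fin.isValue] <;> ring
  have hk := hsum i
  rcases (by grind : j = i ∨ j = i + 1 ∨ j = i + 2) with rfl | rfl | rfl
  -- Two vertices of one type, possible when ν₁ = ν₂. They are distinct because `u` and `w` are not
  -- proportional, so the stronger bound with the additional −2 applies.
  · have hne' : wordAct R (L' ++ L.reverse) (dual R ν j) ≠ dual R ν j := by
      intro heq
      apply hne (c * d⁻¹)
      rw [wordAct_append] at heq
      have h1 : w = d • wordAct R L'.reverse (dual R ν j) := by
        rw [← h.wordAct_smul, ← hw, h.wordAct_reverse]
      rw [h1, smul_smul, hu']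
      rw [mul_assoc, inv_mul_cancel₀ hd0, mul_one]
      congr 1
      rw [← heq, h.wordAct_reverse]
      rw [heq]
    have hself := h.form_wordAct_dual_self_le hν _ j hne'
    rw [(h.form_dual_dual hl j).1] at hself
    have hs := sinPi_sq (ν j)
    have h01 : cosPi (ν 0) = cosPi (ν 1) := by rw [← hi, ← hj]
    have hlt : sinPi (ν 0) * sinPi (ν 1) < cosPi (ν 0) * cosPi (ν 1) + cosPi (ν 2) :=
      hν.sin_mul_sin_lt 2
    rw [← hi, ← hj] at hlt ⊢
    have hls : lSq ν = cosPi (ν j) ^ 2 + cosPi (ν j) ^ 2 + cosPi (ν 2) ^ 2 +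
        2 * cosPi (ν j) * cosPi (ν j) * cosPi (ν 2) - 1 := by
      rw [lSq, ← hi, ← hj]
    have hq2 := hq 2
    refine le_trans ?_ (hbound (sinPi (ν j) ^ 2 + 2 * lSq ν) ?_ (by positivity))
    · rw [hls, hs]
      -- With q = q₁ = q₂, the difference p² + 2l² − (q² + q₃) factors as (1 + 2q₃)(2q² − 1 + q₃).
      have h3 : 0 < 2 * cosPi (ν j) ^ 2 - 1 + cosPi (ν 2) := by nlinarith
      nlinarith [mul_pos (by linarith : 0 < 1 + 2 * cosPi (ν 2)) h3]
    · refine hself.trans (le_of_eq ?_)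
      field_simp
      ring
  · have h1 := h.form_wordAct_dual_le hν (L' ++ L.reverse) i (i + 1)
    rw [(h.form_dual_dual hl i).2.1] at h1
    rw [hi, hj] at h1 hk
    have h2 : cosPi (ν (i + 2)) = cosPi (ν 2) := by linarith
    rw [h2] at h1
    exact hbound _ h1 (add_nonneg (mul_nonneg (hq _) (hq _)) (hq _))
  · have h1 := h.form_wordAct_dual_le hν (L' ++ L.reverse) i (i + 2)
    rw [(h.form_dual_dual hl i).2.2] at h1
    rw [hi, hj] at h1 hk
    have h2 : cosPi (ν (i + 1)) = cosPi (ν 2) := by linarith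
    rw [h2] at h1
    exact hbound _ h1 (add_nonneg (mul_nonneg (hq _) (hq _)) (hq _))

end IsMirrorTriple

/-! ### Triangle groups with the real line as limit set -/

theorem homog_im {x : OnePoint ℂ} (hx : x ∈ SphereCircle.realLine.points) :
    (homog x).1.im = 0 ∧ (homog x).2.im = 0 := by
  cases x with
  | infty => simp [homog_infty]
  | coe z => exact ⟨(coe_mem_realLine z).mp hx, by simp [homog_coe]⟩

theorem bracket_im {x y : OnePoint ℂ} (hx : x ∈ SphereCircle.realLine.points)
    (hy : y ∈ SphereCircle.realLine.points) : (bracket x y).im = 0 := by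
  obtain ⟨h1, h2⟩ := homog_im hx
  obtain ⟨h3, h4⟩ := homog_im hy
  simp [bracket, h1, h2, h3, h4]

/-- A Moebius transformation that maps `∞, 0, 1` into the extended real line is real. -/
theorem exists_realPSL {T : PSL(2, ℂ)} (h0 : mobius T ∞ ∈ SphereCircle.realLine.points)
    (h1 : mobius T ((0 : ℂ) : OnePoint ℂ) ∈ SphereCircle.realLine.points)
    (h2 : mobius T ((1 : ℂ) : OnePoint ℂ) ∈ SphereCircle.realLine.points) :
    ∃ N : RMat, N.det ≠ 0 ∧ T = realPSL N := by
  have hinj := (mobius T).injective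
  have hab := hinj.ne (OnePoint.infty_ne_coe (0 : ℂ))
  have hac := hinj.ne (OnePoint.infty_ne_coe (1 : ℂ))
  have hbc := hinj.ne (show ((0 : ℂ) : OnePoint ℂ) ≠ ((1 : ℂ) : OnePoint ℂ) from
    fun h => zero_ne_one (OnePoint.coe_injective h))
  have hdet := det_standardMatrix hab hac hbc
  obtain ⟨e0, e1, e2⟩ := mobius_standardMatrix hab hac hbc
  set K := standardMatrix (mobius T ∞) (mobius T ((0 : ℂ) : OnePoint ℂ))
    (mobius T ((1 : ℂ) : OnePoint ℂ)) with hK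
  have hreal : (K.map Complex.re).map Complex.ofReal = K := by
    obtain ⟨a1, a2⟩ := homog_im h0
    obtain ⟨b1, b2⟩ := homog_im h1
    have k1 := bracket_im h2 h0
    have k2 := bracket_im h2 h1
    have him : ∀ i j, (K i j).im = 0 := by
      intro i j
      rw [hK, standardMatrix]
      fin_cases i <;> fin_cases j <;> simp [a1, a2, b1, b2, k1, k2]
    ext i j
    exact Complex.ext (by simp) (by simp [him])
  have hKdet : (K.map Complex.re).det ≠ 0 := by
    intro h
    rw [← hreal, det_map_ofReal, h] at hdet
    simp at hdet
  have hone : toPSL K * T = 1 := by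
    apply eq_one_of_fixes_three <;> rw [map_mul, Equiv.Perm.mul_apply] <;> assumption
  refine ⟨(K.map Complex.re).adjugate, by rw [Matrix.det_adjugate]; simpa using hKdet, ?_⟩
  rw [← realPSL_inv hKdet, realPSL, hreal]
  exact eq_inv_of_mul_eq_one_right hone

/-- Conjugates of a triple of mirrors. -/
theorem IsMirrorTriple.exists_conj {R : Fin 3 → V3} {ν : Fin 3 → ℕ∞} (h : IsMirrorTriple R ν)
    {N : RMat} (hN : N.det ≠ 0) : ∃ R' : Fin 3 → V3, IsMirrorTriple R' ν ∧
      evenGroup R' = (evenGroup R).map (MulAut.conj (realPSL N)).toMonoidHom := by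
  have hNu : IsUnit N.det := hN.isUnit
  have hinv : N⁻¹ * N = 1 := Matrix.nonsing_inv_mul N hNu
  -- Mirrors are transported by matrix conjugation. It preserves traces, hence the form, for either
  -- sign of det N.
  have hmul : ∀ X Y : RMat, N * X * N⁻¹ * (N * Y * N⁻¹) = N * (X * Y) * N⁻¹ := by
    intro X Y
    calc _ = N * X * (N⁻¹ * N) * Y * N⁻¹ := by simp only [mul_assoc]
      _ = _ := by rw [hinv, mul_one]; simp only [mul_assoc]
  have htr : ∀ X : RMat, (N * X * N⁻¹).trace = X.trace := by
    intro X
    rw [Matrix.trace_mul_comm, ← mul_assoc, hinv, one_mul]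
  have htoMat : ∀ v, toMat (tracelessPart (N * toMat v * N⁻¹)) = N * toMat v * N⁻¹ := by
    intro v
    have h1 := eq_add_toMat (N * toMat v * N⁻¹)
    have h2 : (N * toMat v * N⁻¹).trace = 0 := by
      rw [htr]; simp [toMat, Matrix.trace_fin_two]
    rw [h2] at h1
    simpa using h1.symm
  have hform : ∀ v w, form (tracelessPart (N * toMat v * N⁻¹)) (tracelessPart (N * toMat w * N⁻¹))
      = form v w := by
    intro v w
    have h1 := trace_toMat_mul v w
    have h2 := trace_toMat_mul (tracelessPart (N * toMat v * N⁻¹))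
      (tracelessPart (N * toMat w * N⁻¹))
    rw [htoMat, htoMat, hmul, htr, h1] at h2
    linarith
  have h' : IsMirrorTriple (fun i => tracelessPart (N * toMat (R i) * N⁻¹)) ν :=
    ⟨fun i => by rw [hform, h.norm], fun i => by rw [hform, h.gram]⟩
  refine ⟨_, h', ?_⟩
  have hNinv : realPSL N⁻¹ = (realPSL N)⁻¹ := by
    rw [eq_comm, inv_eq_iff_mul_eq_one, ← realPSL_mul hN
      (by rw [Matrix.det_nonsing_inv]; simpa using hN), Matrix.mul_nonsing_inv N hNu, realPSL_one]
  have hrot : ∀ i, rotation (fun i => tracelessPart (N * toMat (R i) * N⁻¹)) i =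
      realPSL N * rotation R i * (realPSL N)⁻¹ := by
    intro i
    rw [h'.rotation_eq, htoMat, htoMat, hmul, realPSL_mul _ _, realPSL_mul hN _, ← h.rotation_eq,
      hNinv]
    · rw [h.det_rotation]; simp
    · rw [Matrix.det_mul, h.det_rotation]; simpa using hN
    · rw [Matrix.det_nonsing_inv]; simpa using hN
  rw [evenGroup, evenGroup, MonoidHom.map_closure, ← Set.range_comp]
  congr 2
  funext i
  exact hrot i

theorem mem_limitSet_conj_iff (U : PSL(2, ℂ)) {Γ : Subgroup PSL(2, ℂ)} {x : OnePoint ℂ} :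
    mobius U x ∈ limitSet (Γ.map (MulAut.conj U).toMonoidHom) ↔ x ∈ limitSet Γ := by
  rw [limitSet, limitSet, Set.mem_compl_iff, Set.mem_compl_iff, mem_discontinuitySet_conj_iff]

/-- Triangle groups with the real line as limit set are generated by mirrors. -/
theorem IsTriangleGroup.exists_mirrors {Γ : Subgroup PSL(2, ℂ)} {ν : Fin 3 → ℕ∞}
    (hν : IsHyperbolicSignature ν) (h : IsTriangleGroup Γ ν)
    (hlim : limitSet Γ = SphereCircle.realLine.points) :
    ∃ R : Fin 3 → V3, IsMirrorTriple R ν ∧ Γ = evenGroup R := by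
  obtain ⟨v, S, T, hv, hS, rfl⟩ := h.triangle
  obtain ⟨R, hR, hSR⟩ := hv.exists_isMirrorTriple hν.1 hS
  rw [hR.orientationPreserving_eq (fun i => (orthogonal_realLine_iff _).mp (hS i).1) hSR] at hlim ⊢
  -- Both the group of the triangle and its conjugate by `T` have the real line as limit set, so `T`
  -- preserves it and is given by a real matrix.
  have key : ∀ x ∈ SphereCircle.realLine.points, mobius T x ∈ SphereCircle.realLine.points := by
    intro x hx
    rw [← hlim, mem_limitSet_conj_iff, hR.limitSet_evenGroup hν]
    exact hx
  obtain ⟨N, hN, rfl⟩ := exists_realPSL (key _ infty_mem_realLine)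
    (key _ ((coe_mem_realLine _).mpr rfl)) (key _ ((coe_mem_realLine _).mpr rfl))
  obtain ⟨R', hR', he⟩ := hR.exists_conj hN
  exact ⟨R', hR', he.symm⟩

/-! ### The circles of the parameters `(∞, 0, 1)` -/

theorem points_eq_realLine {Λ : SphereCircle} (h0 : ∞ ∈ Λ.points)
    (h1 : ((0 : ℂ) : OnePoint ℂ) ∈ Λ.points) (h2 : ((1 : ℂ) : OnePoint ℂ) ∈ Λ.points) :
    Λ.α = 0 ∧ Λ.γ = 0 ∧ Λ.β.re = 0 ∧ Λ.β.im ≠ 0 ∧ Λ.points = SphereCircle.realLine.points := by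
  rw [SphereCircle.mem_points_iff_quad] at h0 h1 h2
  simp [SphereCircle.quad, homog_infty, homog_coe] at h0 h1 h2
  have hre : Λ.β.re = 0 := by rw [h0, h1] at h2; linarith
  have him : Λ.β.im ≠ 0 := by
    intro him
    have := Λ.nondeg
    rw [h0, Complex.normSq_apply, hre, him] at this
    simp at this
  refine ⟨h0, h1, hre, him, ?_⟩
  ext x
  rw [SphereCircle.mem_points_iff_quad]
  cases x with
  | infty => simp [SphereCircle.quad, homog_infty, h0, infty_mem_realLine]
  | coe z =>
    rw [coe_mem_realLine]
    simp [SphereCircle.quad, homog_coe, h0, h1, hre, him]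

theorem points_eq_of_orthogonal {Λ L : SphereCircle} (hΛ : ∞ ∈ Λ.points ∧
    ((0 : ℂ) : OnePoint ℂ) ∈ Λ.points ∧ ((1 : ℂ) : OnePoint ℂ) ∈ Λ.points)
    (hL : L.Orthogonal Λ) (h0 : ∞ ∈ L.points) {t : ℝ} (h1 : ((t : ℂ) : OnePoint ℂ) ∈ L.points)
    (z : ℂ) : (z : OnePoint ℂ) ∈ L.points ↔ z.re = t := by
  obtain ⟨e1, e2, e3, e4, -⟩ := points_eq_realLine hΛ.1 hΛ.2.1 hΛ.2.2
  rw [SphereCircle.mem_points_iff_quad] at h0 h1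
  simp [SphereCircle.quad, homog_infty, homog_coe] at h0 h1
  rw [SphereCircle.Orthogonal, e1, e2] at hL
  simp [e3, e4] at hL
  have hre : L.β.re ≠ 0 := by
    intro hre
    have := L.nondeg
    rw [h0, Complex.normSq_apply, hre, hL] at this
    simp at this
  rw [SphereCircle.mem_points_iff_quad]
  simp [SphereCircle.quad, homog_coe, h0, hL]
  rw [h0] at h1
  constructor
  · intro h
    have : L.β.re * (z.re - t) = 0 := by linarith
    linarith [(mul_eq_zero.mp this).resolve_left hre]
  · rintro rfl
    linarith

/-! ### Uniqueness of the canonical generators -/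

/-- The fixed points of an elliptic or parabolic element determine the ratio of the entries. -/
theorem diag_sub_eq {M : RMat} (hM : M.det = 1) (htr : M.trace ^ 2 ≤ 4) {t : ℝ}
    (hfix : ∀ z : ℂ, mobius (realPSL M) z = z → z.re = t) : M 0 0 - M 1 1 = 2 * t * M 1 0 := by
  have hd : M.det ≠ 0 := by simp [hM]
  rw [Matrix.det_fin_two] at hM
  rw [Matrix.trace_fin_two] at htr
  by_cases hc : M 1 0 = 0
  · rw [hc] at hM ⊢
    have : (M 0 0 - M 1 1) ^ 2 ≤ 0 := by nlinarith
    rw [pow_eq_zero_iff two_ne_zero |>.mp (le_antisymm this (sq_nonneg _))]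
    ring
  · have hs := Real.sq_sqrt (sub_nonneg.mpr htr)
    set s := √(4 - (M 0 0 + M 1 1) ^ 2) with hs'
    have hcC : (M 1 0 : ℂ) ≠ 0 := by exact_mod_cast hc
    -- A root of the fixed point equation, whose discriminant is tr² − 4 ≤ 0; its real part carries
    -- the information.
    have h1 := hfix (((M 0 0 - M 1 1) / (2 * M 1 0) : ℝ) + (s / (2 * M 1 0) : ℝ) * Complex.I) (by
      rw [realPSL_coe_fixed hd]
      have hsC : (s : ℂ) ^ 2 = 4 - (M 0 0 + M 1 1) ^ 2 := by exact_mod_cast hs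
      have hMC : (M 0 0 * M 1 1 - M 0 1 * M 1 0 : ℂ) = 1 := by exact_mod_cast hM
      push_cast
      field_simp
      linear_combination (s : ℂ) ^ 2 * Complex.I_sq - hsC + 4 * hMC)
    rw [Complex.add_re, Complex.re_ofReal_mul, Complex.ofReal_re, Complex.I_re, mul_zero,
      add_zero] at h1
    field_simp at h1
    linarith

/-- Elements of order `n` of a group of mirrors are represented by matrices of trace
`-2 cos (π / n)`. -/
theorem IsMirrorTriple.exists_matrix {R : Fin 3 → V3} {ν : Fin 3 → ℕ∞} (h : IsMirrorTriple R ν)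
    {A : PSL(2, ℂ)} (hA : A ∈ evenGroup R) {n : ℕ∞} (hn : 2 ≤ n) (hord : HasOrder A n)
    (hgeo : IsElliptic A → IsGeometric A)
    (hfix : ∀ z : ℂ, mobius A z = z → z.re = 0) :
    ∃ a c : ℝ, a * c = sinPi n ^ 2 ∧ A = realPSL !![-cosPi n, -a; c, -cosPi n] := by
  obtain ⟨L, hL, hAL⟩ := (h.mem_evenGroup_iff A).mp hA
  rw [← h.realPSL_wordMat] at hAL
  have hd := h.det_wordMat L
  rw [hL.neg_one_pow] at hd
  rw [hAL] at hord hgeo hfix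
  have htr := hord.trace_sq_eq hd hn hgeo
  have hq := cosPi_le_one n
  have hq0 := cosPi_nonneg hn
  obtain ⟨M, hM, hMtr, hAM⟩ : ∃ M : RMat, M.det = 1 ∧ M.trace = -2 * cosPi n ∧
      realPSL (wordMat R L) = realPSL M := by
    -- Only the squared trace is known; the sign of the matrix is chosen to make the trace −2
    -- cos(π/n).
    have h2 : ((wordMat R L).trace + 2 * cosPi n) * ((wordMat R L).trace - 2 * cosPi n) = 0 := by
      linear_combination htr
    rcases mul_eq_zero.mp h2 with h3 | h3
    · exact ⟨_, hd, by linarith, rfl⟩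
    · refine ⟨-wordMat R L, ?_, ?_, (realPSL_neg (by simp [hd])).symm⟩
      · rw [Matrix.det_neg, hd]; simp
      · rw [Matrix.trace_neg]; linarith
  rw [hAM] at hfix hAL
  have hdiag := diag_sub_eq hM (by rw [hMtr]; nlinarith) hfix
  rw [Matrix.trace_fin_two] at hMtr
  rw [Matrix.det_fin_two] at hM
  have h00 : M 0 0 = -cosPi n := by linarith
  have h11 : M 1 1 = -cosPi n := by linarith
  refine ⟨-M 0 1, M 1 0, ?_, ?_⟩
  · rw [sinPi_sq]
    rw [h00, h11] at hM
    linarith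
  · rw [hAL]
    congr 1
    ext i j
    fin_cases i <;> fin_cases j <;> simp [h00, h11]

theorem fixed_cases {q a c : ℝ} (hdet : (!![-q, -a; c, -q] : RMat).det ≠ 0) {z : OnePoint ℂ}
    (hz : mobius (realPSL !![-q, -a; c, -q]) z = z) (hup : IsUpper z)
    (hre : ∀ w : ℂ, z = w → w.re = 0) :
    (z = ∞ ∧ c = 0) ∨ ∃ y : ℝ, 0 ≤ y ∧ z = ((y * Complex.I : ℂ) : OnePoint ℂ) ∧ c * y ^ 2 = a := by
  rcases hup with rfl | ⟨w, rfl, hw⟩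
  · left
    exact ⟨rfl, by simpa using (realPSL_infty_fixed hdet).mp hz⟩
  · right
    have hwe : w = (w.im : ℂ) * Complex.I := by
      apply Complex.ext <;> simp [hre w rfl]
    refine ⟨w.im, hw, by rw [← hwe], ?_⟩
    have h1 := (realPSL_coe_fixed hdet w).mp hz
    rw [hwe, mul_pow, Complex.I_sq] at h1
    simp at h1
    have h2 : ((c * w.im ^ 2 - a : ℝ) : ℂ) = 0 := by push_cast; linear_combination -h1
    have h3 : c * w.im ^ 2 - a = 0 := by exact_mod_cast h2
    linarith

/-- A point yi is fixed exactly when cy² = a, and ∞ when c = 0, so proportional pairs (a, c) would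
have the same fixed point in the closed upper half-plane. -/
theorem not_proportional {a₁ c₁ a₂ c₂ : ℝ} {z₁ z₂ : OnePoint ℂ}
    (h₁ : (z₁ = ∞ ∧ c₁ = 0) ∨ ∃ y : ℝ, 0 ≤ y ∧ z₁ = ((y * Complex.I : ℂ) : OnePoint ℂ) ∧
      c₁ * y ^ 2 = a₁)
    (h₂ : (z₂ = ∞ ∧ c₂ = 0) ∨ ∃ y : ℝ, 0 ≤ y ∧ z₂ = ((y * Complex.I : ℂ) : OnePoint ℂ) ∧
      c₂ * y ^ 2 = a₂)
    (hne : z₁ ≠ z₂) (h₁0 : a₁ ≠ 0 ∨ c₁ ≠ 0) (h₂0 : a₂ ≠ 0 ∨ c₂ ≠ 0) (r : ℝ) :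
    ¬(a₁ = r * a₂ ∧ c₁ = r * c₂) := by
  rintro ⟨ha, hc⟩
  have hr : r ≠ 0 := by rintro rfl; rcases h₁0 with h | h <;> simp_all
  rcases h₁ with ⟨rfl, h1⟩ | ⟨y₁, hy₁, rfl, h1⟩
  · rw [hc] at h1
    have hc2 := (mul_eq_zero.mp h1).resolve_left hr
    rcases h₂ with ⟨rfl, -⟩ | ⟨y₂, hy₂, rfl, h2⟩
    · exact hne rfl
    · rw [hc2, zero_mul] at h2
      rcases h₂0 with h | h
      · exact h h2.symm
      · exact h hc2
  · have h1' : c₂ * y₁ ^ 2 = a₂ := by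
      apply mul_left_cancel₀ hr
      rw [← ha, ← h1, hc]; ring
    have hc2 : c₂ ≠ 0 := by
      rintro rfl
      rw [zero_mul] at h1'
      rcases h₂0 with h | h
      · exact h h1'.symm
      · exact h rfl
    rcases h₂ with ⟨rfl, h⟩ | ⟨y₂, hy₂, rfl, h2⟩
    · exact hc2 h
    · apply hne
      have : y₁ ^ 2 = y₂ ^ 2 := mul_left_cancel₀ hc2 (h1'.trans h2.symm)
      rw [(pow_left_inj₀ hy₁ hy₂ two_ne_zero).mp this]

/-- Well ordering puts z₁ above z₂ on the imaginary axis. For z₁ = y₁i and z₂ = y₂i the two sides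
are c₁c₂y₂² and c₁c₂y₁², and the sign hypothesis gives c₁c₂ ≥ 0. -/
theorem WellOrdered.le {a₁ c₁ a₂ c₂ : ℝ} {z₁ z₂ : OnePoint ℂ}
    (h₁ : (z₁ = ∞ ∧ c₁ = 0) ∨ ∃ y : ℝ, 0 ≤ y ∧ z₁ = ((y * Complex.I : ℂ) : OnePoint ℂ) ∧
      c₁ * y ^ 2 = a₁)
    (h₂ : (z₂ = ∞ ∧ c₂ = 0) ∨ ∃ y : ℝ, 0 ≤ y ∧ z₂ = ((y * Complex.I : ℂ) : OnePoint ℂ) ∧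
      c₂ * y ^ 2 = a₂)
    (hwo : WellOrdered ∞ ((0 : ℂ) : OnePoint ℂ) z₁ z₂) (h : 0 ≤ a₁ * c₂) :
    c₁ * a₂ ≤ a₁ * c₂ := by
  obtain ⟨hne, hwo⟩ := hwo
  rcases h₁ with ⟨rfl, h1⟩ | ⟨y₁, hy₁, rfl, h1⟩
  · rw [h1, zero_mul]; exact h
  rcases h₂ with ⟨rfl, h2⟩ | ⟨y₂, hy₂, rfl, h2⟩
  · exfalso
    rcases hwo with hz | hz | ⟨-, -, t, ht, hcr⟩
    · exact OnePoint.coe_ne_infty _ hz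
    · exact OnePoint.infty_ne_coe _ hz
    · simp [crossRatio, bracket, homog_infty, homog_coe] at hcr
      have : (0 : ℝ) = t := by exact_mod_cast hcr
      linarith
  · rcases hwo with hz | hz | ⟨-, -, t, ht, hcr⟩
    · exact absurd hz (OnePoint.coe_ne_infty _)
    · have hy : y₂ = 0 := by simpa using OnePoint.coe_injective hz
      rw [hy] at h2
      rw [← h2]
      simpa using h
    · have hyy : y₁ ≠ y₂ := by rintro rfl; exact hne rfl
      rw [crossRatio_infty_zero (fun h => hne (by rw [h])), ← sub_mul,
        mul_div_mul_right _ _ Complex.I_ne_zero] at hcr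
      have hcr' : y₁ / (y₁ - y₂) = t := by exact_mod_cast OnePoint.coe_injective hcr
      have hlt : y₂ < y₁ := by
        by_contra! hle
        have : y₁ / (y₁ - y₂) ≤ 0 := div_nonpos_of_nonneg_of_nonpos hy₁ (by linarith)
        linarith
      have hsq : y₂ ^ 2 < y₁ ^ 2 := by gcongr
      have hc : 0 ≤ c₁ * c₂ := by
        by_contra! hneg
        rw [← h1] at h
        have : 0 < y₁ ^ 2 := by have := sq_nonneg y₂; linarith
        nlinarith
      rw [← h1, ← h2]
      nlinarith

theorem IsHyperbolicSignature.nParam_eq {ν : Fin 3 → ℕ∞} :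
    sinPi (ν 0) ^ 2 * cosPi (ν 1) + cosPi (ν 0) * dParam ν = nParam ν := by
  rw [sinPi_sq, dParam, nParam]; ring

/-- The equations for the entries of canonical generators have only one solution. -/
theorem IsHyperbolicSignature.solve {ν : Fin 3 → ℕ∞} (hν : IsHyperbolicSignature ν)
    {a₁ c₁ a₂ c₂ : ℝ} (h₁ : a₁ * c₁ = sinPi (ν 0) ^ 2) (h₂ : a₂ * c₂ = sinPi (ν 1) ^ 2)
    (hs : a₁ * c₂ + c₁ * a₂ = 2 * (cosPi (ν 0) * cosPi (ν 1) + cosPi (ν 2)))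
    (hle : c₁ * a₂ ≤ a₁ * c₂)
    (hAB : a₁ * c₂ - c₁ * a₂ = 2 * (c₁ * cosPi (ν 1) + cosPi (ν 0) * c₂)) :
    !![-cosPi (ν 0), -a₁; c₁, -cosPi (ν 0)] = matA ν ∧
    !![-cosPi (ν 1), -a₂; c₂, -cosPi (ν 1)] = matB ν := by
  have hl := hν.lParam_pos
  have hn := hν.nParam_pos
  have hd := hν.dParam_pos
  have hq0 := cosPi_nonneg (hν.1 0)
  have hq1 := cosPi_nonneg (hν.1 1)
  have hlsq := hν.lParam_sq
  have hdef : dParam ν = cosPi (ν 0) * cosPi (ν 1) + cosPi (ν 2) + lParam ν := rfl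
  -- The sum and the product of a₁c₂ and c₁a₂ are known; their difference is ±2l, and the order of
  -- the two fixes the sign.
  have hdiff : a₁ * c₂ - c₁ * a₂ = 2 * lParam ν := by
    have h3 : (a₁ * c₂ - c₁ * a₂) ^ 2 = (2 * lParam ν) ^ 2 := by
      have : (a₁ * c₂ - c₁ * a₂) ^ 2 = (a₁ * c₂ + c₁ * a₂) ^ 2 - 4 * (a₁ * c₁) * (a₂ * c₂) := by
        ring
      rw [this, hs, h₁, h₂, mul_pow 2 (lParam ν), hlsq, sinPi_sq, sinPi_sq]; ring
    exact (pow_left_inj₀ (by linarith) (by positivity) two_ne_zero).mp h3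
  have hac : a₁ * c₂ = dParam ν := by linarith
  have hlin : c₁ * cosPi (ν 1) + cosPi (ν 0) * c₂ = lParam ν := by linarith
  have hc₂ : c₂ ≠ 0 := by rintro rfl; rw [mul_zero] at hac; exact hd.ne hac
  have h5 : dParam ν * c₁ = sinPi (ν 0) ^ 2 * c₂ := by
    rw [← hac, ← h₁]; ring
  have h6 : nParam ν * c₂ = dParam ν * lParam ν := by
    rw [← IsHyperbolicSignature.nParam_eq, ← hlin]
    linear_combination (-cosPi (ν 1)) * h5
  have e1 : c₂ = dParam ν * lParam ν / nParam ν := by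
    field_simp; linarith
  have e2 : a₁ = nParam ν / lParam ν := by
    apply mul_right_cancel₀ hc₂
    rw [hac, e1]; field_simp
  have e3 : c₁ = sinPi (ν 0) ^ 2 * lParam ν / nParam ν := by
    apply mul_left_cancel₀ hd.ne'
    rw [h5, e1]; field_simp
  have e4 : a₂ = nParam ν * sinPi (ν 1) ^ 2 / (lParam ν * dParam ν) := by
    apply mul_right_cancel₀ hc₂
    rw [h₂, e1]; field_simp
  exact ⟨by rw [matA, e2, e3], by rw [matB, e4, ← e1]⟩

/-- Uniqueness of canonical generators for the parameters `(∞, 0, 1)`. -/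
theorem IsHyperbolicSignature.eq_of_isCanonicalPair {ν : Fin 3 → ℕ∞}
    (hν : IsHyperbolicSignature ν) {A B : PSL(2, ℂ)}
    (hAB : IsCanonicalPair ∞ ((0 : ℂ) : OnePoint ℂ) ((1 : ℂ) : OnePoint ℂ) ν A B) :
    A = realPSL (matA ν) ∧ B = realPSL (matB ν) := by
  obtain ⟨Γ, hΓ, Λ, L, L', hΛ, ⟨hL, hL0, hL1⟩, ⟨hL', hL0', hL1'⟩, hlim, -, ⟨oA, oB, oAB⟩,
    ⟨fA, fB, fAB⟩, ⟨z₁, ⟨hz₁, hz₁'⟩, z₂, ⟨hz₂, hz₂'⟩, k1, k2, hwo⟩, ⟨pA, pB⟩, gA, gB⟩ := hAB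
  obtain ⟨-, -, -, -, hΛR⟩ := points_eq_realLine hΛ.1 hΛ.2.1 hΛ.2.2
  rw [hΛR] at hlim
  obtain ⟨R, hR, rfl⟩ := hΓ.exists_mirrors hν hlim
  have hLz := points_eq_of_orthogonal hΛ hL hL0 (t := 0) (by simpa using hL1)
  have hLz' := points_eq_of_orthogonal hΛ hL' hL0' (t := 1) (by simpa using hL1')
  rw [mem_closure_disc_standard] at hz₁' hz₂'
  have fA' : ∀ z : ℂ, mobius A z = z → z.re = 0 := fun z hz => (hLz z).mp (fA z hz)
  have fB' : ∀ z : ℂ, mobius B z = z → z.re = 0 := fun z hz => (hLz z).mp (fB z hz)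
  have fAB' : ∀ z : ℂ, mobius (A * B) z = z → z.re = 1 := fun z hz => (hLz' z).mp (fAB z hz)
  have r1 : ∀ w : ℂ, z₁ = w → w.re = 0 := fun w hw => (hLz w).mp (hw ▸ hz₁)
  have r2 : ∀ w : ℂ, z₂ = w → w.re = 0 := fun w hw => (hLz w).mp (hw ▸ hz₂)
  have hdet : ∀ {n : ℕ∞} {a c : ℝ}, a * c = sinPi n ^ 2 →
      (!![-cosPi n, -a; c, -cosPi n] : RMat).det = 1 := by
    intro n a c h
    rw [Matrix.det_fin_two_of]
    rw [sinPi_sq] at h; linarith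
  have hq := fun i => cosPi_nonneg (hν.1 i)
  have hq2 := cosPi_le_one (ν 2)
  have hcross : 0 < cosPi (ν 0) * cosPi (ν 1) + cosPi (ν 2) := hν.cos_cross_pos 2
  -- Stated for arbitrary representing matrices of this shape, so that it can be used again after a
  -- change of sign.
  have key : ∀ a₁ c₁ a₂ c₂ : ℝ, a₁ * c₁ = sinPi (ν 0) ^ 2 → a₂ * c₂ = sinPi (ν 1) ^ 2 →
      A = realPSL !![-cosPi (ν 0), -a₁; c₁, -cosPi (ν 0)] →
      B = realPSL !![-cosPi (ν 1), -a₂; c₂, -cosPi (ν 1)] →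
      (2 * (cosPi (ν 0) * cosPi (ν 1) + cosPi (ν 2)) ≤ |a₁ * c₂ + c₁ * a₂| ∧
        |2 * cosPi (ν 0) * cosPi (ν 1) - (a₁ * c₂ + c₁ * a₂)| ≤ 2 * cosPi (ν 2)) ∧
      (0 ≤ a₁ * c₂ + c₁ * a₂ → A = realPSL (matA ν) ∧ B = realPSL (matB ν)) := by
    intro a₁ c₁ a₂ c₂ h₁ h₂ hA hB
    set MA : RMat := !![-cosPi (ν 0), -a₁; c₁, -cosPi (ν 0)] with hMA
    set MB : RMat := !![-cosPi (ν 1), -a₂; c₂, -cosPi (ν 1)] with hMB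
    have dA : MA.det = 1 := hdet h₁
    have dB : MB.det = 1 := hdet h₂
    have tA : tracelessPart MA = ![0, a₁, c₁] := by
      ext i; fin_cases i <;> simp [tracelessPart, hMA]
    have tB : tracelessPart MB = ![0, a₂, c₂] := by
      ext i; fin_cases i <;> simp [tracelessPart, hMB]
    have hMAB : realPSL MA * realPSL MB = realPSL (MA * MB) :=
      (realPSL_mul (by simp [dA]) (by simp [dB])).symm
    have trAB : (MA * MB).trace =
        2 * cosPi (ν 0) * cosPi (ν 1) - (a₁ * c₂ + c₁ * a₂) := by
      simp [hMA, hMB, Matrix.trace_fin_two]; ring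
    rw [hA] at k1 oA gA pA oAB fAB'
    rw [hB] at k2 oB gB pB oAB fAB'
    rw [hMAB] at oAB fAB'
    have hne1 := oA.ne_one (hν.1 0)
    have hne2 := oB.ne_one (hν.1 1)
    have n1 : a₁ ≠ 0 ∨ c₁ ≠ 0 := by
      by_contra! hcon
      refine hne1 (realPSL_eq_one_of_tracelessPart (by simp [dA]) ?_)
      rw [tA, hcon.1, hcon.2]; ext i; fin_cases i <;> rfl
    have n2 : a₂ ≠ 0 ∨ c₂ ≠ 0 := by
      by_contra! hcon
      refine hne2 (realPSL_eq_one_of_tracelessPart (by simp [dB]) ?_)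
      rw [tB, hcon.1, hcon.2]; ext i; fin_cases i <;> rfl
    have f1 := fixed_cases (by rw [← hMA, dA]; simp) k1 hz₁' r1
    have f2 := fixed_cases (by rw [← hMB, dB]; simp) k2 hz₂' r2
    have hprop := not_proportional f1 f2 hwo.1 n1 n2
    obtain ⟨LA, i, c, hc, hi, hLA⟩ := hR.exists_vertex hν dA (hν.1 0)
      (by simp [hMA, Matrix.trace_fin_two]; ring) oA pA
    obtain ⟨LB, j, d, hd, hj, hLB⟩ := hR.exists_vertex hν dB (hν.1 1)
      (by simp [hMB, Matrix.trace_fin_two]; ring) oB pB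
    -- The distance of the two vertices bounds |a₁c₂ + c₁a₂| from below; their fixed points are
    -- distinct by the well ordering.
    have hdist := hR.le_sq_form hν hc hd hi hj hLA hLB (by
      intro r hr
      rw [tA, tB] at hr
      exact hprop r ⟨by simpa using congrFun hr 1, by simpa using congrFun hr 2⟩)
    have hb1 : 2 * (cosPi (ν 0) * cosPi (ν 1) + cosPi (ν 2)) ≤ |a₁ * c₂ + c₁ * a₂| := by
      have : form (tracelessPart MA) (tracelessPart MB) = -((a₁ * c₂ + c₁ * a₂) / 2) := by
        rw [tA, tB]; simp [form_apply]
      rw [this, abs_neg, abs_div, abs_two] at hdist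
      linarith
    have dAB : (MA * MB).det = 1 := by rw [Matrix.det_mul, dA, dB, one_mul]
    -- AB is not assumed to be geometric, so its order gives only an upper bound for |tr AB|.
    have hb2 : |2 * cosPi (ν 0) * cosPi (ν 1) - (a₁ * c₂ + c₁ * a₂)| ≤ 2 * cosPi (ν 2) := by
      have := oAB.trace_sq_le dAB (hν.1 2)
      rw [trAB] at this
      refine abs_le_of_sq_le_sq (by linarith) (by linarith [hq 2])
    refine ⟨⟨hb1, hb2⟩, fun hs => ?_⟩
    rw [abs_of_nonneg hs] at hb1
    have hb2' := (abs_le.mp hb2).1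
    have hs2 : a₁ * c₂ + c₁ * a₂ = 2 * (cosPi (ν 0) * cosPi (ν 1) + cosPi (ν 2)) := by linarith
    have hdiag := diag_sub_eq dAB (by rw [trAB, hs2]; nlinarith [hq 2]) fAB'
    have hrel : a₁ * c₂ - c₁ * a₂ = 2 * (c₁ * cosPi (ν 1) + cosPi (ν 0) * c₂) := by
      simp [hMA, hMB] at hdiag
      linarith
    have hprod : 0 ≤ (a₁ * c₂) * (c₁ * a₂) := by
      have : (a₁ * c₂) * (c₁ * a₂) = sinPi (ν 0) ^ 2 * sinPi (ν 1) ^ 2 := by rw [← h₁, ← h₂]; ring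
      rw [this]; positivity
    -- The two numbers a₁c₂ and c₁a₂ have a nonnegative product and a positive sum.
    have hpos : 0 ≤ a₁ * c₂ := by
      by_contra! hneg
      nlinarith
    have hle := WellOrdered.le f1 f2 hwo hpos
    obtain ⟨e1, e2⟩ := hν.solve h₁ h₂ hs2 hle hrel
    rw [hA, hB, ← e1, ← e2]
    exact ⟨rfl, rfl⟩
  obtain ⟨a₁, c₁, h₁, hA⟩ := hR.exists_matrix pA.1 (hν.1 0) oA gA fA'
  obtain ⟨a₂, c₂, h₂, hB⟩ := hR.exists_matrix pB.1 (hν.1 1) oB gB fB'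
  obtain ⟨⟨hb1, hb2⟩, hmain⟩ := key a₁ c₁ a₂ c₂ h₁ h₂ hA hB
  by_cases hs : 0 ≤ a₁ * c₂ + c₁ * a₂
  · exact hmain hs
  push Not at hs
  rw [abs_of_neg hs] at hb1
  have hb2' := (abs_le.mp hb2).2
  -- With a negative sum the two bounds leave only q₁q₂ = 0. Then A or B has trace zero, and
  -- replacing its matrix by the negative keeps the normal form and reverses the sign of the sum.
  have hzero : cosPi (ν 0) * cosPi (ν 1) = 0 :=
    le_antisymm (by linarith) (mul_nonneg (hq 0) (hq 1))
  rcases mul_eq_zero.mp hzero with h0 | h0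
  · refine (key (-a₁) (-c₁) a₂ c₂ (by linarith) h₂ ?_ hB).2 (by linarith)
    rw [hA, ← realPSL_neg (by rw [hdet h₁]; simp)]
    congr 1
    ext i j
    fin_cases i <;> fin_cases j <;> simp [h0]
  · refine (key a₁ c₁ (-a₂) (-c₂) h₁ (by linarith) hA ?_).2 (by linarith)
    rw [hB, ← realPSL_neg (by rw [hdet h₂]; simp)]
    congr 1
    ext i j
    fin_cases i <;> fin_cases j <;> simp [h0]

end TriangleGroups

end

theorem theorem3 :
    -- existence and uniqueness, for all parameters and all hyperbolic signatures
    (∀ (a b c : OnePoint ℂ) (ν : Fin 3 → ℕ∞), a ≠ b → a ≠ c → b ≠ c →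
      TriangleGroups.IsHyperbolicSignature ν →
      ∃! P : PSL(2, ℂ) × PSL(2, ℂ), TriangleGroups.IsCanonicalPair a b c ν P.1 P.2) ∧
    -- the generators for `(∞, 0, 1)` and `(0, 3; ∞, ν₁, ν₂)`
    (∀ ν₁ ν₂ : ℕ∞, TriangleGroups.IsHyperbolicSignature ![⊤, ν₁, ν₂] →
      ∃ A B : PSL(2, ℂ),
        TriangleGroups.IsClassOf A !![-1, -2; 0, -1] ∧
        TriangleGroups.IsClassOf B
          !![-TriangleGroups.cosPi ν₁,
              (TriangleGroups.cosPi ν₁ ^ 2 - 1) /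
                (TriangleGroups.cosPi ν₁ + TriangleGroups.cosPi ν₂);
             TriangleGroups.cosPi ν₁ + TriangleGroups.cosPi ν₂, -TriangleGroups.cosPi ν₁] ∧
        TriangleGroups.IsCanonicalPair ∞ ((0 : ℂ) : OnePoint ℂ) ((1 : ℂ) : OnePoint ℂ)
          ![⊤, ν₁, ν₂] A B) ∧
    -- the generators for `(∞, 0, 1)` and `(0, 3; ν₁, ν₂, ν₃)` with all `ν j` finite
    (∀ ν : Fin 3 → ℕ∞, TriangleGroups.IsHyperbolicSignature ν → (∀ j, ν j ≠ ⊤) →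
      0 < TriangleGroups.lSq ν ∧
      ∃ A B : PSL(2, ℂ),
        TriangleGroups.IsClassOf A
          !![-TriangleGroups.cosPi (ν 0),
              -(TriangleGroups.kParam ν * TriangleGroups.sinPi (ν 0));
             (TriangleGroups.kParam ν)⁻¹ * TriangleGroups.sinPi (ν 0),
              -TriangleGroups.cosPi (ν 0)] ∧
        TriangleGroups.IsClassOf B
          !![-TriangleGroups.cosPi (ν 1),
              -(TriangleGroups.hParam ν * TriangleGroups.sinPi (ν 1));
             (TriangleGroups.hParam ν)⁻¹ * TriangleGroups.sinPi (ν 1),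
              -TriangleGroups.cosPi (ν 1)] ∧
        TriangleGroups.IsCanonicalPair ∞ ((0 : ℂ) : OnePoint ℂ) ((1 : ℂ) : OnePoint ℂ) ν A B) ∧
    -- all other parameters: conjugation by the Moebius transformation `T` that maps
    -- `a, b, c` to `∞, 0, 1`
    (∀ a b c : OnePoint ℂ, a ≠ b → a ≠ c → b ≠ c →
      ∃ T : PSL(2, ℂ),
        (∀ T' : PSL(2, ℂ),
          (TriangleGroups.mobius T' a = ∞ ∧ TriangleGroups.mobius T' b = ((0 : ℂ) : OnePoint ℂ) ∧
            TriangleGroups.mobius T' c = ((1 : ℂ) : OnePoint ℂ)) ↔ T' = T) ∧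
        ∀ (ν : Fin 3 → ℕ∞) (A B : PSL(2, ℂ)), TriangleGroups.IsHyperbolicSignature ν →
          TriangleGroups.IsCanonicalPair ∞ ((0 : ℂ) : OnePoint ℂ) ((1 : ℂ) : OnePoint ℂ) ν A B →
          TriangleGroups.IsCanonicalPair a b c ν (T⁻¹ * A * T) (T⁻¹ * B * T)) := by
  have transfer : ∀ (a b c : OnePoint ℂ) (ν : Fin 3 → ℕ∞) (T A B : PSL(2, ℂ)),
      TriangleGroups.mobius T a = ∞ → TriangleGroups.mobius T b = ((0 : ℂ) : OnePoint ℂ) →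
      TriangleGroups.mobius T c = ((1 : ℂ) : OnePoint ℂ) →
      TriangleGroups.IsCanonicalPair ∞ ((0 : ℂ) : OnePoint ℂ) ((1 : ℂ) : OnePoint ℂ) ν A B →
      TriangleGroups.IsCanonicalPair a b c ν (T⁻¹ * A * T) (T⁻¹ * B * T) := by
    intro a b c ν T A B ha hb hc h
    have h' := h.conj T⁻¹
    rwa [map_inv, ← ha, ← hb, ← hc, Equiv.Perm.inv_def, Equiv.symm_apply_apply,
      Equiv.symm_apply_apply, Equiv.symm_apply_apply, inv_inv] at h'
  refine ⟨fun a b c ν hab hac hbc hν => ?_, fun ν₁ ν₂ hν => ?_, fun ν hν hfin => ?_,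
    fun a b c hab hac hbc => ?_⟩
  · obtain ⟨T, ha, hb, hc⟩ := TriangleGroups.exists_mobius_standard hab hac hbc
    refine ⟨(_, _), transfer a b c ν T _ _ ha hb hc hν.isCanonicalPair, ?_⟩
    rintro ⟨A, B⟩ hAB
    have h := TriangleGroups.IsCanonicalPair.conj T hAB
    rw [ha, hb, hc] at h
    obtain ⟨hA, hB⟩ := hν.eq_of_isCanonicalPair h
    rw [← hA, ← hB]
    ext1 <;> simp [mul_assoc]
  · obtain ⟨hA, hB⟩ := TriangleGroups.matA_parabolic hν
    exact ⟨_, _, hA ▸ TriangleGroups.isClassOf_realPSL hν.det_matA,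
      hB ▸ TriangleGroups.isClassOf_realPSL hν.det_matB, hν.isCanonicalPair⟩
  · obtain ⟨hA, hB⟩ := TriangleGroups.mat_finite hν hfin
    exact ⟨hν.lSq_pos, _, _, hA ▸ TriangleGroups.isClassOf_realPSL hν.det_matA,
      hB ▸ TriangleGroups.isClassOf_realPSL hν.det_matB, hν.isCanonicalPair⟩
  · obtain ⟨T, ha, hb, hc⟩ := TriangleGroups.exists_mobius_standard hab hac hbc
    refine ⟨T, fun T' => ⟨?_, ?_⟩, fun ν A B _ h => transfer a b c ν T A B ha hb hc h⟩
    · rintro ⟨ha', hb', hc'⟩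
      refine mul_inv_eq_one.mp (TriangleGroups.eq_one_of_fixes_three (A := T' * T⁻¹) ?_ ?_ ?_)
      · rw [map_mul, map_inv, Equiv.Perm.mul_apply, ← ha, Equiv.Perm.inv_def,
          Equiv.symm_apply_apply, ha', ha]
      · rw [map_mul, map_inv, Equiv.Perm.mul_apply, ← hb, Equiv.Perm.inv_def,
          Equiv.symm_apply_apply, hb', hb]
      · rw [map_mul, map_inv, Equiv.Perm.mul_apply, ← hc, Equiv.Perm.inv_def,
          Equiv.symm_apply_apply, hc', hc]
    · rintro rfl
      exact ⟨ha, hb, hc⟩
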